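/- Let $p,q,i,r,s\ge 0$ be integers with $r\le p$, $s\le q$, $r+s\le i$, and put $\nu=i-r-s$, $\hat r=p-r-\nu$, $\hat s=q-s-\nu$. Let $b$ be the standard symmetric bilinear form of signature $(p,q)$ on $\mathbb R^{p+q}$ (written $\mathbb R^{(p,q)}$ with this form), $H=SO(p,q)\subset G=SL(p+q,\mathbb R)$ its special orthogonal group, $\mathcal O=\mathcal O_{(r,s)}\subset Gr(i,\mathbb R^{p+q})$ the set of $i$-dimensional subspaces $W$ such that $b|_{W\times W}$ has signature $(r,s)$, and $IGr(\nu,\mathbb R^{(p,q)})\subset Gr(\nu,\mathbb R^{p+q})$ the set of totally isotropic subspaces of dimension $\nu$. Unless $r=s=0$ and $p=q=\nu$, the set $\mathcal O$ is, if non-empty, a single $H$-orbit. Moreover: (1) $\mathcal O$ is non-empty if and only if $\nu\le\min(p-r,q-s)$, i.e. if and only if $\hat r\ge 0$ and $\hat s\ge 0$. In that case, $\mathcal O$ is an embedded submanifold of $Gr(i,\mathbb R^{p+q})$ of codimension $\nu(\nu+1)/2$. (2) Suppose that $\mathcal O\neq\emptyset$. Then $IGr(\nu,\mathbb R^{(p,q)})$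 is an embedded submanifold of $Gr(\nu,\mathbb R^{p+q})$, and $W\mapsto W\cap W^\perp$ defines an $H$-equivariant surjective smooth submersion $\mathcal O\to IGr(\nu,\mathbb R^{(p,q)})$. Each of its fibers is an embedded submanifold of $Gr(i,\mathbb R^{p+q})$ isomorphic to the symmetric space $SO(p-\nu,q-\nu)/S(O(r,s)\times O(\hat r,\hat s))$. Here $S(O(r,s)\times O(\hat r,\hat s))$ is the group of block diagonal matrices in $SO(p-\nu,q-\nu)$ with respect to $\mathbb R^{(p-\nu,q-\nu)}=\mathbb R^{(r,s)}\oplus\mathbb R^{(\hat r,\hat s)}$; it is the fixed point group of a continuous involutive automorphism $\sigma$ of $SO(p-\nu,q-\nu)$ (i.e. $\sigma^2=\mathrm{id}$). The isomorphism is a diffeomorphism, and it is equivariant for the action of the stabilizer in $H$ of the base point $N\in IGr(\nu,\mathbb R^{(p,q)})$, which acts on the symmetric space through a surjective homomorphism onto $SO(p-\nu,q-\nu)$. (3) Suppose that $\mathcal O\neq\emptyset$, let $o\in Gr(i,\mathbb R^{p+q})$ be any point, and let $P\subset G$ be the stabilizer of $o$. There are $g\in G$ with $g\cdot o\in\mathcal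 O$. For any such $g$ put $H_{\mathcal O}=g^{-1}Hg$, which is the special orthogonal group of the form $b_g(x,y)=b(gx,gy)$, and let $\mathfrak g,\mathfrak p,\mathfrak h_{\mathcal O}$ be the Lie algebras of $G,P,H_{\mathcal O}$. Then there is a natural surjective continuous homomorphism $H_{\mathcal O}\cap P\to GL(\nu,\mathbb R)\times S(O(r,s)\times O(\hat r,\hat s))$: with $R=o\cap o^{\perp}$ (with respect to $b_g$), it sends an element to the maps it induces on $R\cong\mathbb R^\nu$ and on $R^\perp/R\cong\mathbb R^{(p-\nu,q-\nu)}$, where the last isomorphism is compatible with the forms and maps $o/R$ onto $\mathbb R^{(r,s)}$. The representation of $H_{\mathcal O}\cap P$ on $S^2\mathbb R^{\nu*}$ (symmetric bilinear forms on $\mathbb R^\nu$) which it induces through the natural representation of $GL(\nu,\mathbb R)$ is isomorphic to the representation on the infinitesimal transversal $(\mathfrak g/\mathfrak p)/(\mathfrak h_{\mathcal O}/(\mathfrak h_{\mathcal O}\cap\mathfrak p))$ induced by the adjoint action. -/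

import Mathlib

open scoped Manifold ContDiff Matrix

noncomputable section

/-! ### Grassmannians as smooth manifolds -/

section Grassmannian

/-- The Grassmannian `Gr(k, V)` of `k`-dimensional linear subspaces of `V`. -/
@[ext]
structure Gr (k : ℕ) (V : Type*) [AddCommGroup V] [Module ℝ V] where
  toSubmodule : Submodule ℝ V
  finrank_eq : Module.finrank ℝ toSubmodule = k

/-- The model space of `Gr(k, V)`: linear maps from `ℝ^k` to `ℝ^(dim V - k)`. -/
abbrev GrModel (k : ℕ) (V : Type*) [AddCommGroup V] [Module ℝ V] : Type :=
  (Fin k → ℝ) →L[ℝ] (Fin (Module.finrank ℝ V - k) → ℝ)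

/-- Linear coordinates on `V` which split it as `ℝ^k × ℝ^(dim V - k)`. -/
abbrev GrSplit (k : ℕ) (V : Type*) [AddCommGroup V] [Module ℝ V] : Type _ :=
  V ≃ₗ[ℝ] (Fin k → ℝ) × (Fin (Module.finrank ℝ V - k) → ℝ)

variable {k : ℕ} {V : Type*} [AddCommGroup V] [Module ℝ V]

/-- The subspace which in the coordinates `φ` is the graph of the linear map `A`. -/
def Gr.graph (φ : GrSplit k V) (A : GrModel k V) : Gr k V :=
  ⟨A.toLinearMap.graph.map φ.symm.toLinearMap, by
    rw [LinearEquiv.finrank_map_eq φ.symm]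
    have e : (Fin k → ℝ) ≃ₗ[ℝ] A.toLinearMap.graph :=
      LinearEquiv.ofBijective
        ((LinearMap.id.prod A.toLinearMap).codRestrict _ (fun x => by
          simp [LinearMap.mem_graph_iff]))
        ⟨fun x y h => by simpa using congrArg (fun z => z.1.1) h, fun z => ⟨z.1.1, by
          have := z.2
          rw [LinearMap.mem_graph_iff] at this
          ext1
          exact Prod.ext rfl this.symm⟩⟩
    rw [← e.finrank_eq]; simp⟩

theorem Gr.mem_graph {φ : GrSplit k V} {A : GrModel k V} {v : V} :
    v ∈ (Gr.graph φ A).1 ↔ (φ v).2 = A (φ v).1 := by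
  constructor
  · rintro ⟨z, hz, rfl⟩
    simpa using hz
  · intro h
    exact ⟨φ v, by simpa using h, by simp⟩

theorem Gr.graph_injective (φ : GrSplit k V) : Function.Injective (Gr.graph φ) := by
  intro A B h
  ext1 x
  have h1 : φ.symm (x, A x) ∈ (Gr.graph φ A).1 := by simp [Gr.mem_graph]
  rw [h] at h1
  simpa [Gr.mem_graph] using h1

/-- The standard chart of `Gr(k, V)` attached to the coordinates `φ`: it is defined on those
subspaces which are graphs over the first factor, and maps the graph of `A` to `A`. -/
def Gr.chart (φ : GrSplit k V) : PartialEquiv (Gr k V) (GrModel k V) where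
  toFun := Function.invFun (Gr.graph φ)
  invFun := Gr.graph φ
  source := Set.range (Gr.graph φ)
  target := Set.univ
  map_source' _ _ := Set.mem_univ _
  map_target' A _ := ⟨A, rfl⟩
  left_inv' := by
    rintro _ ⟨A, rfl⟩
    rw [Function.leftInverse_invFun (Gr.graph_injective φ) A]
  right_inv' A _ := Function.leftInverse_invFun (Gr.graph_injective φ) A

/-- The first component of the coordinate change from `φ` to `ψ` on the graph of `A`. -/
def Gr.changeFst (φ ψ : GrSplit k V) (A : GrModel k V) : (Fin k → ℝ) →L[ℝ] (Fin k → ℝ) :=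
  (LinearMap.toContinuousLinearMap
    (LinearMap.fst ℝ _ _ ∘ₗ (φ.symm.trans ψ).toLinearMap ∘ₗ LinearMap.inl ℝ _ _)) +
  (LinearMap.toContinuousLinearMap
    (LinearMap.fst ℝ _ _ ∘ₗ (φ.symm.trans ψ).toLinearMap ∘ₗ LinearMap.inr ℝ _ _)).comp A

/-- The second component of the coordinate change from `φ` to `ψ` on the graph of `A`. -/
def Gr.changeSnd (φ ψ : GrSplit k V) (A : GrModel k V) : GrModel k V :=
  (LinearMap.toContinuousLinearMap
    (LinearMap.snd ℝ _ _ ∘ₗ (φ.symm.trans ψ).toLinearMap ∘ₗ LinearMap.inl ℝ _ _)) +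
  (LinearMap.toContinuousLinearMap
    (LinearMap.snd ℝ _ _ ∘ₗ (φ.symm.trans ψ).toLinearMap ∘ₗ LinearMap.inr ℝ _ _)).comp A

theorem Gr.change_apply (φ ψ : GrSplit k V) (A : GrModel k V) (x : Fin k → ℝ) :
    ψ (φ.symm (x, A x)) = (Gr.changeFst φ ψ A x, Gr.changeSnd φ ψ A x) := by
  have h : ((x, A x) : (Fin k → ℝ) × (Fin (Module.finrank ℝ V - k) → ℝ)) = (x, 0) + (0, A x) := by
    simp
  rw [h, map_add, map_add]
  ext1 <;> simp [Gr.changeFst, Gr.changeSnd]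

theorem Gr.graph_eq_graph_iff (φ ψ : GrSplit k V) (A B : GrModel k V) :
    Gr.graph φ A = Gr.graph ψ B ↔
      IsUnit (Gr.changeFst φ ψ A) ∧
        B = (Gr.changeSnd φ ψ A).comp (Ring.inverse (Gr.changeFst φ ψ A)) := by
  constructor
  · intro h
    have key : ∀ x, Gr.changeSnd φ ψ A x = B (Gr.changeFst φ ψ A x) := by
      intro x
      have h1 : φ.symm (x, A x) ∈ (Gr.graph φ A).1 := by simp [Gr.mem_graph]
      rw [h, Gr.mem_graph, Gr.change_apply] at h1
      exact h1
    have hinj : Function.Injective (Gr.changeFst φ ψ A) := by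
      rw [injective_iff_map_eq_zero]
      intro x hx
      have h1 := Gr.change_apply φ ψ A x
      rw [key, hx, map_zero] at h1
      have h2 : ψ (φ.symm (x, A x)) = 0 := h1
      simp at h2
      exact h2.1
    have hu : IsUnit (Gr.changeFst φ ψ A) := by
      have e := LinearEquiv.ofInjectiveEndo
        (Gr.changeFst φ ψ A : (Fin k → ℝ) →ₗ[ℝ] (Fin k → ℝ)) hinj
      let e' := (LinearEquiv.ofInjectiveEndo
        (Gr.changeFst φ ψ A : (Fin k → ℝ) →ₗ[ℝ] (Fin k → ℝ)) hinj).toContinuousLinearEquiv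
      refine ⟨ContinuousLinearEquiv.toUnit e', ?_⟩
      ext x
      rfl
    refine ⟨hu, ?_⟩
    have h2 : Gr.changeSnd φ ψ A = B.comp (Gr.changeFst φ ψ A) := by
      ext1 x; exact key x
    rw [h2, ContinuousLinearMap.comp_assoc]
    have := Ring.mul_inverse_cancel _ hu
    change B = B.comp (Gr.changeFst φ ψ A * Ring.inverse (Gr.changeFst φ ψ A))
    rw [this]
    rfl
  · rintro ⟨hu, rfl⟩
    apply Gr.ext
    ext v
    constructor
    · intro hv
      rw [Gr.mem_graph] at hv ⊢
      have h1 := Gr.change_apply φ ψ A (φ v).1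
      rw [← hv] at h1
      simp only [Prod.mk.eta, LinearEquiv.symm_apply_apply] at h1
      rw [h1]
      change _ = Gr.changeSnd φ ψ A
        ((Ring.inverse (Gr.changeFst φ ψ A) * Gr.changeFst φ ψ A) (φ v).1)
      rw [Ring.inverse_mul_cancel _ hu]
      rfl
    · intro hv
      rw [Gr.mem_graph] at hv
      set x := Ring.inverse (Gr.changeFst φ ψ A) (ψ v).1 with hx
      have h1 : Gr.changeFst φ ψ A x = (ψ v).1 := by
        change (Gr.changeFst φ ψ A * Ring.inverse (Gr.changeFst φ ψ A)) (ψ v).1 = _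
        rw [Ring.mul_inverse_cancel _ hu]
        rfl
      have h2 : ψ v = ψ (φ.symm (x, A x)) := by
        rw [Gr.change_apply, h1]
        exact Prod.ext rfl hv
      have h3 : v = φ.symm (x, A x) := ψ.injective h2
      rw [h3, Gr.mem_graph]
      simp

theorem Gr.chart_trans_source (φ ψ : GrSplit k V) :
    ((Gr.chart φ).symm.trans (Gr.chart ψ)).source = {A | IsUnit (Gr.changeFst φ ψ A)} := by
  ext A
  simp only [PartialEquiv.trans_source, PartialEquiv.symm_source, Set.mem_inter_iff,
    Set.mem_preimage, Set.mem_ofPred_eq]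
  constructor
  · rintro ⟨-, B, hB⟩
    exact ((Gr.graph_eq_graph_iff φ ψ A B).1 hB.symm).1
  · intro h
    exact ⟨Set.mem_univ _, _, ((Gr.graph_eq_graph_iff φ ψ A _).2 ⟨h, rfl⟩).symm⟩

theorem Gr.chart_trans_apply (φ ψ : GrSplit k V) {A : GrModel k V}
    (hA : IsUnit (Gr.changeFst φ ψ A)) :
    ((Gr.chart φ).symm.trans (Gr.chart ψ)) A =
      (Gr.changeSnd φ ψ A).comp (Ring.inverse (Gr.changeFst φ ψ A)) := by
  change Function.invFun (Gr.graph ψ) (Gr.graph φ A) = _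
  rw [(Gr.graph_eq_graph_iff φ ψ A _).2 ⟨hA, rfl⟩]
  exact Function.leftInverse_invFun (Gr.graph_injective ψ) _

theorem Gr.contDiff_changeFst (φ ψ : GrSplit k V) : ContDiff ℝ ∞ (Gr.changeFst φ ψ) :=
  contDiff_const.add (contDiff_const.clm_comp contDiff_id)

theorem Gr.contDiff_changeSnd (φ ψ : GrSplit k V) : ContDiff ℝ ∞ (Gr.changeSnd φ ψ) :=
  contDiff_const.add (contDiff_const.clm_comp contDiff_id)

theorem Gr.contDiffOn_chart_trans (φ ψ : GrSplit k V) :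
    ContDiffOn ℝ ∞ ((Gr.chart φ).symm.trans (Gr.chart ψ))
      ((Gr.chart φ).symm.trans (Gr.chart ψ)).source := by
  rw [Gr.chart_trans_source]
  have h : ContDiffOn ℝ ∞ (fun A => (Gr.changeSnd φ ψ A).comp (Ring.inverse (Gr.changeFst φ ψ A)))
      {A | IsUnit (Gr.changeFst φ ψ A)} := by
    intro A hA
    obtain ⟨u, hu⟩ := hA
    have h0 : ContDiffAt ℝ ∞ Ring.inverse (Gr.changeFst φ ψ A) := by
      rw [← hu]
      exact contDiffAt_ringInverse ℝ u
    have h1 : ContDiffAt ℝ ∞ (fun A => Ring.inverse (Gr.changeFst φ ψ A)) A :=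
      h0.comp A (Gr.contDiff_changeFst φ ψ).contDiffAt
    exact ((Gr.contDiff_changeSnd φ ψ).contDiffAt.clm_comp h1).contDiffWithinAt
  exact h.congr fun A hA => Gr.chart_trans_apply φ ψ hA

variable [FiniteDimensional ℝ V]

theorem Gr.exists_mem_chart (W : Gr k V) : ∃ φ : GrSplit k V, W ∈ (Gr.chart φ).source := by
  obtain ⟨C, hC⟩ := Submodule.exists_isCompl W.1
  have hd : Module.finrank ℝ C = Module.finrank ℝ V - k := by
    have := Submodule.finrank_add_eq_of_isCompl hC
    rw [W.2] at this
    omega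
  let e1 : W.1 ≃ₗ[ℝ] (Fin k → ℝ) := LinearEquiv.ofFinrankEq _ _ (by rw [W.2]; simp)
  let e2 : C ≃ₗ[ℝ] (Fin (Module.finrank ℝ V - k) → ℝ) :=
    LinearEquiv.ofFinrankEq _ _ (by rw [hd]; simp)
  let φ : GrSplit k V := (Submodule.prodEquivOfIsCompl _ _ hC).symm.trans (e1.prodCongr e2)
  refine ⟨φ, 0, ?_⟩
  apply Gr.ext
  ext v
  rw [Gr.mem_graph]
  simp [φ]

/-- The standard smooth atlas of the Grassmannian. -/
def Gr.chartedSpaceCore (k : ℕ) (V : Type*) [AddCommGroup V] [Module ℝ V] [FiniteDimensional ℝ V] :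
    ChartedSpaceCore (GrModel k V) (Gr k V) where
  atlas := Set.range Gr.chart
  chartAt W := Gr.chart (Gr.exists_mem_chart W).choose
  mem_chart_source W := (Gr.exists_mem_chart W).choose_spec
  chart_mem_atlas W := ⟨_, rfl⟩
  open_source := by
    rintro _ _ ⟨φ, rfl⟩ ⟨ψ, rfl⟩
    rw [Gr.chart_trans_source]
    exact Units.isOpen.preimage (Gr.contDiff_changeFst φ ψ).continuous
  continuousOn_toFun := by
    rintro _ _ ⟨φ, rfl⟩ ⟨ψ, rfl⟩
    exact (Gr.contDiffOn_chart_trans φ ψ).continuousOn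

instance : TopologicalSpace (Gr k V) := (Gr.chartedSpaceCore k V).toTopologicalSpace

instance : ChartedSpace (GrModel k V) (Gr k V) := (Gr.chartedSpaceCore k V).toChartedSpace

instance : IsManifold 𝓘(ℝ, GrModel k V) ∞ (Gr k V) := by
  apply isManifold_of_contDiffOn
  intro e e' he he'
  obtain ⟨_, ⟨_, rfl⟩, _, ⟨⟨φ, rfl⟩, rfl⟩, h⟩ := he
  obtain ⟨_, ⟨_, rfl⟩, _, ⟨⟨ψ, rfl⟩, rfl⟩, h'⟩ := he'
  rw [Set.mem_singleton_iff.1 h, Set.mem_singleton_iff.1 h']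
  have := Gr.contDiffOn_chart_trans φ ψ
  simp only [modelWithCornersSelf_coe, modelWithCornersSelf_coe_symm, Set.preimage_id,
    Set.range_id, Set.inter_univ, Function.comp_id, Function.id_comp]
  exact this

end Grassmannian

/-! ### Embedded submanifolds and submersions between them -/

section Submanifold

/-- A structure of `d`-dimensional smooth manifold on the topological space `S` for which the map
`ι : S → M` is a smooth embedding (immersion and homeomorphism onto the image). For a subset
`S ⊆ M` with its inclusion, this says that `S` is an embedded submanifold of `M`; the smooth
structure is then unique. -/
structure EmbeddedManifold (E : Type) [NormedAddCommGroup E] [NormedSpace ℝ E]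
    {M : Type} [TopologicalSpace M] [ChartedSpace E M] {S : Type} [TopologicalSpace S] (ι : S → M) (d : ℕ) where
  chartedSpace : ChartedSpace (EuclideanSpace ℝ (Fin d)) S
  isManifold : IsManifold (𝓡 d) ∞ S
  isSmoothEmbedding : Manifold.IsSmoothEmbedding (𝓡 d) 𝓘(ℝ, E) ∞ ι

variable {E : Type} [NormedAddCommGroup E] [NormedSpace ℝ E]
  {M : Type} [TopologicalSpace M] [ChartedSpace E M]
  {E' : Type} [NormedAddCommGroup E'] [NormedSpace ℝ E']
  {M' : Type} [TopologicalSpace M'] [ChartedSpace E' M']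

/-- The map `f` is a smooth submersion for the given smooth structures. -/
def EmbeddedManifold.IsSubmersion {S S' : Type} [TopologicalSpace S] [TopologicalSpace S']
    {ι : S → M} {ι' : S' → M'} {d d' : ℕ} (m : EmbeddedManifold E ι d)
    (m' : EmbeddedManifold E' ι' d')
    (f : S → S') : Prop :=
  letI := m.chartedSpace
  letI := m'.chartedSpace
  Manifold.IsSubmersion (𝓡 d) (𝓡 d') ∞ f

end Submanifold

/-! ### The groups `SL(p+q, ℝ)`, `SO(p,q)`, `S(O(r,s) × O(a-r,b-s))` -/

section Groups

/-- The space `ℝ^(p,q)`. -/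
abbrev Rpq (p q : ℕ) : Type := Fin p ⊕ Fin q → ℝ

/-- The group `SL(p+q, ℝ)`. -/
abbrev SLpq (p q : ℕ) : Type := Matrix.SpecialLinearGroup (Fin p ⊕ Fin q) ℝ

/-- The standard symmetric bilinear form of signature `(p, q)` on `ℝ^(p,q)`. -/
def stdForm (p q : ℕ) : LinearMap.BilinForm ℝ (Rpq p q) :=
  Matrix.toBilin' (LieAlgebra.Orthogonal.indefiniteDiagonal (Fin p) (Fin q) ℝ)

theorem stdForm_apply {p q : ℕ} (x y : Rpq p q) :
    stdForm p q x y = ∑ j, x (.inl j) * y (.inl j) - ∑ j, x (.inr j) * y (.inr j) := by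
  simp [stdForm, LieAlgebra.Orthogonal.indefiniteDiagonal, Matrix.toBilin'_apply',
    Matrix.mulVec_diagonal, dotProduct, sub_eq_add_neg]

/-- The group `SO(p,q)` as a subgroup of `SL(p+q, ℝ)`. -/
def SOpq (p q : ℕ) : Subgroup (SLpq p q) where
  carrier := {g | ∀ x y, stdForm p q (g.1 *ᵥ x) (g.1 *ᵥ y) = stdForm p q x y}
  one_mem' x y := by simp
  mul_mem' {g h} hg hh x y := by
    have e : ∀ z, (g * h).1 *ᵥ z = g.1 *ᵥ (h.1 *ᵥ z) := fun z => by
      rw [Matrix.mulVec_mulVec]; rfl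
    rw [e, e]
    exact (hg _ _).trans (hh _ _)
  inv_mem' {g} hg x y := by
    have key : ∀ z, g.1 *ᵥ ((g⁻¹ : SLpq p q).1 *ᵥ z) = z := by
      intro z
      rw [Matrix.mulVec_mulVec]
      have : g.1 * (g⁻¹ : SLpq p q).1 = 1 := congrArg Subtype.val (mul_inv_cancel g)
      rw [this, Matrix.one_mulVec]
    have := hg ((g⁻¹ : SLpq p q).1 *ᵥ x) ((g⁻¹ : SLpq p q).1 *ᵥ y)
    rw [key, key] at this
    exact this.symm

/-- The vector space of square matrices of size `p + q`. -/
abbrev MatSpace (p q : ℕ) : Type := Fin p ⊕ Fin q → Fin p ⊕ Fin q → ℝ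

/-- The embedding of `SO(p,q)` into the vector space of matrices. -/
def SOpq.entries (p q : ℕ) (h : SOpq p q) : MatSpace p q :=
  fun x y => h.1.1 x y

/-- The indices of the first `r` positive and the first `s` negative coordinates of `ℝ^(a,b)`. They
span `ℝ^(r,s) ⊆ ℝ^(a,b)` while the other indices span the complement `ℝ^(a-r,b-s)`. -/
def firstBlock {a b : ℕ} (r s : ℕ) : Set (Fin a ⊕ Fin b) :=
  {x | Sum.elim (fun j => j.1 < r) (fun j => j.1 < s) x}

/-- The subspace `ℝ^(r,s)` of `ℝ^(a,b)`. -/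
def coordSubspace (a b r s : ℕ) : Submodule ℝ (Rpq a b) where
  carrier := {z | ∀ x, x ∉ firstBlock r s → z x = 0}
  zero_mem' _ _ := rfl
  add_mem' {z w} hz hw x hx := by simp [hz x hx, hw x hx]
  smul_mem' c z hz x hx := by simp [hz x hx]

open Classical in
theorem blockDiagonal_iff_commute {n : Type} [Fintype n] [DecidableEq n] (B : Set n)
    (h : Matrix n n ℝ) :
    (∀ x y, ¬ (x ∈ B ↔ y ∈ B) → h x y = 0) ↔
      Commute h (Matrix.diagonal fun x => if x ∈ B then (1 : ℝ) else -1) := by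
  rw [commute_iff_eq, ← Matrix.ext_iff]
  refine forall_congr' fun x => forall_congr' fun y => ?_
  rw [Matrix.mul_diagonal, Matrix.diagonal_mul]
  by_cases hx : x ∈ B <;> by_cases hy : y ∈ B <;> simp [hx, hy]
  · constructor <;> intro h <;> linarith
  · constructor <;> intro h <;> linarith

/-- The group `S(O(r,s) × O(a-r,b-s))`, that is, the group of those matrices in `SO(a,b)` which
are block diagonal with respect to `ℝ^(a,b) = ℝ^(r,s) ⊕ ℝ^(a-r,b-s)`. -/
def SOO (a b r s : ℕ) : Subgroup (SOpq a b) where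
  carrier := {h | ∀ x y, ¬ (x ∈ firstBlock r s ↔ y ∈ firstBlock r s) → h.1.1 x y = 0}
  one_mem' x y hxy := by
    have : x ≠ y := by rintro rfl; exact hxy Iff.rfl
    simp [this]
  mul_mem' {g h} hg hh := by
    have h1 := (blockDiagonal_iff_commute _ _).1 hg
    have h2 := (blockDiagonal_iff_commute _ _).1 hh
    exact (blockDiagonal_iff_commute _ _).2 (h1.mul_left h2)
  inv_mem' {g} hg := by
    have h1 := (blockDiagonal_iff_commute _ _).1 hg
    refine (blockDiagonal_iff_commute _ _).2 ?_
    have e1 : g.1.1 * (g⁻¹).1.1 = 1 := congrArg (fun z : SOpq a b => z.1.1) (mul_inv_cancel g)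
    have e2 : (g⁻¹).1.1 * g.1.1 = 1 := congrArg (fun z : SOpq a b => z.1.1) (inv_mul_cancel g)
    exact Commute.units_inv_left (u := ⟨g.1.1, (g⁻¹).1.1, e1, e2⟩) h1

end Groups

/-! ### The action on Grassmannians, orbits, isotropic subspaces -/

section Orbits

variable {p q k : ℕ}

/-- The action of `SL(p+q, ℝ)` on `Gr(k, ℝ^(p+q))`. -/
instance : MulAction (SLpq p q) (Gr k (Rpq p q)) where
  smul g W := ⟨W.1.map (Matrix.SpecialLinearGroup.toLin' g).toLinearMap, by
    rw [LinearEquiv.finrank_map_eq]; exact W.2⟩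
  one_smul W := by
    apply Gr.ext
    change Submodule.map _ W.1 = W.1
    rw [map_one]
    exact Submodule.map_id _
  mul_smul g h W := by
    apply Gr.ext
    change Submodule.map _ W.1 = Submodule.map _ (Submodule.map _ W.1)
    rw [map_mul, ← Submodule.map_comp]
    rfl

/-- `O_(r,s)`: the set of `i`-dimensional subspaces of `ℝ^(p+q)` to which the standard form of
signature `(p,q)` restricts with signature `(r,s)`. -/
def grOrbit (p q i r s : ℕ) : Set (Gr i (Rpq p q)) :=
  {W | sigPos ((stdForm p q).toQuadraticMap.restrict W.1) = r ∧
    sigNeg ((stdForm p q).toQuadraticMap.restrict W.1) = s}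

/-- The Grassmannian `IGr(ν, ℝ^(p,q))` of totally isotropic `ν`-dimensional subspaces. -/
def IGr (ν p q : ℕ) : Set (Gr ν (Rpq p q)) :=
  {N | ∀ x ∈ N.1, ∀ y ∈ N.1, stdForm p q x y = 0}

/-- The fiber of `π` over `N`, as a subset of the Grassmannian containing the domain of `π`. -/
def fiber {M X : Type} {S : Set M} (π : S → X) (N : X) : Set M :=
  Subtype.val '' (π ⁻¹' {N})

end Orbits

/-! ### The isotropy group and the infinitesimal transversal -/

section Transversal

variable {p q i : ℕ}

/-- The subgroup `H_g = g⁻¹ SO(p,q) g` of `SL(p+q, ℝ)`. -/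
def conjSO (g : SLpq p q) : Subgroup (SLpq p q) :=
  (SOpq p q).comap (MulAut.conj g).toMonoidHom

/-- The form `(x, y) ↦ b(g x, g y)`, whose special orthogonal group is `g⁻¹ SO(p,q) g`. -/
def conjForm (g : SLpq p q) : LinearMap.BilinForm ℝ (Rpq p q) :=
  (stdForm p q).comp (Matrix.toLin' g.1) (Matrix.toLin' g.1)

/-- The isotropy group `H_g ∩ P`, where `P` is the stabilizer of `o` in `SL(p+q, ℝ)`. -/
def isotropy (o : Gr i (Rpq p q)) (g : SLpq p q) : Subgroup (SLpq p q) :=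
  conjSO g ⊓ MulAction.stabilizer (SLpq p q) o

/-- The Lie algebra `𝔤 = 𝔰𝔩(p+q, ℝ)` of matrices of trace zero. -/
abbrev slpq (p q : ℕ) : Submodule ℝ (Matrix (Fin p ⊕ Fin q) (Fin p ⊕ Fin q) ℝ) :=
  LinearMap.ker (Matrix.traceLinearMap (Fin p ⊕ Fin q) ℝ ℝ)

/-- The adjoint representation of `SL(p+q, ℝ)` on `𝔤`. -/
def adRep (p q : ℕ) : Representation ℝ (SLpq p q) (slpq p q) where
  toFun k :=
    { toFun := fun X => ⟨k.1 * X.1 * (k⁻¹ : SLpq p q).1, by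
        have hX : X.1.trace = 0 := X.2
        have e : (k⁻¹ : SLpq p q).1 * k.1 = 1 := congrArg Subtype.val (inv_mul_cancel k)
        rw [LinearMap.mem_ker, Matrix.traceLinearMap_apply, Matrix.trace_mul_comm, ← mul_assoc, e, one_mul, hX]⟩
      map_add' := fun X Y => by ext1; simp [mul_add, add_mul]
      map_smul' := fun c X => by ext1; simp }
  map_one' := by ext1 X; ext1; simp
  map_mul' k l := by ext1 X; ext1; simp [mul_assoc]

/-- The Lie algebra `𝔭` of the stabilizer `P` of `o`. -/
def parabolicAlg (o : Gr i (Rpq p q)) : Submodule ℝ (slpq p q) where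
  carrier := {X | ∀ x ∈ o.1, X.1 *ᵥ x ∈ o.1}
  zero_mem' x _ := by simp
  add_mem' {X Y} hX hY x hx := by
    simpa [Matrix.add_mulVec] using add_mem (hX x hx) (hY x hx)
  smul_mem' c X hX x hx := by
    simpa [Matrix.smul_mulVec] using Submodule.smul_mem _ c (hX x hx)

/-- The Lie algebra `𝔥_g` of `H_g`, consisting of the matrices which are skew with respect to the
form `b(g x, g y)`. -/
def conjSOAlg (g : SLpq p q) : Submodule ℝ (slpq p q) where
  carrier := {X | ∀ x y, conjForm g (X.1 *ᵥ x) y + conjForm g x (X.1 *ᵥ y) = 0}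
  zero_mem' x y := by simp
  add_mem' {X Y} hX hY x y := by
    have h1 := hX x y
    have h2 := hY x y
    simp only [Submodule.coe_add, Matrix.add_mulVec, map_add, LinearMap.add_apply]
    linarith
  smul_mem' c X hX x y := by
    have h1 := hX x y
    simp only [Submodule.coe_smul, Matrix.smul_mulVec, map_smul, LinearMap.smul_apply,
      smul_eq_mul]
    linear_combination c * h1

theorem conjForm_isotropy {o : Gr i (Rpq p q)} {g : SLpq p q} (k : isotropy o g)
    (x y : Rpq p q) : conjForm g (k.1.1 *ᵥ x) (k.1.1 *ᵥ y) = conjForm g x y := by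
  have h := k.2.1 (g.1 *ᵥ x) (g.1 *ᵥ y)
  have e : ∀ z, ((MulAut.conj g).toMonoidHom k.1).1 *ᵥ (g.1 *ᵥ z) = g.1 *ᵥ (k.1.1 *ᵥ z) := by
    intro z
    rw [Matrix.mulVec_mulVec, Matrix.mulVec_mulVec]
    congr 1
    have : (MulAut.conj g k.1) * g = g * k.1 := by simp
    exact congrArg Subtype.val this
  rw [e, e] at h
  simpa [conjForm] using h

theorem mulVec_mem_of_isotropy {o : Gr i (Rpq p q)} {g : SLpq p q} (k : isotropy o g)
    {x : Rpq p q} (hx : x ∈ o.1) : k.1.1 *ᵥ x ∈ o.1 := by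
  have h : (k.1 • o).1 = o.1 := congrArg Gr.toSubmodule k.2.2
  rw [← h]
  exact ⟨x, hx, rfl⟩

theorem isotropy_mul_inv_mulVec {o : Gr i (Rpq p q)} {g : SLpq p q} (k : isotropy o g)
    (x : Rpq p q) : k.1.1 *ᵥ ((k⁻¹).1.1 *ᵥ x) = x := by
  have e : k.1.1 * (k⁻¹).1.1 = 1 := congrArg (fun z : isotropy o g => z.1.1) (mul_inv_cancel k)
  rw [Matrix.mulVec_mulVec, e, Matrix.one_mulVec]

/-- The representation of `H_g ∩ P` on `𝔤/𝔭` induced by the adjoint action. -/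
def tangentRep (o : Gr i (Rpq p q)) (g : SLpq p q) :
    Representation ℝ (isotropy o g) (slpq p q ⧸ parabolicAlg o) :=
  Representation.quotient (k := ℝ) (G := isotropy o g) (V := slpq p q)
    ((adRep p q).comp (isotropy o g).subtype) (parabolicAlg o) (by
    intro k X hX x hx
    have h := mulVec_mem_of_isotropy k (hX _ (mulVec_mem_of_isotropy k⁻¹ hx))
    rw [Matrix.mulVec_mulVec, Matrix.mulVec_mulVec] at h
    exact h)

/-- The infinitesimal transversal `(𝔤/𝔭) / (𝔥_g/(𝔥_g ∩ 𝔭))`, where `𝔥_g/(𝔥_g ∩ 𝔭)` is identified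
with its image under the injection into `𝔤/𝔭`, that is, with the image of `𝔥_g` in `𝔤/𝔭`. -/
abbrev Transversal (o : Gr i (Rpq p q)) (g : SLpq p q) : Type :=
  (slpq p q ⧸ parabolicAlg o) ⧸ (conjSOAlg g).map (parabolicAlg o).mkQ

/-- The natural representation of `H_g ∩ P` on the infinitesimal transversal. -/
def transversalRep (o : Gr i (Rpq p q)) (g : SLpq p q) :
    Representation ℝ (isotropy o g) (Transversal o g) :=
  Representation.quotient (tangentRep o g) ((conjSOAlg g).map (parabolicAlg o).mkQ) (by
    rintro k _ ⟨X, hX, rfl⟩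
    refine ⟨adRep p q k.1 X, ?_, rfl⟩
    intro x y
    have h := hX ((k⁻¹).1.1 *ᵥ x) ((k⁻¹).1.1 *ᵥ y)
    rw [← conjForm_isotropy k, ← conjForm_isotropy k ((k⁻¹).1.1 *ᵥ x),
      isotropy_mul_inv_mulVec, isotropy_mul_inv_mulVec] at h
    simpa [adRep, mul_assoc] using h)

/-- `S²(ℝ^ν)^*`, the space of symmetric bilinear forms on `ℝ^ν`. -/
def symForms (ν : ℕ) : Submodule ℝ (LinearMap.BilinForm ℝ (Fin ν → ℝ)) where
  carrier := {B | ∀ x y, B x y = B y x}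
  zero_mem' _ _ := rfl
  add_mem' {B C} hB hC x y := by simp [hB x y, hC x y]
  smul_mem' c B hB x y := by simp [hB x y]

/-- The natural representation of `GL(ν, ℝ)` on `S²(ℝ^ν)^*`, given by
`(A · B)(x, y) = B(A⁻¹ x, A⁻¹ y)`. -/
def symRep (ν : ℕ) : Representation ℝ (GL (Fin ν) ℝ) (symForms ν) where
  toFun A :=
    { toFun := fun B => ⟨B.1.comp (Matrix.toLin' A⁻¹.1) (Matrix.toLin' A⁻¹.1),
        fun x y => B.2 _ _⟩
      map_add' := fun B C => rfl
      map_smul' := fun c B => rfl }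
  map_one' := by
    refine LinearMap.ext fun B => Subtype.ext (LinearMap.ext fun x => LinearMap.ext fun y => ?_)
    simp
  map_mul' A C := by
    refine LinearMap.ext fun B => Subtype.ext (LinearMap.ext fun x => LinearMap.ext fun y => ?_)
    simp [mul_inv_rev]

/-- The homomorphism `ψ` is the natural one: writing `R` for the null space of the form
`b(g x, g y)` on `o`, and choosing linear isomorphisms of `ℝ^ν` with `R` and of `ℝ^(p-ν,q-ν)` with
`R^⊥/R` which are compatible with the forms and with the subspaces `ℝ^(r,s)` and `o/R`, it sends an
element of the isotropy group to the maps which it induces on `R` and on `R^⊥/R`. -/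
def IsNaturalHom {r s ν : ℕ} (o : Gr i (Rpq p q)) (g : SLpq p q)
    (ψ : isotropy o g →* GL (Fin ν) ℝ × SOO (p - ν) (q - ν) r s) : Prop :=
  ∃ R : Submodule ℝ (Rpq p q), R = o.1 ⊓ (conjForm g).orthogonal o.1 ∧
  ∃ (α : (Fin ν → ℝ) ≃ₗ[ℝ] R)
    (γ : (conjForm g).orthogonal R →ₗ[ℝ] Rpq (p - ν) (q - ν)),
    Function.Surjective γ ∧
    (∀ x, γ x = 0 ↔ x.1 ∈ R) ∧
    (∀ x y, stdForm (p - ν) (q - ν) (γ x) (γ y) = conjForm g x.1 y.1) ∧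
    (∀ x, γ x ∈ coordSubspace (p - ν) (q - ν) r s ↔ x.1 ∈ o.1) ∧
    (∀ k v, (α ((ψ k).1.1 *ᵥ v)).1 = k.1.1 *ᵥ (α v).1) ∧
    (∀ k, ∀ x y : (conjForm g).orthogonal R, y.1 = k.1.1 *ᵥ x.1 →
      γ y = (ψ k).2.1.1.1 *ᵥ γ x)

end Transversal

end

set_option linter.unusedSectionVars false
set_option autoImplicit false

/-! Everything rests on a normal form of Witt type. Let W have signature (r,s), and let X ≅ ℝ^ν be
its radical W ∩ W^⊥. Sylvester's theorem puts the form on W in standard shape. Nondegeneracy of the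
ambient form gives an isotropic subspace dual to X and orthogonal to a complement of X in W, and the
orthogonal complement of what has been built so far is again a nondegenerate space. Hence ℝ^(p,q) ≅
X ⊕ ℝ^(a,b) ⊕ X* with a = p - ν and b = q - ν, where X and X* are paired hyperbolically and W = X ⊕
ℝ^(r,s) (`exists_wittFrame`, `exists_frame_of_hasSig`). Comparing signatures gives the criterion for
non-emptiness. Two such frames differ by an isometry, and a coordinate reflection of ℝ^(a,b)
corrects its determinant unless a = b = 0; this gives the orbit statement.

For the manifold structures write the middle space as U₁ ⊕ U₂ with U₁ = ℝ^(r,s). A subspace near X ⊕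
U₁ has parameters c₁ : X → U₁, c₂ : X → U₂, A : U₁ → U₂, a skew form κ and a symmetric form σ on X,
with quadratic corrections chosen so that the restricted form becomes 2σ ⊕ (β₁ + A*β₂)
(`wittForm_wittParam`). The derivative of this parametrization at the origin is bijective because β₁
is nondegenerate, so it gives charts. For small A the second summand still has signature (r,s), so
the orbit is the slice σ = 0, of codimension ν(ν+1)/2 (`hasSig_sum_iff`,
`WittData.exists_isSliceChart`). The radical depends only on (c₁, c₂, κ). The case U₁ = 0 of the
same construction gives charts of the isotropic Grassmannian, so passing to the radical is a linear
surjection that forgets A, and a fiber is the slice on which everything but A vanishes.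

The members of the fiber over N correspond to the subspaces h ℝ^(r,s) of ℝ^(a,b) ≅ N^⊥/N with h in
SO(a,b), and two elements h give the same one exactly when they lie in the same coset of S(O × O).
The group SO(a,b) is a slice of the matrix space, given by the Gram equation. The map from it to the
fiber is a submersion, since infinitesimal isometries realize all linear maps ℝ^(r,s) → ℝ^(a-r,b-s).
A submersion whose fibers are the cosets identifies the fiber with the symmetric space.

Isometries preserving X act on the graded pieces X, X^⊥/X and X* by some A, some L and the
contragredient of A. Total determinant one therefore forces det L = 1 (`det_wittMidEnd`), and block
diagonal elements show that every pair (A, L) occurs. For the transversal, a traceless matrix Z is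
sent to the symmetric form b(Zx, y) + b(x, Zy) on the radical. This map is equivariant and
surjective, and its kernel is 𝔭 + 𝔥 (`ker_transversalForm_le`). -/

noncomputable section

/-! ### Slice charts, embedded submanifolds and submersions -/

section SliceCharts

open Topology

variable {E : Type} [NormedAddCommGroup E] [NormedSpace ℝ E]
  {M : Type} [TopologicalSpace M] [ChartedSpace E M]
  {S : Type} [TopologicalSpace S]
  {F₁ F₂ : Type} [NormedAddCommGroup F₁] [NormedSpace ℝ F₁]
  [NormedAddCommGroup F₂] [NormedSpace ℝ F₂]
  {d : ℕ}

variable (E) in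
/-- A smooth chart `θ` of `M` with values in `F₁ × F₂` in which the image of `ι` is the zero locus
of the second component. -/
structure IsSliceChart (ι : S → M) (θ : OpenPartialHomeomorph M (F₁ × F₂)) : Prop where
  contMDiffOn : ContMDiffOn 𝓘(ℝ, E) 𝓘(ℝ, F₁ × F₂) ∞ θ θ.source
  contMDiffOn_symm : ContMDiffOn 𝓘(ℝ, F₁ × F₂) 𝓘(ℝ, E) ∞ θ.symm θ.target
  mem_range_iff : ∀ m ∈ θ.source, m ∈ Set.range ι ↔ (θ m).2 = 0

variable {ι : S → M} {θ θ' : OpenPartialHomeomorph M (F₁ × F₂)}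

theorem IsSliceChart.apply_invFun [Nonempty S] (hθ : IsSliceChart E ι θ) {v : F₁}
    (hv : (v, (0 : F₂)) ∈ θ.target) :
    ι (Function.invFun ι (θ.symm (v, 0))) = θ.symm (v, 0) := by
  apply Function.invFun_eq
  apply (hθ.mem_range_iff _ (θ.map_target hv)).2
  rw [θ.right_inv hv]

theorem IsSliceChart.eq_mk_zero (hθ : IsSliceChart E ι θ) {x : S} (hx : ι x ∈ θ.source) :
    θ (ι x) = ((θ (ι x)).1, 0) :=
  Prod.ext rfl ((hθ.mem_range_iff _ hx).1 ⟨x, rfl⟩)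

/-- The chart of `S` induced by a slice chart. -/
def IsSliceChart.chart [Nonempty S] (hθ : IsSliceChart E ι θ) (hι : IsEmbedding ι)
    (L : F₁ ≃L[ℝ] EuclideanSpace ℝ (Fin d)) :
    OpenPartialHomeomorph S (EuclideanSpace ℝ (Fin d)) where
  toFun s := L (θ (ι s)).1
  invFun v := Function.invFun ι (θ.symm (L.symm v, 0))
  source := ι ⁻¹' θ.source
  target := {v | (L.symm v, (0 : F₂)) ∈ θ.target}
  map_source' s hs := by
    simp only [Set.mem_ofPred_eq, ContinuousLinearEquiv.symm_apply_apply]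
    rw [← hθ.eq_mk_zero hs]
    exact θ.map_source hs
  map_target' v hv := by
    simp only [Set.mem_preimage]
    rw [hθ.apply_invFun hv]
    exact θ.map_target hv
  left_inv' s hs := by
    simp only [ContinuousLinearEquiv.symm_apply_apply]
    rw [← hθ.eq_mk_zero hs, θ.left_inv hs]
    exact Function.leftInverse_invFun hι.injective s
  right_inv' v hv := by
    rw [hθ.apply_invFun hv, θ.right_inv hv]
    simp
  open_source := θ.open_source.preimage hι.continuous
  open_target := θ.open_target.preimage (by fun_prop)
  continuousOn_toFun := L.continuous.comp_continuousOn (continuous_fst.comp_continuousOn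
    (θ.continuousOn.comp hι.continuous.continuousOn fun s hs => hs))
  -- Since `ι` is an embedding, continuity into `S` can be tested after composing with `ι`, where
  -- the inverse becomes that of `θ`.
  continuousOn_invFun := by
    rw [hι.isInducing.continuousOn_iff]
    have h : ContinuousOn (fun v => θ.symm (L.symm v, (0 : F₂)))
        {v | (L.symm v, (0 : F₂)) ∈ θ.target} :=
      θ.continuousOn_symm.comp (by fun_prop) fun v hv => hv
    exact h.congr fun v hv => hθ.apply_invFun hv

/-- Up to `L`, the transition map is the first component of `θ' ∘ θ.symm` restricted to the slice,
so its smoothness is inherited from the ambient manifold. -/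
theorem IsSliceChart.contDiffOn_chart_trans [Nonempty S] (hθ : IsSliceChart E ι θ)
    (hθ' : IsSliceChart E ι θ') (hι : IsEmbedding ι)
    (L : F₁ ≃L[ℝ] EuclideanSpace ℝ (Fin d)) :
    ContDiffOn ℝ ∞ ((hθ.chart hι L).symm.trans (hθ'.chart hι L))
      ((hθ.chart hι L).symm.trans (hθ'.chart hι L)).source := by
  have h : ContDiffOn ℝ ∞ (θ' ∘ θ.symm) (θ.target ∩ θ.symm ⁻¹' θ'.source) := by
    rw [← contMDiffOn_iff_contDiffOn]
    exact hθ'.contMDiffOn.comp (hθ.contMDiffOn_symm.mono Set.inter_subset_left)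
      Set.inter_subset_right
  have h2 : ContDiffOn ℝ ∞ (fun v => L ((θ' ∘ θ.symm) (L.symm v, (0 : F₂))).1)
      ((hθ.chart hι L).symm.trans (hθ'.chart hι L)).source := by
    have h3 : ContDiff ℝ ∞ (fun v => (L.symm v, (0 : F₂))) := by fun_prop
    have h4 : ContDiffOn ℝ ∞ (fun v => (θ' ∘ θ.symm) (L.symm v, (0 : F₂)))
        ((hθ.chart hι L).symm.trans (hθ'.chart hι L)).source := by
      refine h.comp h3.contDiffOn ?_
      intro v hv
      obtain ⟨hv1, hv2⟩ := hv
      refine ⟨hv1, ?_⟩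
      have hv2' : ι (Function.invFun ι (θ.symm (L.symm v, 0))) ∈ θ'.source := hv2
      rwa [hθ.apply_invFun hv1] at hv2'
    exact L.contDiff.comp_contDiffOn (contDiff_fst.comp_contDiffOn h4)
  refine h2.congr ?_
  intro v hv
  change L (θ' (ι (Function.invFun ι (θ.symm (L.symm v, 0))))).1 = _
  rw [hθ.apply_invFun hv.1]
  rfl

variable (E) in
/-- The charted space structure on `S` given by slice charts around all of its points. -/
abbrev sliceChartedSpace (hι : IsEmbedding ι)
    (L : F₁ ≃L[ℝ] EuclideanSpace ℝ (Fin d))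
    (h : ∀ x : S, ∃ θ : OpenPartialHomeomorph M (F₁ × F₂), IsSliceChart E ι θ ∧ ι x ∈ θ.source) :
    ChartedSpace (EuclideanSpace ℝ (Fin d)) S where
  -- All slice charts are admitted, not just the chosen ones. Any slice chart that suits a later
  -- computation therefore belongs to the atlas automatically.
  atlas := {κ | ∃ (_ : Nonempty S) (θ : OpenPartialHomeomorph M (F₁ × F₂))
    (hθ : IsSliceChart E ι θ), κ = hθ.chart hι L}
  chartAt := fun x =>
    haveI : Nonempty S := ⟨x⟩
    (h x).choose_spec.1.chart hι L
  mem_chart_source := fun x => (h x).choose_spec.2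
  chart_mem_atlas := fun x => ⟨⟨x⟩, _, (h x).choose_spec.1, rfl⟩

theorem isManifold_sliceChartedSpace (hι : IsEmbedding ι)
    (L : F₁ ≃L[ℝ] EuclideanSpace ℝ (Fin d))
    (h : ∀ x : S, ∃ θ : OpenPartialHomeomorph M (F₁ × F₂), IsSliceChart E ι θ ∧ ι x ∈ θ.source) :
    @IsManifold _ _ _ _ _ _ _ (𝓡 d) ∞ S _ (sliceChartedSpace E hι L h) := by
  let := sliceChartedSpace E hι L h
  apply isManifold_of_contDiffOn
  rintro _ _ ⟨hS, θ, hθ, rfl⟩ ⟨_, θ', hθ', rfl⟩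
  have := hθ.contDiffOn_chart_trans hθ' hι L
  simp only [modelWithCornersSelf_coe, modelWithCornersSelf_coe_symm, Set.preimage_id,
    Set.range_id, Set.inter_univ, Function.comp_id, Function.id_comp]
  exact this

theorem IsSliceChart.chart_mem_maximalAtlas [Nonempty S] (hι : IsEmbedding ι)
    (L : F₁ ≃L[ℝ] EuclideanSpace ℝ (Fin d))
    (h : ∀ x : S, ∃ θ : OpenPartialHomeomorph M (F₁ × F₂), IsSliceChart E ι θ ∧ ι x ∈ θ.source)
    (hθ : IsSliceChart E ι θ) :
    letI := sliceChartedSpace E hι L h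
    hθ.chart hι L ∈ IsManifold.maximalAtlas (𝓡 d) ∞ S := by
  let := sliceChartedSpace E hι L h
  have := isManifold_sliceChartedSpace hι L h
  exact IsManifold.subset_maximalAtlas ⟨inferInstance, θ, hθ, rfl⟩

/-- In a slice chart the map `ι` reads `v ↦ (L.symm v, 0)`, which is already the normal form of an
immersion with complement `F₂`. -/
theorem isSmoothEmbedding_sliceChartedSpace [IsManifold 𝓘(ℝ, E) ∞ M] (hι : IsEmbedding ι)
    (L : F₁ ≃L[ℝ] EuclideanSpace ℝ (Fin d)) (e : (F₁ × F₂) ≃L[ℝ] E)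
    (h : ∀ x : S, ∃ θ : OpenPartialHomeomorph M (F₁ × F₂), IsSliceChart E ι θ ∧ ι x ∈ θ.source) :
    letI := sliceChartedSpace E hι L h
    Manifold.IsSmoothEmbedding (𝓡 d) 𝓘(ℝ, E) ∞ ι := by
  let := sliceChartedSpace E hι L h
  have := isManifold_sliceChartedSpace hι L h
  refine ⟨Manifold.IsImmersionOfComplement.isImmersion (F := F₂) fun x => ?_, hι⟩
  have : Nonempty S := ⟨x⟩
  obtain ⟨θ, hθ, hx⟩ := h x
  refine Manifold.IsImmersionAtOfComplement.mk_of_charts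
    ((L.symm.prodCongr (ContinuousLinearEquiv.refl ℝ F₂)).trans e)
    (hθ.chart hι L) (θ.trans e.toHomeomorph.toOpenPartialHomeomorph) hx ?_
    (hθ.chart_mem_maximalAtlas hι L h) ?_ ?_ ?_
  · simpa using hx
  · apply OpenPartialHomeomorph.mem_maximalAtlas_of_contMDiffOn
    · have h1 : ContMDiff 𝓘(ℝ, F₁ × F₂) 𝓘(ℝ, E) ∞ e := e.contDiff.contMDiff
      exact (h1.comp_contMDiffOn hθ.contMDiffOn).mono (by intro x hx; simpa using hx)
    · have h1 : ContMDiff 𝓘(ℝ, E) 𝓘(ℝ, F₁ × F₂) ∞ e.symm := e.symm.contDiff.contMDiff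
      exact hθ.contMDiffOn_symm.comp h1.contMDiffOn (by intro x hx; simpa using hx)
  · intro s hs
    have hs' : ι s ∈ θ.source := hs
    simpa using hs'
  · intro v hv
    have hv' : (L.symm v, (0 : F₂)) ∈ θ.target := by
      have : v ∈ (hθ.chart hι L).target := by simpa using hv
      exact this
    change e (θ (ι (Function.invFun ι (θ.symm (L.symm v, 0))))) = e (L.symm v, 0)
    rw [hθ.apply_invFun hv', θ.right_inv hv']

/-- The smooth structure on `S` given by slice charts around all of its points. -/
def EmbeddedManifold.ofSlices [IsManifold 𝓘(ℝ, E) ∞ M] (hι : IsEmbedding ι)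
    (L : F₁ ≃L[ℝ] EuclideanSpace ℝ (Fin d)) (e : (F₁ × F₂) ≃L[ℝ] E)
    (h : ∀ x : S, ∃ θ : OpenPartialHomeomorph M (F₁ × F₂), IsSliceChart E ι θ ∧ ι x ∈ θ.source) :
    EmbeddedManifold E ι d where
  chartedSpace := sliceChartedSpace E hι L h
  isManifold := isManifold_sliceChartedSpace hι L h
  isSmoothEmbedding := isSmoothEmbedding_sliceChartedSpace hι L e h

section InverseFunction

variable {F F' : Type*} [NormedAddCommGroup F] [NormedSpace ℝ F] [NormedAddCommGroup F']
  [NormedSpace ℝ F'] [CompleteSpace F]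

/-- The inverse function theorem for smooth maps, with an open neighbourhood on which the inverse
is smooth. -/
theorem ContDiffAt.exists_openPartialHomeomorph {f : F → F'} {a : F} (hf : ∀ᶠ x in 𝓝 a, ContDiffAt ℝ ∞ f x)
    {f' : F ≃L[ℝ] F'} (hf' : HasFDerivAt f (f' : F →L[ℝ] F') a) :
    ∃ ψ : OpenPartialHomeomorph F F', (∀ x, ψ x = f x) ∧ a ∈ ψ.source ∧
      ContDiffOn ℝ ∞ ψ ψ.source ∧ ContDiffOn ℝ ∞ ψ.symm ψ.target := by
  have hfa : ContDiffAt ℝ ∞ f a := hf.self_of_nhds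
  let ψ₀ := hfa.toOpenPartialHomeomorph f hf' (by simp)
  have hψ₀ : ∀ x, ψ₀ x = f x := fun x => rfl
  have ha₀ : a ∈ ψ₀.source := hfa.mem_toOpenPartialHomeomorph_source hf' (by simp)
  -- Invertible operators form an open set, so the derivative stays invertible near `a`. This gives
  -- smoothness of the inverse on a whole neighbourhood and not only at the image of `a`.
  have h2 : ∀ᶠ x in 𝓝 a, fderiv ℝ f x ∈ Set.range ((↑) : (F ≃L[ℝ] F') → F →L[ℝ] F') := by
    have hc : ContinuousAt (fderiv ℝ f) a := (hfa.fderiv_right (m := 0) (by simp)).continuousAt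
    apply hc.eventually
    apply (ContinuousLinearEquiv.isOpen).mem_nhds
    rw [hf'.fderiv]
    exact ⟨f', rfl⟩
  obtain ⟨s, hs, hso, has⟩ := eventually_nhds_iff.1 (hf.and h2)
  refine ⟨ψ₀.restrOpen s hso, hψ₀, ⟨ha₀, has⟩, ?_, ?_⟩
  · intro x hx
    exact (hs x hx.2).1.contDiffWithinAt
  · intro y hy
    have hy1 : y ∈ ψ₀.target := by simpa using hy.1
    have hy2 : ψ₀.symm y ∈ s := by
      have := (ψ₀.restrOpen s hso).map_target hy
      exact this.2
    obtain ⟨g, hg⟩ := (hs _ hy2).2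
    refine ContDiffAt.contDiffWithinAt ?_
    refine ψ₀.contDiffAt_symm (f₀' := g) hy1 ?_ (hs _ hy2).1
    rw [hg]
    exact ((hs _ hy2).1.differentiableAt (by simp)).hasFDerivAt

end InverseFunction

/-- A projection onto the kernel completes `g` to an isomorphism. It supplies the complementary
coordinates needed to straighten a submersion. -/
theorem ContinuousLinearMap.exists_equiv_prod_of_surjective {F F' K : Type*}
    [NormedAddCommGroup F] [NormedSpace ℝ F] [NormedAddCommGroup F'] [NormedSpace ℝ F']
    [NormedAddCommGroup K] [NormedSpace ℝ K] [FiniteDimensional ℝ F] [FiniteDimensional ℝ F']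
    [FiniteDimensional ℝ K] (g : F →L[ℝ] F') (hg : Function.Surjective g)
    (hd : Module.finrank ℝ F = Module.finrank ℝ F' + Module.finrank ℝ K) :
    ∃ φ : F ≃L[ℝ] F' × K, ∀ v, (φ v).1 = g v := by
  obtain ⟨C, hC⟩ := Submodule.exists_isCompl g.toLinearMap.ker
  have hk : Module.finrank ℝ g.toLinearMap.ker = Module.finrank ℝ K := by
    have h1 := g.toLinearMap.finrank_range_add_finrank_ker
    rw [LinearMap.range_eq_top.2 hg, finrank_top] at h1
    omega
  let u : g.toLinearMap.ker ≃ₗ[ℝ] K := LinearEquiv.ofFinrankEq _ _ hk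
  let p : F →ₗ[ℝ] K := u.toLinearMap ∘ₗ Submodule.projectionOnto _ _ hC
  have hinj : Function.Injective (g.toLinearMap.prod p) := by
    rw [injective_iff_map_eq_zero]
    intro v hv
    have h1 : g v = 0 := congrArg Prod.fst hv
    have h2 : p v = 0 := congrArg Prod.snd hv
    have h3 : Submodule.projectionOnto _ _ hC v = 0 := u.map_eq_zero_iff.1 h2
    have h4 : Submodule.projectionOnto _ _ hC v = ⟨v, h1⟩ :=
      Submodule.projectionOnto_apply_left hC ⟨v, h1⟩
    exact (congrArg Subtype.val (h3.symm.trans h4)).symm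
  refine ⟨(LinearMap.linearEquivOfInjective _ hinj
    (by rw [hd, Module.finrank_prod])).toContinuousLinearEquiv, fun v => rfl⟩

section Submersion

variable {E' : Type} [NormedAddCommGroup E'] [NormedSpace ℝ E']
  {M' : Type} [TopologicalSpace M'] [ChartedSpace E' M']
  {S' : Type} [TopologicalSpace S']
  {F₁' F₂' : Type} [NormedAddCommGroup F₁'] [NormedSpace ℝ F₁']
  [NormedAddCommGroup F₂'] [NormedSpace ℝ F₂']
  {d' : ℕ} {ι' : S' → M'}

/-- A map which in slice charts is smooth with surjective derivative is a submersion. -/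
theorem EmbeddedManifold.isSubmersion_ofSlices [IsManifold 𝓘(ℝ, E) ∞ M] [IsManifold 𝓘(ℝ, E') ∞ M']
    (hι : IsEmbedding ι) (L : F₁ ≃L[ℝ] EuclideanSpace ℝ (Fin d)) (e : (F₁ × F₂) ≃L[ℝ] E)
    (h : ∀ x : S, ∃ θ : OpenPartialHomeomorph M (F₁ × F₂), IsSliceChart E ι θ ∧ ι x ∈ θ.source)
    (hι' : IsEmbedding ι') (L' : F₁' ≃L[ℝ] EuclideanSpace ℝ (Fin d')) (e' : (F₁' × F₂') ≃L[ℝ] E')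
    (h' : ∀ x : S', ∃ θ : OpenPartialHomeomorph M' (F₁' × F₂'),
      IsSliceChart E' ι' θ ∧ ι' x ∈ θ.source)
    (f : S → S')
    (hf : ∀ x : S, ∃ (θ : OpenPartialHomeomorph M (F₁ × F₂))
      (θ' : OpenPartialHomeomorph M' (F₁' × F₂')) (G : F₁ → F₁'),
      IsSliceChart E ι θ ∧ ι x ∈ θ.source ∧ IsSliceChart E' ι' θ' ∧
      (∀ᶠ s in 𝓝 x, ι' (f s) ∈ θ'.source ∧ (θ' (ι' (f s))).1 = G (θ (ι s)).1) ∧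
      (∀ᶠ v in 𝓝 (θ (ι x)).1, ContDiffAt ℝ ∞ G v) ∧
      Function.Surjective (fderiv ℝ G (θ (ι x)).1)) :
    (EmbeddedManifold.ofSlices hι L e h).IsSubmersion
      (EmbeddedManifold.ofSlices hι' L' e' h') f := by
  let := sliceChartedSpace E hι L h
  have := isManifold_sliceChartedSpace hι L h
  let := sliceChartedSpace E' hι' L' h'
  have := isManifold_sliceChartedSpace hι' L' h'
  change Manifold.IsSubmersion (𝓡 d) (𝓡 d') ∞ f
  apply Manifold.IsSubmersionOfComplement.isSubmersion (F := EuclideanSpace ℝ (Fin (d - d')))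
  intro x
  obtain ⟨θ, θ', G, hθ, hx, hθ', hG, hGs, hGd⟩ := hf x
  have : Nonempty S := ⟨x⟩
  have : Nonempty S' := ⟨f x⟩
  let κ := hθ.chart hι L
  let κ' := hθ'.chart hι' L'
  let g : EuclideanSpace ℝ (Fin d) → EuclideanSpace ℝ (Fin d') := fun v => L' (G (L.symm v))
  have hgs : ∀ᶠ v in 𝓝 (κ x), ContDiffAt ℝ ∞ g v := by
    have hc : Filter.Tendsto L.symm (𝓝 (κ x)) (𝓝 (θ (ι x)).1) := by
      have := L.symm.continuous.tendsto (κ x)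
      rwa [show L.symm (κ x) = (θ (ι x)).1 from L.symm_apply_apply _] at this
    filter_upwards [hc.eventually hGs] with v hv
    exact L'.contDiff.contDiffAt.comp v (hv.comp v L.symm.contDiff.contDiffAt)
  have hG1 : HasFDerivAt G (fderiv ℝ G (θ (ι x)).1) (L.symm (κ x)) := by
    rw [show L.symm (κ x) = (θ (ι x)).1 from L.symm_apply_apply _]
    exact (hGs.self_of_nhds.differentiableAt (by simp)).hasFDerivAt
  let g' : EuclideanSpace ℝ (Fin d) →L[ℝ] EuclideanSpace ℝ (Fin d') :=
    L'.toContinuousLinearMap ∘L (fderiv ℝ G (θ (ι x)).1) ∘L L.symm.toContinuousLinearMap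
  have hgd : HasFDerivAt g g' (κ x) :=
    L'.hasFDerivAt.comp (κ x) (hG1.comp (κ x) L.symm.hasFDerivAt)
  have hsurj : Function.Surjective g' :=
    L'.surjective.comp (hGd.comp L.symm.surjective)
  have hdim : d' ≤ d := by
    simpa using LinearMap.finrank_le_finrank_of_surjective (f := g'.toLinearMap) hsurj
  obtain ⟨φ, hφ⟩ := ContinuousLinearMap.exists_equiv_prod_of_surjective
    (K := EuclideanSpace ℝ (Fin (d - d'))) _ hsurj (by simp; omega)
  -- The local expression `g` is completed by the linear kernel coordinates of its derivative. Then
  -- `T` has the invertible derivative `φ` and is a local diffeomorphism.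
  let T : EuclideanSpace ℝ (Fin d) → EuclideanSpace ℝ (Fin d') × EuclideanSpace ℝ (Fin (d - d')) :=
    fun v => (g v, (φ v).2)
  have hTs : ∀ᶠ v in 𝓝 (κ x), ContDiffAt ℝ ∞ T v := by
    filter_upwards [hgs] with v hv
    exact hv.prodMk (contDiff_snd.comp φ.contDiff).contDiffAt
  have hTd : HasFDerivAt T (φ : _ →L[ℝ] _) (κ x) := by
    have h2 := ((ContinuousLinearMap.snd ℝ _ _).comp φ.toContinuousLinearMap).hasFDerivAt (x := κ x)
    refine (hgd.prodMk h2).congr_fderiv ?_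
    ext1 v
    exact Prod.ext (hφ v).symm rfl
  obtain ⟨ψ, hψ, hxψ, hψ1, hψ2⟩ := ContDiffAt.exists_openPartialHomeomorph hTs hTd
  obtain ⟨N, hN, hNo, hxN⟩ := eventually_nhds_iff.1 hG
  have hκmem := hθ.chart_mem_maximalAtlas hι L h
  -- In the chart `φ.symm ∘ T ∘ κ` the map `f` is exactly the first component of `φ`, the normal
  -- form of a submersion.
  let dom := ((κ.restrOpen N hNo).trans ψ).trans φ.symm.toHomeomorph.toOpenPartialHomeomorph
  have hdom : ∀ s, s ∈ dom.source ↔ (s ∈ κ.source ∧ s ∈ N) ∧ κ s ∈ ψ.source := by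
    intro s
    simp [dom]
  refine Manifold.IsSubmersionAtOfComplement.mk_of_charts φ dom κ' ?_ (hN x hxN).1 ?_
    (hθ'.chart_mem_maximalAtlas hι' L' h') ?_ ?_
  · exact (hdom x).2 ⟨⟨hx, hxN⟩, hxψ⟩
  · apply OpenPartialHomeomorph.mem_maximalAtlas_of_contMDiffOn
    · have h1 : ContMDiffOn (𝓡 d) (𝓡 d) ∞ κ κ.source := contMDiffOn_of_mem_maximalAtlas hκmem
      have h2 := hψ1.contMDiffOn.comp (h1.mono (t := dom.source) fun s hs => ((hdom s).1 hs).1.1)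
        fun s hs => ((hdom s).1 hs).2
      exact φ.symm.contDiff.contMDiff.comp_contMDiffOn h2
    · have h1 : ContMDiffOn (𝓡 d) (𝓡 d) ∞ κ.symm κ.target :=
        contMDiffOn_symm_of_mem_maximalAtlas hκmem
      have h2 := hψ2.contMDiffOn.comp (φ.contDiff.contMDiff.contMDiffOn (s := dom.target))
        (fun v hv => by
          obtain ⟨s, hs, rfl⟩ : ∃ s ∈ dom.source, dom s = v :=
            ⟨dom.symm v, dom.map_target hv, dom.right_inv hv⟩
          simpa [dom] using ψ.map_source ((hdom s).1 hs).2)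
      refine h1.comp h2 ?_
      intro v hv
      obtain ⟨s, hs, rfl⟩ : ∃ s ∈ dom.source, dom s = v :=
        ⟨dom.symm v, dom.map_target hv, dom.right_inv hv⟩
      have h3 : ψ.symm (φ (dom s)) = κ s := by
        simpa [dom] using ψ.left_inv ((hdom s).1 hs).2
      change ψ.symm (φ (dom s)) ∈ κ.target
      rw [h3]
      exact κ.map_source ((hdom s).1 hs).1.1
  · intro s hs
    exact (hN s ((hdom s).1 hs).1.2).1
  · intro v hv
    have hv' : v ∈ dom.target := by simpa using hv
    obtain ⟨s, hs, rfl⟩ : ∃ s ∈ dom.source, dom s = v :=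
      ⟨dom.symm v, dom.map_target hv', dom.right_inv hv'⟩
    have h1 : (dom.extend (𝓡 d)).symm (dom s) = s := by
      simpa using dom.left_inv hs
    simp only [Function.comp_apply, h1]
    have h3 : φ (dom s) = T (κ s) := by
      simp [dom, hψ]
    rw [h3]
    change L' (θ' (ι' (f s))).1 = L' (G (L.symm (L (θ (ι s)).1)))
    rw [(hN s ((hdom s).1 hs).1.2).2]
    simp

end Submersion

end SliceCharts

end

noncomputable section

/-! ### Charts of the Grassmannian by graphs of linear maps `Y → Z` -/

section GraphCharts

variable {V Y Z : Type} [AddCommGroup V] [Module ℝ V] [FiniteDimensional ℝ V]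
  [NormedAddCommGroup Y] [NormedSpace ℝ Y] [FiniteDimensional ℝ Y]
  [NormedAddCommGroup Z] [NormedSpace ℝ Z] [FiniteDimensional ℝ Z] {k : ℕ}

/-- A linear isomorphism of `Y` with `ℝ^k`. -/
def graphFstEquiv (hk : Module.finrank ℝ Y = k) : Y ≃L[ℝ] (Fin k → ℝ) :=
  (LinearEquiv.ofFinrankEq Y (Fin k → ℝ) (by simpa using hk)).toContinuousLinearEquiv

/-- A linear isomorphism of `Z` with `ℝ^(dim V - k)`, where `V ≃ Y × Z`. -/
def graphSndEquiv (φ : V ≃ₗ[ℝ] Y × Z) (hk : Module.finrank ℝ Y = k) :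
    Z ≃L[ℝ] (Fin (Module.finrank ℝ V - k) → ℝ) :=
  (LinearEquiv.ofFinrankEq Z (Fin (Module.finrank ℝ V - k) → ℝ) (by
    rw [φ.finrank_eq, Module.finrank_prod]; simp; omega)).toContinuousLinearEquiv

/-- A splitting `V ≃ Y × Z` in standard coordinates. -/
def graphSplit (φ : V ≃ₗ[ℝ] Y × Z) (hk : Module.finrank ℝ Y = k) : GrSplit k V :=
  φ.trans ((graphFstEquiv hk).toLinearEquiv.prodCongr (graphSndEquiv φ hk).toLinearEquiv)

/-- The identification of `Hom(Y, Z)` with the model space of the Grassmannian. -/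
def graphModelEquiv (φ : V ≃ₗ[ℝ] Y × Z) (hk : Module.finrank ℝ Y = k) :
    GrModel k V ≃L[ℝ] (Y →L[ℝ] Z) :=
  (graphFstEquiv hk).symm.arrowCongr (graphSndEquiv φ hk).symm

/-- The chart of `Gr(k, V)` given by graphs of linear maps `Y → Z`, where `V ≃ Y × Z`. -/
def Gr.graphChart (φ : V ≃ₗ[ℝ] Y × Z) (hk : Module.finrank ℝ Y = k) :
    OpenPartialHomeomorph (Gr k V) (Y →L[ℝ] Z) :=
  ((Gr.chartedSpaceCore k V).openPartialHomeomorph (Gr.chart (graphSplit φ hk))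
    ⟨graphSplit φ hk, rfl⟩).trans (graphModelEquiv φ hk).toHomeomorph.toOpenPartialHomeomorph

theorem Gr.graphChart_target (φ : V ≃ₗ[ℝ] Y × Z) (hk : Module.finrank ℝ Y = k) :
    (Gr.graphChart φ hk).target = Set.univ := by
  ext A
  simp only [graphChart, OpenPartialHomeomorph.trans_target, Set.mem_inter_iff, Set.mem_preimage,
    Set.mem_univ, iff_true]
  exact ⟨trivial, trivial⟩

theorem Gr.mem_graphChart_symm (φ : V ≃ₗ[ℝ] Y × Z) (hk : Module.finrank ℝ Y = k)
    (A : Y →L[ℝ] Z) (v : V) :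
    v ∈ ((Gr.graphChart φ hk).symm A).1 ↔ (φ v).2 = A (φ v).1 := by
  change v ∈ (Gr.graph (graphSplit φ hk) ((graphModelEquiv φ hk).symm A)).1 ↔ _
  rw [Gr.mem_graph]
  change (graphSndEquiv φ hk) (φ v).2 = (graphSndEquiv φ hk) (A ((graphFstEquiv hk).symm
    ((graphFstEquiv hk) (φ v).1))) ↔ _
  simp

theorem Gr.graphChart_mem_atlas (φ : V ≃ₗ[ℝ] Y × Z) (hk : Module.finrank ℝ Y = k) :
    (Gr.chartedSpaceCore k V).openPartialHomeomorph (Gr.chart (graphSplit φ hk))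
      ⟨graphSplit φ hk, rfl⟩ ∈ IsManifold.maximalAtlas 𝓘(ℝ, GrModel k V) ∞ (Gr k V) := by
  apply IsManifold.subset_maximalAtlas
  exact Set.mem_iUnion.2 ⟨_, Set.mem_iUnion.2 ⟨⟨_, rfl⟩, rfl⟩⟩

theorem Gr.contMDiffOn_graphChart (φ : V ≃ₗ[ℝ] Y × Z) (hk : Module.finrank ℝ Y = k) :
    ContMDiffOn 𝓘(ℝ, GrModel k V) 𝓘(ℝ, Y →L[ℝ] Z) ∞ (Gr.graphChart φ hk)
      (Gr.graphChart φ hk).source := by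
  have h1 := contMDiffOn_of_mem_maximalAtlas (Gr.graphChart_mem_atlas φ hk)
  have h2 := (graphModelEquiv φ hk).contDiff (n := ∞).contMDiff.comp_contMDiffOn h1
  exact h2.mono fun W hW => hW.1

theorem Gr.contMDiff_graphChart_symm (φ : V ≃ₗ[ℝ] Y × Z) (hk : Module.finrank ℝ Y = k) :
    ContMDiff 𝓘(ℝ, Y →L[ℝ] Z) 𝓘(ℝ, GrModel k V) ∞ (Gr.graphChart φ hk).symm := by
  have h1 := contMDiffOn_symm_of_mem_maximalAtlas (Gr.graphChart_mem_atlas φ hk)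
  have h2 := (graphModelEquiv φ hk).symm.contDiff (n := ∞).contMDiff.contMDiffOn
    (s := Set.univ)
  rw [← contMDiffOn_univ]
  exact h1.comp h2 fun A _ => trivial

end GraphCharts

end

noncomputable section

/-! ### Signatures of degenerate quadratic forms -/

section Signature

open Topology

variable {M M' P N K : Type*} [AddCommGroup M] [Module ℝ M] [FiniteDimensional ℝ M]
  [AddCommGroup M'] [Module ℝ M'] [FiniteDimensional ℝ M'] [AddCommGroup P] [Module ℝ P]
  [AddCommGroup N] [Module ℝ N] [AddCommGroup K] [Module ℝ K]
  {r s : ℕ}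

/-- The quadratic form `Q` has signature `(r, s)`. -/
def HasSig (Q : QuadraticForm ℝ M) (r s : ℕ) : Prop := sigPos Q = r ∧ sigNeg Q = s

theorem hasSig_congr {Q : QuadraticForm ℝ M} {Q' : QuadraticForm ℝ M'} (e : M ≃ₗ[ℝ] M')
    (he : ∀ x, Q' (e x) = Q x) : HasSig Q r s ↔ HasSig Q' r s := by
  have h : QuadraticMap.Equivalent Q Q' := ⟨⟨e, he⟩⟩
  unfold HasSig
  rw [h.sigPos_eq, h.sigNeg_eq]

theorem finrank_le_sigPos {Q : QuadraticForm ℝ M} (f : P →ₗ[ℝ] M) (hf : ∀ x, x ≠ 0 → 0 < Q (f x)) :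
    Module.finrank ℝ P ≤ sigPos Q := by
  have hinj : Function.Injective f := by
    rw [injective_iff_map_eq_zero]
    intro x hx
    by_contra h
    have := hf x h
    simp [hx] at this
  rw [← LinearMap.finrank_range_of_inj hinj]
  apply le_sigPos_of_posDef
  rintro ⟨_, x, rfl⟩ hx
  apply hf
  rintro rfl
  simp at hx

theorem finrank_le_sigNeg {Q : QuadraticForm ℝ M} (f : N →ₗ[ℝ] M) (hf : ∀ x, x ≠ 0 → Q (f x) < 0) :
    Module.finrank ℝ N ≤ sigNeg Q := by
  rw [← sigPos_neg]
  exact finrank_le_sigPos f fun x hx => by simpa using hf x hx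

/-- The three maps bound the positive index, the negative index and the dimension of the radical
from below. These invariants add up to the dimension of `M`, so `hd` forces equality in all three
bounds. -/
theorem hasSig_of_maps {Q : QuadraticForm ℝ M} (fP : P →ₗ[ℝ] M) (fN : N →ₗ[ℝ] M) (fK : K →ₗ[ℝ] M)
    (hP : ∀ x, x ≠ 0 → 0 < Q (fP x)) (hN : ∀ x, x ≠ 0 → Q (fN x) < 0)
    (hK : Function.Injective fK) (hK' : ∀ x m, Q (fK x + m) = Q m)
    (hd : Module.finrank ℝ P + Module.finrank ℝ N + Module.finrank ℝ K = Module.finrank ℝ M) :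
    HasSig Q (Module.finrank ℝ P) (Module.finrank ℝ N) := by
  have h1 := finrank_le_sigPos fP hP
  have h2 := finrank_le_sigNeg fN hN
  have h3 : Module.finrank ℝ K ≤ Module.finrank ℝ Q.radical := by
    rw [← LinearMap.finrank_range_of_inj hK]
    apply Submodule.finrank_mono
    rintro _ ⟨x, rfl⟩
    rw [QuadraticMap.mem_radical_iff']
    exact ⟨by simpa using hK' x 0, hK' x⟩
  have h4 := QuadraticForm.sigPos_add_sigNeg_add_radical (Q := Q)
  constructor <;> omega

theorem HasSig.exists_posDef {Q : QuadraticForm ℝ M} (h : HasSig Q r s) :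
    ∃ P : Submodule ℝ M, Module.finrank ℝ P = r ∧ ∀ x : P, x ≠ 0 → 0 < Q x := by
  obtain ⟨P, hP, hP'⟩ := exists_finrank_eq_sigPos_and_posDef Q
  exact ⟨P, hP.trans h.1, fun x hx => hP' x hx⟩

theorem HasSig.exists_negDef {Q : QuadraticForm ℝ M} (h : HasSig Q r s) :
    ∃ P : Submodule ℝ M, Module.finrank ℝ P = s ∧ ∀ x : P, x ≠ 0 → Q x < 0 := by
  obtain ⟨P, hP, hP'⟩ := exists_finrank_eq_sigNeg_and_negDef Q
  exact ⟨P, hP.trans h.2, fun x hx => by simpa using hP' x hx⟩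

theorem HasSig.finrank_radical {Q : QuadraticForm ℝ M} (h : HasSig Q r s) :
    r + s + Module.finrank ℝ Q.radical = Module.finrank ℝ M := by
  rw [← QuadraticForm.sigPos_add_sigNeg_add_radical (Q := Q), h.1, h.2]

/-- The quadratic form of a continuous bilinear form. -/
def quadOf {F : Type*} [NormedAddCommGroup F] [NormedSpace ℝ F] (β : F →L[ℝ] F →L[ℝ] ℝ) :
    QuadraticForm ℝ F :=
  LinearMap.BilinMap.toQuadraticMap
    (LinearMap.mk₂ ℝ (fun x y => β x y) (by simp) (by simp) (by simp) (by simp))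

@[simp]
theorem quadOf_apply {F : Type*} [NormedAddCommGroup F] [NormedSpace ℝ F]
    (β : F →L[ℝ] F →L[ℝ] ℝ) (x : F) : quadOf β x = β x x := rfl

/-- By homogeneity it suffices to test on the unit sphere, whose compactness makes the neighbourhood
uniform. The factor `ε` lets the same statement serve for positive and negative definiteness. -/
theorem eventually_posDef {F T : Type*} [NormedAddCommGroup F] [NormedSpace ℝ F]
    [FiniteDimensional ℝ F] [TopologicalSpace T] {β : T → F →L[ℝ] F →L[ℝ] ℝ} {t₀ : T}
    (hβ : ContinuousAt β t₀) (ε : ℝ) (P : Submodule ℝ F)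
    (hP : ∀ x : P, x ≠ 0 → 0 < ε * β t₀ x x) :
    ∀ᶠ t in 𝓝 t₀, ∀ x : P, x ≠ 0 → 0 < ε * β t x x := by
  have h1 : ∀ᶠ t in 𝓝 t₀, ∀ x ∈ Metric.sphere (0 : P) 1, 0 < ε * β t x x := by
    apply (isCompact_sphere (0 : P) 1).eventually_forall_of_forall_eventually
    intro x hx
    have hx0 : x ≠ 0 := by
      rintro rfl
      simp at hx
    have hc : ContinuousAt (fun z : T × P => ε * β z.1 z.2 z.2) (t₀, x) := by
      have h2 : ContinuousAt (fun z : T × P => β z.1) (t₀, x) :=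
        hβ.comp_of_eq continuousAt_fst rfl
      have h3 : ContinuousAt (fun z : T × P => (z.2 : F)) (t₀, x) := by fun_prop
      exact ((h2.clm_apply h3).clm_apply h3).const_mul ε
    exact hc.eventually (lt_mem_nhds (hP x hx0))
  filter_upwards [h1] with t ht x hx
  have h4 : 0 < ‖x‖ := norm_pos_iff.2 hx
  have h5 := ht (‖x‖⁻¹ • x) (by
    rw [mem_sphere_zero_iff_norm, norm_smul, norm_inv, norm_norm, inv_mul_cancel₀ h4.ne'])
  simp only [Submodule.coe_smul, map_smul, _root_.smul_apply, smul_eq_mul] at h5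
  have h6 : 0 < ‖x‖⁻¹ := by positivity
  rw [show ε * (‖x‖⁻¹ * (‖x‖⁻¹ * β t x x)) = ‖x‖⁻¹ * (‖x‖⁻¹ * (ε * β t x x)) by ring] at h5
  exact pos_of_mul_pos_right (pos_of_mul_pos_right h5 h6.le) h6.le

/-- A nondegenerate signature is an open condition: maximal positive and negative definite subspaces
persist, and together they already exhaust the dimension. -/
theorem eventually_hasSig {F T : Type*} [NormedAddCommGroup F] [NormedSpace ℝ F]
    [FiniteDimensional ℝ F] [TopologicalSpace T] {β : T → F →L[ℝ] F →L[ℝ] ℝ} {t₀ : T}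
    (hβ : ContinuousAt β t₀) (h : HasSig (quadOf (β t₀)) r s) (hd : r + s = Module.finrank ℝ F) :
    ∀ᶠ t in 𝓝 t₀, HasSig (quadOf (β t)) r s := by
  obtain ⟨P, hP, hP'⟩ := h.exists_posDef
  obtain ⟨N, hN, hN'⟩ := h.exists_negDef
  have h2 := eventually_posDef hβ (-1) N (fun x hx => by simpa using hN' x hx)
  filter_upwards [eventually_posDef hβ 1 P (fun x hx => by simpa using hP' x hx), h2] with t ht1 ht2
  have := hasSig_of_maps (Q := quadOf (β t)) P.subtype N.subtype (0 : (Fin 0 → ℝ) →ₗ[ℝ] F)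
    (fun x hx => by simpa using ht1 x hx)
    (fun x hx => by simpa using ht2 x hx) (fun x y _ => Subsingleton.elim _ _) (by simp)
    (by simp [hP, hN, hd])
  rwa [hP, hN] at this

/-- The orthogonal sum of `2σ` with a form whose signature `(r, s)` is non-degenerate has signature
`(r, s)` if and only if `σ` vanishes. -/
theorem hasSig_sum_iff {X U : Type*} [AddCommGroup X] [Module ℝ X] [FiniteDimensional ℝ X]
    [AddCommGroup U] [Module ℝ U] [FiniteDimensional ℝ U] (σ : QuadraticForm ℝ X)
    (γ : QuadraticForm ℝ U) (Q : QuadraticForm ℝ (X × U)) (hQ : ∀ z, Q z = σ z.1 + γ z.2)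
    (hγ : HasSig γ r s) (hd : r + s = Module.finrank ℝ U) : HasSig Q r s ↔ σ = 0 := by
  constructor
  · intro h
    have h1 := h.finrank_radical
    have h0 := hγ.finrank_radical
    have h0' : γ.radical = ⊥ := Submodule.finrank_eq_zero.1 (by omega)
    have h2 : Q.radical ≤ LinearMap.range (LinearMap.inl ℝ X U) := by
      intro z hz
      rw [QuadraticMap.mem_radical_iff'] at hz
      have h3 : z.2 ∈ γ.radical := by
        rw [QuadraticMap.mem_radical_iff']
        have h4 : ∀ n, γ (z.2 + n) = γ n - σ z.1 := by
          intro n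
          have := hz.2 (0, n)
          simp only [hQ, Prod.fst_add, add_zero, Prod.snd_add, QuadraticMap.map_zero,
            zero_add] at this
          linarith
        have h5 := h4 (-z.2)
        have h6 := hz.1
        rw [hQ] at h6
        simp only [add_neg_cancel, QuadraticMap.map_zero, QuadraticMap.map_neg] at h5
        have h7 : σ z.1 = 0 := by linarith
        exact ⟨by linarith, fun n => by rw [h4, h7, sub_zero]⟩
      rw [h0', Submodule.mem_bot] at h3
      exact ⟨z.1, Prod.ext rfl h3.symm⟩
    -- The assumed signature makes the radical of dimension `dim X`, so it is all of `X × 0`, and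
    -- `Q` vanishes there.
    have h5 : Q.radical = LinearMap.range (LinearMap.inl ℝ X U) := by
      apply Submodule.eq_of_le_of_finrank_le h2
      rw [LinearMap.finrank_range_of_inj LinearMap.inl_injective]
      rw [Module.finrank_prod] at h1
      omega
    ext x
    have h6 : (x, (0 : U)) ∈ Q.radical := by rw [h5]; exact ⟨x, rfl⟩
    rw [QuadraticMap.mem_radical_iff'] at h6
    simpa [hQ] using h6.1
  · rintro rfl
    obtain ⟨P, hP, hP'⟩ := hγ.exists_posDef
    obtain ⟨N, hN, hN'⟩ := hγ.exists_negDef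
    have := hasSig_of_maps (Q := Q) (LinearMap.inr ℝ X U ∘ₗ P.subtype)
      (LinearMap.inr ℝ X U ∘ₗ N.subtype) (LinearMap.inl ℝ X U) (fun x hx => by
        simpa [hQ] using hP' x hx) (fun x hx => by simpa [hQ] using hN' x hx)
      LinearMap.inl_injective (by simp [hQ]) (by rw [hP, hN, Module.finrank_prod, hd, add_comm])
    rwa [hP, hN] at this

end Signature

end

noncomputable section

/-! ### Nonlinear parametrization of the subspaces near a given one -/

section WittCharts

open Topology

/-- Linear parametrizations of the skew-symmetric and of the symmetric bilinear forms on `X`. -/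
structure BilinParam (X K S : Type*) [NormedAddCommGroup X] [NormedSpace ℝ X]
    [NormedAddCommGroup K] [NormedSpace ℝ K] [NormedAddCommGroup S] [NormedSpace ℝ S] where
  skew : K →L[ℝ] X →L[ℝ] X →L[ℝ] ℝ
  sym : S →L[ℝ] X →L[ℝ] X →L[ℝ] ℝ
  skew_swap : ∀ κ x y, skew κ x y = -skew κ y x
  sym_swap : ∀ σ x y, sym σ x y = sym σ y x
  skew_injective : Function.Injective skew
  sym_injective : Function.Injective sym
  exists_sym_add_skew : ∀ T, ∃ σ κ, T = sym σ + skew κ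

variable {X U₁ U₂ K S : Type} [NormedAddCommGroup X] [NormedSpace ℝ X] [FiniteDimensional ℝ X]
  [NormedAddCommGroup U₁] [NormedSpace ℝ U₁] [FiniteDimensional ℝ U₁]
  [NormedAddCommGroup U₂] [NormedSpace ℝ U₂] [FiniteDimensional ℝ U₂]
  [NormedAddCommGroup K] [NormedSpace ℝ K] [FiniteDimensional ℝ K]
  [NormedAddCommGroup S] [NormedSpace ℝ S] [FiniteDimensional ℝ S]

/-- The form on `X × U₁ × U₂ × X*` which is the orthogonal sum of `β₁`, `β₂` and the pairing of `X`
and `X*`. -/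
def wittForm (β₁ : U₁ →L[ℝ] U₁ →L[ℝ] ℝ) (β₂ : U₂ →L[ℝ] U₂ →L[ℝ] ℝ)
    (m m' : X × U₁ × U₂ × (X →L[ℝ] ℝ)) : ℝ :=
  m.2.2.2 m'.1 + m'.2.2.2 m.1 + β₁ m.2.1 m'.2.1 + β₂ m.2.2.1 m'.2.2.1

/-- The parameters of the subspaces near `X × U₁` on which the form is as degenerate as on
`X × U₁`. -/
abbrev WittSlice (X U₁ U₂ K : Type) [NormedAddCommGroup X] [NormedSpace ℝ X]
    [NormedAddCommGroup U₁] [NormedSpace ℝ U₁] [NormedAddCommGroup U₂] [NormedSpace ℝ U₂] : Type :=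
  ((X →L[ℝ] U₁) × (X →L[ℝ] U₂)) × (U₁ →L[ℝ] U₂) × K

/-- Reordering of the factors of `X × U₁ × U₂ × X*`. -/
def wittSplit (X U₁ U₂ : Type) [NormedAddCommGroup X] [NormedSpace ℝ X]
    [NormedAddCommGroup U₁] [NormedSpace ℝ U₁] [NormedAddCommGroup U₂] [NormedSpace ℝ U₂] :
    (X × U₁ × U₂ × (X →L[ℝ] ℝ)) ≃ₗ[ℝ] (X × U₁) × (U₂ × (X →L[ℝ] ℝ)) :=
  (LinearEquiv.prodAssoc ℝ X U₁ (U₂ × (X →L[ℝ] ℝ))).symm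

variable (J : BilinParam X K S) (β₁ : U₁ →L[ℝ] U₁ →L[ℝ] ℝ) (β₂ : U₂ →L[ℝ] U₂ →L[ℝ] ℝ)

/-- The linear map whose graph is the subspace with given parameters. -/
def wittMap (p : WittSlice X U₁ U₂ K × S) : (X × U₁) →L[ℝ] (U₂ × (X →L[ℝ] ℝ)) :=
  ((p.1.2.1 ∘L (ContinuousLinearMap.snd ℝ X U₁ - p.1.1.1 ∘L ContinuousLinearMap.fst ℝ X U₁)) + p.1.1.2 ∘L ContinuousLinearMap.fst ℝ X U₁).prod
    ((J.sym p.2 + J.skew p.1.2.2 - (1 / 2 : ℝ) • ((β₁ ∘L p.1.1.1).flip ∘L p.1.1.1 +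
      (β₂ ∘L p.1.1.2).flip ∘L p.1.1.2)) ∘L ContinuousLinearMap.fst ℝ X U₁
      - ((β₁ ∘L p.1.1.1).flip + (β₂ ∘L p.1.1.2).flip ∘L p.1.2.1) ∘L
        (ContinuousLinearMap.snd ℝ X U₁ - p.1.1.1 ∘L ContinuousLinearMap.fst ℝ X U₁))

/-- The subspace is spanned by a graph over `X`, which carries the parameters `c₁, c₂, σ, κ`, and by
the vectors `(0, w, A w, ·)` orthogonal to that graph. The point over `(x, v)` has `w = v - c₁ x`,
which explains the recurring difference. -/
theorem wittMap_mk (p : WittSlice X U₁ U₂ K × S) (x : X) (v : U₁) :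
    wittMap J β₁ β₂ p (x, v) = (p.1.2.1 (v - p.1.1.1 x) + p.1.1.2 x,
      J.sym p.2 x + J.skew p.1.2.2 x - (1 / 2 : ℝ) • ((β₁ ∘L p.1.1.1).flip (p.1.1.1 x) +
        (β₂ ∘L p.1.1.2).flip (p.1.1.2 x)) - ((β₁ ∘L p.1.1.1).flip (v - p.1.1.1 x) +
          (β₂ ∘L p.1.1.2).flip (p.1.2.1 (v - p.1.1.1 x)))) := rfl

/-- For operations such as `flip` and `prod`, which are linear in their operator arguments,
smoothness follows from linearity in finite dimensions. -/
theorem contDiff_of_isLinear {E F : Type*} [NormedAddCommGroup E] [NormedSpace ℝ E]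
    [FiniteDimensional ℝ E] [NormedAddCommGroup F] [NormedSpace ℝ F] (f : E → F)
    (h1 : ∀ x y, f (x + y) = f x + f y) (h2 : ∀ (a : ℝ) x, f (a • x) = a • f x) :
    ContDiff ℝ ∞ f :=
  (LinearMap.toContinuousLinearMap (⟨⟨f, h1⟩, h2⟩ : E →ₗ[ℝ] F)).contDiff

theorem contDiff_comp_flip (β : U₁ →L[ℝ] U₁ →L[ℝ] ℝ) :
    ContDiff ℝ ∞ (fun c : X →L[ℝ] U₁ => (β ∘L c).flip) := by
  have h1 : ∀ c c' : X →L[ℝ] U₁, (β ∘L (c + c')).flip = (β ∘L c).flip + (β ∘L c').flip :=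
    fun c c' => by ext; simp
  have h2 : ∀ (a : ℝ) (c : X →L[ℝ] U₁), (β ∘L (a • c)).flip = a • (β ∘L c).flip :=
    fun a c => by ext; simp
  exact contDiff_of_isLinear _ h1 h2

theorem contDiff_clm_prod : ContDiff ℝ ∞
    (fun p : ((X × U₁) →L[ℝ] U₂) × ((X × U₁) →L[ℝ] (X →L[ℝ] ℝ)) => p.1.prod p.2) := by
  have h1 : ∀ c c' : ((X × U₁) →L[ℝ] U₂) × ((X × U₁) →L[ℝ] (X →L[ℝ] ℝ)),
      (c.1 + c'.1).prod (c.2 + c'.2) = c.1.prod c.2 + c'.1.prod c'.2 := fun c c' => rfl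
  have h2 : ∀ (a : ℝ) (c : ((X × U₁) →L[ℝ] U₂) × ((X × U₁) →L[ℝ] (X →L[ℝ] ℝ))),
      (a • c.1).prod (a • c.2) = a • (c.1.prod c.2) := fun a c => rfl
  exact contDiff_of_isLinear _ h1 h2

theorem contDiff_wittMap : ContDiff ℝ ∞ (wittMap J β₁ β₂) := by
  have h1 : ContDiff ℝ ∞ (fun p : WittSlice X U₁ U₂ K × S => p.1.1.1) := by fun_prop
  have h2 : ContDiff ℝ ∞ (fun p : WittSlice X U₁ U₂ K × S => p.1.1.2) := by fun_prop
  have hf1 : ContDiff ℝ ∞ (fun p : WittSlice X U₁ U₂ K × S => (β₁ ∘L p.1.1.1).flip) :=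
    (contDiff_comp_flip β₁).comp h1
  have hf2 : ContDiff ℝ ∞ (fun p : WittSlice X U₁ U₂ K × S => (β₂ ∘L p.1.1.2).flip) :=
    (contDiff_comp_flip β₂).comp h2
  have hL : ContDiff ℝ ∞ (fun p : WittSlice X U₁ U₂ K × S =>
    (ContinuousLinearMap.snd ℝ X U₁ - p.1.1.1 ∘L ContinuousLinearMap.fst ℝ X U₁)) :=
    contDiff_const.sub (h1.clm_comp contDiff_const)
  have hA : ContDiff ℝ ∞ (fun p : WittSlice X U₁ U₂ K × S => p.1.2.1) := by fun_prop
  have hT : ContDiff ℝ ∞ (fun p : WittSlice X U₁ U₂ K × S =>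
      J.sym p.2 + J.skew p.1.2.2) := by fun_prop
  have ha := (hA.clm_comp hL).add (h2.clm_comp (contDiff_const (c := ContinuousLinearMap.fst ℝ X U₁)))
  have hb := ((hT.sub (((hf1.clm_comp h1).add (hf2.clm_comp h2)).const_smul (1 / 2 : ℝ))).clm_comp
      (contDiff_const (c := ContinuousLinearMap.fst ℝ X U₁))).sub ((hf1.add (hf2.clm_comp hA)).clm_comp hL)
  exact contDiff_clm_prod.comp (ha.prodMk hb)

/-- The derivative of `wittMap` at the origin. -/
def wittDeriv : (WittSlice X U₁ U₂ K × S) →ₗ[ℝ] ((X × U₁) →L[ℝ] (U₂ × (X →L[ℝ] ℝ))) where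
  toFun p := (p.1.2.1 ∘L ContinuousLinearMap.snd ℝ X U₁ +
      p.1.1.2 ∘L ContinuousLinearMap.fst ℝ X U₁).prod
    ((J.sym p.2 + J.skew p.1.2.2) ∘L ContinuousLinearMap.fst ℝ X U₁ -
      (β₁ ∘L p.1.1.1).flip ∘L ContinuousLinearMap.snd ℝ X U₁)
  map_add' p p' := by
    refine ContinuousLinearMap.ext fun z => Prod.ext ?_ (ContinuousLinearMap.ext fun y => ?_)
    · simp
      abel
    · simp
      ring
  map_smul' c p := by
    refine ContinuousLinearMap.ext fun z => Prod.ext ?_ (ContinuousLinearMap.ext fun y => ?_)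
    · simp
    · simp
      ring

theorem wittDeriv_mk (p : WittSlice X U₁ U₂ K × S) (x : X) (v : U₁) :
    wittDeriv J β₁ p (x, v) = (p.1.2.1 v + p.1.1.2 x,
      J.sym p.2 x + J.skew p.1.2.2 x - (β₁ ∘L p.1.1.1).flip v) := rfl

/-- Along a ray the parametrization is a cubic polynomial in `t` without constant term, so its
derivative at the origin can be read off. -/
theorem wittMap_smul (p : WittSlice X U₁ U₂ K × S) (x : X) (v : U₁) (t : ℝ) :
    wittMap J β₁ β₂ (t • p) (x, v) = t • wittDeriv J β₁ p (x, v) +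
      (t ^ 2 • (-(p.1.2.1 (p.1.1.1 x)), (1 / 2 : ℝ) • ((β₁ ∘L p.1.1.1).flip (p.1.1.1 x) -
        (β₂ ∘L p.1.1.2).flip (p.1.1.2 x)) - (β₂ ∘L p.1.1.2).flip (p.1.2.1 v)) +
      t ^ 3 • ((0 : U₂), (β₂ ∘L p.1.1.2).flip (p.1.2.1 (p.1.1.1 x)))) := by
  rw [wittMap_mk, wittDeriv_mk]
  refine Prod.ext ?_ (ContinuousLinearMap.ext fun y => ?_)
  · simp [smul_sub, smul_smul, pow_two]
    abel
  · simp
    ring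

/-- Differentiability is known from `contDiff_wittMap`, so the derivative is determined by its
values on rays, where `wittMap_smul` applies. -/
theorem hasFDerivAt_wittMap : HasFDerivAt (wittMap J β₁ β₂)
    (LinearMap.toContinuousLinearMap (wittDeriv J β₁)) 0 := by
  have h0 : DifferentiableAt ℝ (wittMap J β₁ β₂) 0 :=
    (contDiff_wittMap J β₁ β₂).differentiable (by simp) 0
  refine h0.hasFDerivAt.congr_fderiv ?_
  refine ContinuousLinearMap.ext fun p => ContinuousLinearMap.ext fun z => ?_
  have hc : HasDerivAt (fun t : ℝ => t • p) p 0 := by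
    simpa using (hasDerivAt_id (0 : ℝ)).smul_const p
  have h1 : HasDerivAt (fun t : ℝ => wittMap J β₁ β₂ (t • p))
      (fderiv ℝ (wittMap J β₁ β₂) 0 p) 0 := by
    refine HasFDerivAt.comp_hasDerivAt (l := wittMap J β₁ β₂) 0 ?_ hc
    rw [zero_smul]
    exact h0.hasFDerivAt
  have h2 : HasDerivAt (fun t : ℝ => wittMap J β₁ β₂ (t • p) z)
      (fderiv ℝ (wittMap J β₁ β₂) 0 p z) 0 := by
    simpa using h1.clm_apply (hasDerivAt_const (0 : ℝ) z)
  refine h2.unique ?_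
  obtain ⟨x, v⟩ := z
  simp only [wittMap_smul]
  have h3 := (hasDerivAt_id (0 : ℝ)).smul_const (wittDeriv J β₁ p (x, v))
  have h4 := fun n : ℕ => ((hasDerivAt_id (0 : ℝ)).pow n)
  refine (h3.add (((h4 2).smul_const _).add ((h4 3).smul_const _))).congr_deriv ?_
  simp

/-- The derivative of `wittMap` at the origin is bijective. -/
theorem bijective_wittDeriv (hβ₁ : Function.Bijective β₁) (hβ₁' : ∀ x y, β₁ x y = β₁ y x) :
    Function.Bijective (wittDeriv (U₂ := U₂) J β₁) := by
  have hflip : ∀ (c : X →L[ℝ] U₁) v, (β₁ ∘L c).flip v = (β₁ v) ∘L c := fun c v => by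
    ext x
    simp [hβ₁' (c x)]
  constructor
  · rw [injective_iff_map_eq_zero]
    rintro ⟨⟨⟨c₁, c₂⟩, A, κ⟩, σ⟩ hp
    have h1 : ∀ x v, wittDeriv J β₁ (((c₁, c₂), A, κ), σ) (x, v) = 0 := fun x v => by rw [hp]; rfl
    simp only [wittDeriv_mk] at h1
    have hA : A = 0 := ContinuousLinearMap.ext fun v => by simpa using congrArg Prod.fst (h1 0 v)
    have hc₂ : c₂ = 0 := ContinuousLinearMap.ext fun x => by
      simpa using congrArg Prod.fst (h1 x 0)
    have hσκ : ∀ x, J.sym σ x + J.skew κ x = 0 := fun x => by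
      simpa using congrArg Prod.snd (h1 x 0)
    have hc₁ : c₁ = 0 := by
      refine ContinuousLinearMap.ext fun x => ?_
      have h2 : β₁ (c₁ x) = 0 := ContinuousLinearMap.ext fun v => by
        have := congrArg (fun z => z.2 x) (h1 0 v)
        simpa using this
      exact hβ₁.1 (by simpa using h2)
    -- Adding the relation `σ + κ = 0` to its transpose leaves only the symmetric part.
    have hσ : J.sym σ = 0 := ContinuousLinearMap.ext fun x => ContinuousLinearMap.ext fun y => by
      have h2 := congrArg (fun f => f y) (hσκ x)
      have h3 := congrArg (fun f => f x) (hσκ y)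
      simp only [add_apply, zero_apply] at h2 h3
      rw [J.sym_swap, J.skew_swap] at h3
      simp only [zero_apply]
      linarith
    have hκ : J.skew κ = 0 := ContinuousLinearMap.ext fun x => by
      have := hσκ x
      rw [hσ] at this
      simpa using this
    have hσ' : σ = 0 := J.sym_injective (by simpa using hσ)
    have hκ' : κ = 0 := J.skew_injective (by simpa using hκ)
    rw [hA, hc₂, hc₁, hσ', hκ']
    rfl
  · intro T
    obtain ⟨σ, κ, hT⟩ := J.exists_sym_add_skew
      ((ContinuousLinearMap.snd ℝ U₂ (X →L[ℝ] ℝ)) ∘L T ∘L ContinuousLinearMap.inl ℝ X U₁)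
    -- Nondegeneracy of `β₁` is what makes `c₁` recoverable from the component `U₁ → X*` of `T`; the
    -- sign in `B` matches the one in `wittDeriv`.
    let e : U₁ ≃L[ℝ] (U₁ →L[ℝ] ℝ) :=
      (LinearEquiv.ofBijective β₁.toLinearMap hβ₁).toContinuousLinearEquiv
    have he : ∀ u, e u = β₁ u := fun u => rfl
    let B : U₁ →L[ℝ] X →L[ℝ] ℝ :=
      -((ContinuousLinearMap.snd ℝ U₂ (X →L[ℝ] ℝ)) ∘L T ∘L ContinuousLinearMap.inr ℝ X U₁)
    let c₁ : X →L[ℝ] U₁ := e.symm.toContinuousLinearMap ∘L B.flip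
    have hc₁ : ∀ x v, β₁ (c₁ x) v = B v x := fun x v => by
      rw [← he]
      simp [c₁]
    refine ⟨(((c₁, (ContinuousLinearMap.fst ℝ U₂ (X →L[ℝ] ℝ)) ∘L T ∘L
      ContinuousLinearMap.inl ℝ X U₁), (ContinuousLinearMap.fst ℝ U₂ (X →L[ℝ] ℝ)) ∘L T ∘L
      ContinuousLinearMap.inr ℝ X U₁, κ), σ), ?_⟩
    refine ContinuousLinearMap.ext fun z => ?_
    obtain ⟨x, v⟩ := z
    have hz : T (x, v) = T (x, 0) + T (0, v) := by rw [← map_add]; simp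
    rw [wittDeriv_mk]
    refine Prod.ext ?_ (ContinuousLinearMap.ext fun y => ?_)
    · simp [hz, add_comm]
    · have h2 := congrArg (fun f => f x y) hT
      simp only [add_apply] at h2
      simp only [sub_apply, add_apply, ← h2, ContinuousLinearMap.flip_apply,
        ContinuousLinearMap.comp_apply, hc₁, hz, B]
      simp

end WittCharts

end

noncomputable section

/-! ### Signature and radical in terms of the parameters -/

section WittCharts

open Topology

variable {X U₁ U₂ K S : Type} [NormedAddCommGroup X] [NormedSpace ℝ X] [FiniteDimensional ℝ X]
  [NormedAddCommGroup U₁] [NormedSpace ℝ U₁] [FiniteDimensional ℝ U₁]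
  [NormedAddCommGroup U₂] [NormedSpace ℝ U₂] [FiniteDimensional ℝ U₂]
  [NormedAddCommGroup K] [NormedSpace ℝ K] [FiniteDimensional ℝ K]
  [NormedAddCommGroup S] [NormedSpace ℝ S] [FiniteDimensional ℝ S]
  {V : Type} [AddCommGroup V] [Module ℝ V] [FiniteDimensional ℝ V] {k r s : ℕ}
  (J : BilinParam X K S) (β₁ : U₁ →L[ℝ] U₁ →L[ℝ] ℝ) (β₂ : U₂ →L[ℝ] U₂ →L[ℝ] ℝ)
  (τ : V ≃ₗ[ℝ] X × U₁ × U₂ × (X →L[ℝ] ℝ)) (hk : Module.finrank ℝ (X × U₁) = k)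

/-- The subspace with given parameters. -/
def wittGr (p : WittSlice X U₁ U₂ K × S) : Gr k V :=
  (Gr.graphChart (τ.trans (wittSplit X U₁ U₂)) hk).symm (wittMap J β₁ β₂ p)

/-- The linear parametrization of the subspace with given parameters. -/
def wittParam (p : WittSlice X U₁ U₂ K × S) : (X × U₁) →ₗ[ℝ] V :=
  τ.symm.toLinearMap ∘ₗ (wittSplit X U₁ U₂).symm.toLinearMap ∘ₗ
    (LinearMap.id.prod (wittMap J β₁ β₂ p).toLinearMap) ∘ₗ
      ((LinearMap.fst ℝ X U₁).prod (LinearMap.snd ℝ X U₁ + p.1.1.1.toLinearMap ∘ₗ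
        LinearMap.fst ℝ X U₁))

/-- With the shifted coordinate `w` the radical candidates are the points `(x, 0)` and the
nondegenerate part consists of the points `(0, w)`. The terms after `σ` and `κ` are corrections for
the pairings of the middle components. -/
theorem apply_wittParam (p : WittSlice X U₁ U₂ K × S) (x : X) (w : U₁) :
    τ (wittParam J β₁ β₂ τ p (x, w)) = (x, w + p.1.1.1 x, p.1.2.1 w + p.1.1.2 x,
      J.sym p.2 x + J.skew p.1.2.2 x - (1 / 2 : ℝ) • ((β₁ ∘L p.1.1.1).flip (p.1.1.1 x) +
        (β₂ ∘L p.1.1.2).flip (p.1.1.2 x)) - ((β₁ ∘L p.1.1.1).flip w +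
          (β₂ ∘L p.1.1.2).flip (p.1.2.1 w))) := by
  have h : τ (wittParam J β₁ β₂ τ p (x, w)) = (x, w + p.1.1.1 x,
      wittMap J β₁ β₂ p (x, w + p.1.1.1 x)) := by
    simp [wittParam, wittSplit]
  rw [h, wittMap_mk]
  simp only [add_sub_cancel_right]

theorem wittParam_injective (p : WittSlice X U₁ U₂ K × S) :
    Function.Injective (wittParam J β₁ β₂ τ p) := by
  rw [injective_iff_map_eq_zero]
  rintro ⟨x, w⟩ h
  have h1 := apply_wittParam J β₁ β₂ τ p x w
  rw [h, map_zero] at h1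
  have hx : x = 0 := (congrArg Prod.fst h1).symm
  have hw := (congrArg (fun z => z.2.1) h1).symm
  subst hx
  simp only [map_zero, add_zero] at hw
  exact Prod.ext rfl hw

theorem mem_wittGr_iff (p : WittSlice X U₁ U₂ K × S) (v : V) :
    v ∈ (wittGr J β₁ β₂ τ hk p).1 ↔ ∃ z, wittParam J β₁ β₂ τ p z = v := by
  rw [wittGr, Gr.mem_graphChart_symm]
  constructor
  · intro h
    refine ⟨((τ v).1, (τ v).2.1 - p.1.1.1 (τ v).1), τ.injective ?_⟩
    have h' : (τ v).2.2 = wittMap J β₁ β₂ p ((τ v).1, (τ v).2.1) := h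
    rw [wittMap_mk] at h'
    rw [apply_wittParam]
    refine Prod.ext rfl (Prod.ext (by simp) ?_)
    rw [h']
  · rintro ⟨⟨x, w⟩, rfl⟩
    change (τ (wittParam J β₁ β₂ τ p (x, w))).2.2 = wittMap J β₁ β₂ p
      ((τ (wittParam J β₁ β₂ τ p (x, w))).1, (τ (wittParam J β₁ β₂ τ p (x, w))).2.1)
    rw [apply_wittParam, wittMap_mk]
    simp only [add_sub_cancel_right]

/-- The form on `U₁` induced by the embedding `u ↦ (u, A u)` into `U₁ × U₂`. -/
def graphForm (A : U₁ →L[ℝ] U₂) : U₁ →L[ℝ] U₁ →L[ℝ] ℝ :=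
  β₁ + (β₂ ∘L A).flip.comp A

theorem graphForm_apply (hβ₂ : ∀ x y, β₂ x y = β₂ y x) (A : U₁ →L[ℝ] U₂) (w w' : U₁) :
    graphForm β₁ β₂ A w w' = β₁ w w' + β₂ (A w) (A w') := by
  simp [graphForm, hβ₂ (A w')]

/-- The term `κ` cancels by skew-symmetry. The two halves of the quadratic correction cancel the
products of the values of `c₁` and `c₂`, and the remaining corrections cancel the mixed products
with `w` and `A w`. What is left is an orthogonal sum. -/
theorem wittForm_wittParam (hβ₁ : ∀ x y, β₁ x y = β₁ y x) (hβ₂ : ∀ x y, β₂ x y = β₂ y x)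
    (p : WittSlice X U₁ U₂ K × S) (x x' : X) (w w' : U₁) :
    wittForm β₁ β₂ (τ (wittParam J β₁ β₂ τ p (x, w))) (τ (wittParam J β₁ β₂ τ p (x', w'))) =
      2 * J.sym p.2 x x' + graphForm β₁ β₂ p.1.2.1 w w' := by
  rw [apply_wittParam, apply_wittParam, wittForm, graphForm_apply _ _ hβ₂]
  simp only [add_apply, sub_apply, smul_apply, ContinuousLinearMap.flip_apply,
    ContinuousLinearMap.comp_apply, map_add, smul_eq_mul]
  rw [J.sym_swap p.2 x' x, J.skew_swap p.1.2.2 x' x, hβ₁ (p.1.1.1 x') (p.1.1.1 x),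
    hβ₂ (p.1.1.2 x') (p.1.1.2 x), hβ₁ (p.1.1.1 x') w, hβ₂ (p.1.1.2 x') (p.1.2.1 w)]
  ring

variable {B : LinearMap.BilinForm ℝ V}

/-- Pulled back by `wittParam`, the form is `2σ` plus a nondegenerate form which already accounts
for the whole signature, so `hasSig_sum_iff` applies. Polarization passes from the quadratic form of
`σ` to `σ` itself. -/
theorem hasSig_wittGr_iff (hβ₁ : ∀ x y, β₁ x y = β₁ y x) (hβ₂ : ∀ x y, β₂ x y = β₂ y x)
    (hB : ∀ v w, B v w = wittForm β₁ β₂ (τ v) (τ w))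
    (p : WittSlice X U₁ U₂ K × S) (hd : r + s = Module.finrank ℝ U₁)
    (hp : HasSig (quadOf (graphForm β₁ β₂ p.1.2.1)) r s) :
    HasSig (B.toQuadraticMap.restrict (wittGr J β₁ β₂ τ hk p).1) r s ↔ p.2 = 0 := by
  have hmem : ∀ z, wittParam J β₁ β₂ τ p z ∈ (wittGr J β₁ β₂ τ hk p).1 := fun z =>
    (mem_wittGr_iff J β₁ β₂ τ hk p _).2 ⟨z, rfl⟩
  let e : (X × U₁) ≃ₗ[ℝ] (wittGr J β₁ β₂ τ hk p).1 :=
    LinearEquiv.ofBijective ((wittParam J β₁ β₂ τ p).codRestrict _ hmem)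
      ⟨fun x y h => wittParam_injective J β₁ β₂ τ p (congrArg Subtype.val h), fun v => by
        obtain ⟨z, hz⟩ := (mem_wittGr_iff J β₁ β₂ τ hk p _).1 v.2
        exact ⟨z, Subtype.ext hz⟩⟩
  let Q := (B.toQuadraticMap.restrict (wittGr J β₁ β₂ τ hk p).1).comp e.toLinearMap
  have hQ : ∀ z, Q z = quadOf ((2 : ℝ) • J.sym p.2) z.1 +
      quadOf (graphForm β₁ β₂ p.1.2.1) z.2 := by
    rintro ⟨x, w⟩
    change B (wittParam J β₁ β₂ τ p (x, w)) (wittParam J β₁ β₂ τ p (x, w)) = _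
    rw [hB, wittForm_wittParam _ _ _ _ hβ₁ hβ₂]
    simp
  rw [← hasSig_congr (Q := Q) e fun x => rfl, hasSig_sum_iff _ _ _ hQ hp hd]
  constructor
  · intro h
    apply J.sym_injective
    refine ContinuousLinearMap.ext fun x => ContinuousLinearMap.ext fun y => ?_
    have h1 : ∀ z, J.sym p.2 z z = 0 := fun z => by
      have := congrArg (fun f => f z) h
      simpa using this
    have h2 := h1 (x + y)
    simp only [map_add, add_apply, h1, J.sym_swap p.2 y x] at h2
    simp only [map_zero, zero_apply]
    linarith
  · intro h
    ext x
    simp [h]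

/-- For `σ = 0` the form is the zero form on `X` plus a nondegenerate one, whose radical is the `X`
summand. -/
theorem mem_radical_wittGr_iff (hβ₁ : ∀ x y, β₁ x y = β₁ y x) (hβ₂ : ∀ x y, β₂ x y = β₂ y x)
    (hB : ∀ v w, B v w = wittForm β₁ β₂ (τ v) (τ w))
    (p : WittSlice X U₁ U₂ K × S) (hd : r + s = Module.finrank ℝ U₁)
    (hp : HasSig (quadOf (graphForm β₁ β₂ p.1.2.1)) r s) (hp0 : p.2 = 0) (v : V) :
    v ∈ (wittGr J β₁ β₂ τ hk p).1 ⊓ B.orthogonal (wittGr J β₁ β₂ τ hk p).1 ↔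
      ∃ x, v = wittParam J β₁ β₂ τ p (x, 0) := by
  have hrad : (quadOf (graphForm β₁ β₂ p.1.2.1)).radical = ⊥ := by
    have := hp.finrank_radical
    exact Submodule.finrank_eq_zero.1 (by omega)
  have hsym : ∀ w w', graphForm β₁ β₂ p.1.2.1 w w' = graphForm β₁ β₂ p.1.2.1 w' w := fun w w' => by
    rw [graphForm_apply _ _ hβ₂, graphForm_apply _ _ hβ₂, hβ₁, hβ₂]
  constructor
  · rintro ⟨h1, h2⟩
    obtain ⟨⟨x, w⟩, rfl⟩ := (mem_wittGr_iff J β₁ β₂ τ hk p _).1 h1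
    have h3 : ∀ w', graphForm β₁ β₂ p.1.2.1 w' w = 0 := fun w' => by
      have h4 := h2 (wittParam J β₁ β₂ τ p (0, w')) ((mem_wittGr_iff J β₁ β₂ τ hk p _).2 ⟨_, rfl⟩)
      rw [hB, wittForm_wittParam _ _ _ _ hβ₁ hβ₂] at h4
      simpa using h4
    have h5 : w ∈ (quadOf (graphForm β₁ β₂ p.1.2.1)).radical := by
      rw [QuadraticMap.mem_radical_iff']
      refine ⟨h3 w, fun n => ?_⟩
      simp only [quadOf_apply, map_add, add_apply, h3, hsym w n]
      ring
    rw [hrad, Submodule.mem_bot] at h5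
    exact ⟨x, by rw [h5]⟩
  · rintro ⟨x, rfl⟩
    refine ⟨(mem_wittGr_iff J β₁ β₂ τ hk p _).2 ⟨_, rfl⟩, ?_⟩
    intro v hv
    obtain ⟨⟨x', w⟩, rfl⟩ := (mem_wittGr_iff J β₁ β₂ τ hk p _).1 hv
    rw [hB, wittForm_wittParam _ _ _ _ hβ₁ hβ₂, hp0]
    simp

theorem continuous_graphForm : Continuous (graphForm β₁ β₂) := by
  have h1 : ContDiff ℝ ∞ (fun A : U₁ →L[ℝ] U₂ => (β₂ ∘L A).flip) := contDiff_comp_flip β₂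
  have h2 : ContDiff ℝ ∞ (graphForm β₁ β₂) :=
    contDiff_const.add (h1.clm_comp contDiff_id)
  exact h2.continuous

theorem ContDiff.exists_openPartialHomeomorph_of_bijective {E F : Type*} [NormedAddCommGroup E]
    [NormedSpace ℝ E] [FiniteDimensional ℝ E] [NormedAddCommGroup F] [NormedSpace ℝ F]
    {f : E → F} {a : E} (hf : ContDiff ℝ ∞ f) (h : Function.Bijective fun x => fderiv ℝ f a x) :
    ∃ ψ : OpenPartialHomeomorph E F, (∀ x, ψ x = f x) ∧ a ∈ ψ.source ∧
      ContDiffOn ℝ ∞ ψ ψ.source ∧ ContDiffOn ℝ ∞ ψ.symm ψ.target := by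
  have := FiniteDimensional.complete ℝ E
  have h1 : HasFDerivAt f ((LinearEquiv.ofBijective (fderiv ℝ f a).toLinearMap
      h).toContinuousLinearEquiv : E →L[ℝ] F) a :=
    (hf.differentiable (by simp) a).hasFDerivAt.congr_fderiv (by ext x; rfl)
  exact ContDiffAt.exists_openPartialHomeomorph
    (Filter.Eventually.of_forall fun p => hf.contDiffAt) h1

/-- Smooth charts of the Grassmannian by the parameters of `wittGr`. -/
theorem exists_wittChart (hβ₁ : Function.Bijective β₁) (hβ₁' : ∀ x y, β₁ x y = β₁ y x)
    (hd : r + s = Module.finrank ℝ U₁) (hs : HasSig (quadOf β₁) r s) :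
    ∃ θ : OpenPartialHomeomorph (Gr k V) (WittSlice X U₁ U₂ K × S),
      ContMDiffOn 𝓘(ℝ, GrModel k V) 𝓘(ℝ, WittSlice X U₁ U₂ K × S) ∞ θ θ.source ∧
      ContMDiffOn 𝓘(ℝ, WittSlice X U₁ U₂ K × S) 𝓘(ℝ, GrModel k V) ∞ θ.symm θ.target ∧
      0 ∈ θ.target ∧ (∀ p, θ.symm p = wittGr J β₁ β₂ τ hk p) ∧
      ∀ p ∈ θ.target, HasSig (quadOf (graphForm β₁ β₂ p.1.2.1)) r s := by
  have hbij : Function.Bijective fun p => fderiv ℝ (wittMap J β₁ β₂) 0 p := by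
    rw [(hasFDerivAt_wittMap J β₁ β₂).fderiv]
    exact bijective_wittDeriv (U₂ := U₂) J β₁ hβ₁ hβ₁'
  obtain ⟨ψ, hψ, h0, hψ1, hψ2⟩ :=
    (contDiff_wittMap J β₁ β₂).exists_openPartialHomeomorph_of_bijective hbij
  -- The chart is shrunk so that `A` stays small enough for the form induced on `U₁` to keep its
  -- signature, which `hasSig_wittGr_iff` requires.
  have hev : ∀ᶠ p : WittSlice X U₁ U₂ K × S in 𝓝 0,
      HasSig (quadOf (graphForm β₁ β₂ p.1.2.1)) r s := by
    refine eventually_hasSig (β := fun p : WittSlice X U₁ U₂ K × S =>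
      graphForm β₁ β₂ p.1.2.1) ?_ ?_ hd
    · exact ((continuous_graphForm β₁ β₂).comp (by fun_prop)).continuousAt
    · have h0 : graphForm β₁ β₂ (0 : U₁ →L[ℝ] U₂) = β₁ :=
        ContinuousLinearMap.ext fun x => ContinuousLinearMap.ext fun y => by simp [graphForm]
      change HasSig (quadOf (graphForm β₁ β₂ 0)) r s
      rwa [h0]
  obtain ⟨N, hN, hNo, h0N⟩ := eventually_nhds_iff.1 hev
  let ψ' := ψ.restrOpen N hNo
  let Γ := Gr.graphChart (τ.trans (wittSplit X U₁ U₂)) hk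
  have hψ's : ψ'.source = ψ.source ∩ N := rfl
  refine ⟨Γ.trans ψ'.symm, ?_, ?_, ?_, ?_, ?_⟩
  · have h1 : ContDiffOn ℝ ∞ ψ'.symm ψ'.target := hψ2.mono fun y hy => hy.1
    exact h1.contMDiffOn.comp ((Gr.contMDiffOn_graphChart _ hk).mono fun W hW => hW.1)
      fun W hW => hW.2
  · have h1 : ContDiffOn ℝ ∞ ψ' ψ'.source := hψ1.mono fun y hy => hy.1
    refine (Gr.contMDiff_graphChart_symm (τ.trans (wittSplit X U₁ U₂)) hk).comp_contMDiffOn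
      (h1.contMDiffOn.mono fun p hp => ?_)
    exact hp.1
  · rw [OpenPartialHomeomorph.trans_target, Gr.graphChart_target]
    exact ⟨⟨h0, h0N⟩, trivial⟩
  · intro p
    change Γ.symm (ψ p) = _
    rw [hψ]
    rfl
  · intro p hp
    exact hN p hp.1.2

end WittCharts

end

noncomputable section

/-! ### Slices for orbits, for fibers and for the isotropic Grassmannian -/

section WittSlices

open Topology

variable {X U₁ U₂ K S : Type} [NormedAddCommGroup X] [NormedSpace ℝ X] [FiniteDimensional ℝ X]
  [NormedAddCommGroup U₁] [NormedSpace ℝ U₁] [FiniteDimensional ℝ U₁]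
  [NormedAddCommGroup U₂] [NormedSpace ℝ U₂] [FiniteDimensional ℝ U₂]
  [NormedAddCommGroup K] [NormedSpace ℝ K] [FiniteDimensional ℝ K]
  [NormedAddCommGroup S] [NormedSpace ℝ S] [FiniteDimensional ℝ S]
  {V : Type} [AddCommGroup V] [Module ℝ V] [FiniteDimensional ℝ V] {k r s : ℕ}
  {J : BilinParam X K S} {β₁ : U₁ →L[ℝ] U₁ →L[ℝ] ℝ} {β₂ : U₂ →L[ℝ] U₂ →L[ℝ] ℝ}
  {τ : V ≃ₗ[ℝ] X × U₁ × U₂ × (X →L[ℝ] ℝ)} {hk : Module.finrank ℝ (X × U₁) = k}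
  {B : LinearMap.BilinForm ℝ V}

/-- The properties of the parameters of an orbit which are used to build charts. -/
structure WittData (β₁ : U₁ →L[ℝ] U₁ →L[ℝ] ℝ) (β₂ : U₂ →L[ℝ] U₂ →L[ℝ] ℝ) (r s : ℕ) : Prop where
  bijective : Function.Bijective β₁
  symm₁ : ∀ x y, β₁ x y = β₁ y x
  symm₂ : ∀ x y, β₂ x y = β₂ y x
  finrank_eq : r + s = Module.finrank ℝ U₁
  hasSig : HasSig (quadOf β₁) r s

theorem wittMap_zero : wittMap J β₁ β₂ 0 = 0 := by
  refine ContinuousLinearMap.ext fun z => ?_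
  obtain ⟨x, w⟩ := z
  rw [wittMap_mk]
  simp

theorem mem_wittGr_zero_iff (v : V) :
    v ∈ (wittGr J β₁ β₂ τ hk 0).1 ↔ (τ v).2.2 = 0 := by
  rw [wittGr, Gr.mem_graphChart_symm, wittMap_zero]
  rfl

/-- Charts of the Grassmannian in which the subspaces of the given signature are the zero locus of
one component. -/
theorem WittData.exists_isSliceChart (h : WittData β₁ β₂ r s)
    (J : BilinParam X K S) (hk : Module.finrank ℝ (X × U₁) = k)
    (hB : ∀ v w, B v w = wittForm β₁ β₂ (τ v) (τ w)) (W : Gr k V)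
    (hW : ∀ v, v ∈ W.1 ↔ (τ v).2.2 = 0) :
    ∃ θ : OpenPartialHomeomorph (Gr k V) (WittSlice X U₁ U₂ K × S),
      IsSliceChart (GrModel k V)
        (Subtype.val : {W : Gr k V | HasSig (B.toQuadraticMap.restrict W.1) r s} → Gr k V) θ ∧
      W ∈ θ.source ∧ θ W = 0 ∧ (∀ p, θ.symm p = wittGr J β₁ β₂ τ hk p) ∧
      ∀ p ∈ θ.target, HasSig (quadOf (graphForm β₁ β₂ p.1.2.1)) r s := by
  obtain ⟨θ, h1, h2, h0, h3, h4⟩ := exists_wittChart J β₁ β₂ τ hk h.bijective h.symm₁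
    h.finrank_eq h.hasSig
  have hW0 : θ.symm 0 = W := by
    rw [h3]
    apply Gr.ext
    ext v
    rw [mem_wittGr_zero_iff, hW]
  refine ⟨θ, ⟨h1, h2, ?_⟩, hW0 ▸ θ.map_target h0, hW0 ▸ θ.right_inv h0, h3, h4⟩
  intro m hm
  rw [Subtype.range_coe]
  have hm' := θ.left_inv hm
  rw [h3] at hm'
  have := hasSig_wittGr_iff J β₁ β₂ τ hk h.symm₁ h.symm₂ hB (θ m) h.finrank_eq
    (h4 _ (θ.map_source hm))
  rw [hm'] at this
  exact this

/-- Reordering of the parameters. -/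
def wittFiberEquiv (X U₁ U₂ K S : Type) [NormedAddCommGroup X] [NormedSpace ℝ X]
    [NormedAddCommGroup U₁] [NormedSpace ℝ U₁] [NormedAddCommGroup U₂] [NormedSpace ℝ U₂]
    [NormedAddCommGroup K] [NormedSpace ℝ K] [NormedAddCommGroup S] [NormedSpace ℝ S] :
    (WittSlice X U₁ U₂ K × S) ≃L[ℝ]
      (U₁ →L[ℝ] U₂) × (((X →L[ℝ] U₁) × (X →L[ℝ] U₂)) × K × S) where
  toFun p := (p.1.2.1, p.1.1, p.1.2.2, p.2)
  invFun p := ((p.2.1, p.1, p.2.2.1), p.2.2.2)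
  left_inv _ := rfl
  right_inv _ := rfl
  map_add' _ _ := rfl
  map_smul' _ _ := rfl
  continuous_toFun := by fun_prop
  continuous_invFun := by fun_prop

/-- The radical is the graph over `X` given by `c₁`, `c₂` and `κ` with its quadratic correction. It
equals `X` exactly when these vanish, while `A` stays free. -/
theorem radical_wittGr_eq_iff (h : WittData β₁ β₂ r s)
    (hB : ∀ v w, B v w = wittForm β₁ β₂ (τ v) (τ w)) (p : WittSlice X U₁ U₂ K × S)
    (hp : HasSig (quadOf (graphForm β₁ β₂ p.1.2.1)) r s) (hp0 : p.2 = 0) (N : Submodule ℝ V)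
    (hN : ∀ v, v ∈ N ↔ (τ v).2 = 0) :
    (wittGr J β₁ β₂ τ hk p).1 ⊓ B.orthogonal (wittGr J β₁ β₂ τ hk p).1 = N ↔
      p.1.1 = 0 ∧ p.1.2.2 = 0 := by
  have key := mem_radical_wittGr_iff J β₁ β₂ τ hk h.symm₁ h.symm₂ hB p h.finrank_eq hp hp0
  constructor
  · intro e
    have h1 : ∀ x, (τ (wittParam J β₁ β₂ τ p (x, 0))).2 = 0 := fun x => by
      rw [← hN, ← e, key]
      exact ⟨x, rfl⟩
    simp only [apply_wittParam, zero_add, map_zero, Prod.mk_eq_zero] at h1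
    have hc₁ : p.1.1.1 = 0 := ContinuousLinearMap.ext fun x => (h1 x).1
    have hc₂ : p.1.1.2 = 0 := ContinuousLinearMap.ext fun x => (h1 x).2.1
    refine ⟨Prod.ext hc₁ hc₂, J.skew_injective (ContinuousLinearMap.ext fun x => ?_)⟩
    have h2 := (h1 x).2.2
    rw [hc₁, hc₂, hp0] at h2
    simpa using h2
  · rintro ⟨h1, h2⟩
    ext v
    rw [key, hN]
    have h3 : ∀ x, τ (wittParam J β₁ β₂ τ p (x, 0)) = (x, 0) := fun x => by
      rw [apply_wittParam, h1, h2, hp0]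
      simp
    constructor
    · rintro ⟨x, rfl⟩
      rw [h3]
    · intro hv
      refine ⟨(τ v).1, τ.injective ?_⟩
      rw [h3]
      exact Prod.ext rfl hv

/-- Charts of the Grassmannian in which the subspaces of the given signature with given radical are
the zero locus of one component. -/
theorem WittData.exists_isSliceChart_fiber (h : WittData β₁ β₂ r s)
    (J : BilinParam X K S) (hk : Module.finrank ℝ (X × U₁) = k)
    (hB : ∀ v w, B v w = wittForm β₁ β₂ (τ v) (τ w)) (W : Gr k V)
    (hW : ∀ v, v ∈ W.1 ↔ (τ v).2.2 = 0) (N : Submodule ℝ V) (hN : ∀ v, v ∈ N ↔ (τ v).2 = 0)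
    (F : Set (Gr k V)) (hF : ∀ W, W ∈ F ↔ HasSig (B.toQuadraticMap.restrict W.1) r s ∧
      W.1 ⊓ B.orthogonal W.1 = N) :
    ∃ θ : OpenPartialHomeomorph (Gr k V)
        ((U₁ →L[ℝ] U₂) × (((X →L[ℝ] U₁) × (X →L[ℝ] U₂)) × K × S)),
      IsSliceChart (GrModel k V) (Subtype.val : F → Gr k V) θ ∧ W ∈ θ.source ∧ θ W = 0 ∧
      ∀ p, θ.symm p = wittGr J β₁ β₂ τ hk ((wittFiberEquiv X U₁ U₂ K S).symm p) := by
  obtain ⟨θ, hθ, hWs, hW0, h3, h4⟩ := h.exists_isSliceChart J hk hB W hW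
  let E := wittFiberEquiv X U₁ U₂ K S
  refine ⟨θ.trans E.toHomeomorph.toOpenPartialHomeomorph, ⟨?_, ?_, ?_⟩, ?_, ?_, ?_⟩
  · exact E.contDiff.contMDiff.comp_contMDiffOn (hθ.contMDiffOn.mono fun x hx => hx.1)
  · refine hθ.contMDiffOn_symm.comp E.symm.contDiff.contMDiff.contMDiffOn ?_
    exact fun x hx => hx.2
  · intro m hm
    rw [Subtype.range_coe, hF]
    have hm0 : m ∈ θ.source := hm.1
    have h5 := hθ.mem_range_iff m hm0
    rw [Subtype.range_coe] at h5
    have h6 : HasSig (B.toQuadraticMap.restrict m.1) r s ↔ (θ m).2 = 0 := h5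
    have hm' := θ.left_inv hm0
    rw [h3] at hm'
    have h7 : (θ m).2 = 0 → ((m.1 ⊓ B.orthogonal m.1 = N) ↔
        ((θ m).1.1 = 0 ∧ (θ m).1.2.2 = 0)) := fun h0 => by
      have := radical_wittGr_eq_iff (J := J) (hk := hk) h hB (θ m) (h4 _ (θ.map_source hm0)) h0 N hN
      rwa [hm'] at this
    change _ ↔ (((θ m).1.1, (θ m).1.2.2, (θ m).2) : ((X →L[ℝ] U₁) × (X →L[ℝ] U₂)) × K × S) = 0
    rw [h6]
    constructor
    · rintro ⟨e, e'⟩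
      rw [((h7 e).1 e').1, ((h7 e).1 e').2, e]
      rfl
    · intro e
      have e1 := congrArg Prod.fst e
      have e2 := congrArg (fun z => z.2.1) e
      have e3 : (θ m).2 = 0 := congrArg (fun z => z.2.2) e
      exact ⟨e3, (h7 e3).2 ⟨e1, e2⟩⟩
  · exact ⟨hWs, trivial⟩
  · change E (θ W) = 0
    rw [hW0, map_zero]
  · intro p
    exact h3 _

variable {U₀ : Type} [NormedAddCommGroup U₀] [NormedSpace ℝ U₀] [FiniteDimensional ℝ U₀]

/-- The orthogonal sum of two forms. -/
def sumForm (β₁ : U₁ →L[ℝ] U₁ →L[ℝ] ℝ) (β₂ : U₂ →L[ℝ] U₂ →L[ℝ] ℝ) :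
    (U₁ × U₂) →L[ℝ] (U₁ × U₂) →L[ℝ] ℝ :=
  LinearMap.toContinuousBilinearMap (LinearMap.mk₂ ℝ (fun x y => β₁ x.1 y.1 + β₂ x.2 y.2)
    (fun x y z => by simp; ring) (fun c x y => by simp; ring) (fun x y z => by simp; ring)
    (fun c x y => by simp; ring))

@[simp]
theorem sumForm_apply (x y : U₁ × U₂) : sumForm β₁ β₂ x y = β₁ x.1 y.1 + β₂ x.2 y.2 := by
  simp [sumForm]

/-- Isotropic subspaces are the case of a zero-dimensional `U₁`, with all of `U₁ × U₂` moved into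
the complementary factor. The charts built for orbits thus serve for the isotropic Grassmannian too.
-/
theorem WittData.radical [Subsingleton U₀] (h : WittData β₁ β₂ r s) :
    WittData (0 : U₀ →L[ℝ] U₀ →L[ℝ] ℝ) (sumForm β₁ β₂) 0 0 where
  bijective := ⟨fun x y _ => Subsingleton.elim _ _, fun f => ⟨0, by
    ext x
    rw [Subsingleton.elim x 0]
    simp⟩⟩
  symm₁ _ _ := rfl
  symm₂ x y := by simp [h.symm₁ x.1, h.symm₂ x.2]
  finrank_eq := by simp [Module.finrank_zero_of_subsingleton]
  hasSig := by
    have := QuadraticForm.sigPos_add_sigNeg_add_radical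
      (Q := quadOf (0 : U₀ →L[ℝ] U₀ →L[ℝ] ℝ))
    have h0 : Module.finrank ℝ U₀ = 0 := Module.finrank_zero_of_subsingleton
    exact ⟨by omega, by omega⟩

/-- The frame adapted to the radical of a subspace. -/
def radicalFrame (U₀ : Type) [NormedAddCommGroup U₀] [NormedSpace ℝ U₀] [Unique U₀]
    (τ : V ≃ₗ[ℝ] X × U₁ × U₂ × (X →L[ℝ] ℝ)) :
    V ≃ₗ[ℝ] X × U₀ × (U₁ × U₂) × (X →L[ℝ] ℝ) :=
  τ.trans
    { toFun := fun m => (m.1, 0, (m.2.1, m.2.2.1), m.2.2.2)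
      invFun := fun m => (m.1, m.2.2.1.1, m.2.2.1.2, m.2.2.2)
      left_inv := fun _ => rfl
      right_inv := fun _ => Prod.ext rfl (Prod.ext (Subsingleton.elim _ _) rfl)
      map_add' := fun _ _ => Prod.ext rfl (Prod.ext (Subsingleton.elim _ _) rfl)
      map_smul' := fun _ _ => Prod.ext rfl (Prod.ext (Subsingleton.elim _ _) rfl) }

theorem radicalFrame_apply [Unique U₀] (v : V) :
    radicalFrame U₀ τ v = ((τ v).1, 0, ((τ v).2.1, (τ v).2.2.1), (τ v).2.2.2) := rfl

theorem wittForm_radicalFrame [Unique U₀] (v w : V) :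
    wittForm (0 : U₀ →L[ℝ] U₀ →L[ℝ] ℝ) (sumForm β₁ β₂) (radicalFrame U₀ τ v)
      (radicalFrame U₀ τ w) = wittForm β₁ β₂ (τ v) (τ w) := by
  simp only [wittForm, radicalFrame_apply, sumForm_apply, zero_apply]
  ring

/-- The effect on parameters of passing from a subspace to its radical. -/
def radicalParam (X U₁ U₂ K U₀ : Type) [NormedAddCommGroup X] [NormedSpace ℝ X]
    [FiniteDimensional ℝ X]
    [NormedAddCommGroup U₁] [NormedSpace ℝ U₁] [NormedAddCommGroup U₂] [NormedSpace ℝ U₂]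
    [FiniteDimensional ℝ U₁] [FiniteDimensional ℝ U₂]
    [NormedAddCommGroup K] [NormedSpace ℝ K] [FiniteDimensional ℝ K]
    [NormedAddCommGroup U₀] [NormedSpace ℝ U₀] :
    WittSlice X U₁ U₂ K →L[ℝ] WittSlice X U₀ (U₁ × U₂) K :=
  LinearMap.toContinuousLinearMap
    { toFun := fun p => ((0, p.1.1.prod p.1.2), 0, p.2.2)
      map_add' := fun p p' => by
        refine Prod.ext (Prod.ext ?_ rfl) (Prod.ext ?_ rfl) <;> simp
      map_smul' := fun c p => by
        refine Prod.ext (Prod.ext ?_ rfl) (Prod.ext ?_ rfl) <;> simp }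

theorem radicalParam_apply (p : WittSlice X U₁ U₂ K) :
    radicalParam X U₁ U₂ K U₀ p = ((0, p.1.1.prod p.1.2), 0, p.2.2) := rfl

/-- Parameters with values in, or arguments from, the trivial space `U₀` carry no information; the
others are matched by splitting a map into `U₁ × U₂` into its components. -/
theorem radicalParam_surjective [Subsingleton U₀] :
    Function.Surjective (radicalParam X U₁ U₂ K U₀) := by
  rintro ⟨⟨c, d⟩, A, κ⟩
  refine ⟨((ContinuousLinearMap.fst ℝ U₁ U₂ ∘L d, ContinuousLinearMap.snd ℝ U₁ U₂ ∘L d), 0, κ), ?_⟩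
  rw [radicalParam_apply]
  refine Prod.ext (Prod.ext ?_ ?_) (Prod.ext ?_ rfl)
  · ext x
    exact Subsingleton.elim _ _
  · ext x <;> rfl
  · ext x
    · rw [Subsingleton.elim x 0, map_zero, map_zero]
    · rw [Subsingleton.elim x 0, map_zero, map_zero]

/-- On the points `(x, 0)` the parametrization does not involve `A`, and its quadratic correction is
that of the single map `(c₁, c₂)` for the summed form. So it is the parametrization of an isotropic
subspace with the same `κ`. -/
theorem radical_wittGr_eq_wittGr [Unique U₀] (h : WittData β₁ β₂ r s)
    (hB : ∀ v w, B v w = wittForm β₁ β₂ (τ v) (τ w)) (p : WittSlice X U₁ U₂ K × S)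
    (hp : HasSig (quadOf (graphForm β₁ β₂ p.1.2.1)) r s) (hp0 : p.2 = 0) {l : ℕ}
    (hl : Module.finrank ℝ (X × U₀) = l) :
    (wittGr J β₁ β₂ τ hk p).1 ⊓ B.orthogonal (wittGr J β₁ β₂ τ hk p).1 =
      (wittGr J (0 : U₀ →L[ℝ] U₀ →L[ℝ] ℝ) (sumForm β₁ β₂) (radicalFrame U₀ τ) hl
        (radicalParam X U₁ U₂ K U₀ p.1, 0)).1 := by
  ext v
  rw [mem_radical_wittGr_iff J β₁ β₂ τ hk h.symm₁ h.symm₂ hB p h.finrank_eq hp hp0,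
    mem_wittGr_iff]
  have key : ∀ x u, wittParam J (0 : U₀ →L[ℝ] U₀ →L[ℝ] ℝ) (sumForm β₁ β₂) (radicalFrame U₀ τ)
      (radicalParam X U₁ U₂ K U₀ p.1, 0) (x, u) = wittParam J β₁ β₂ τ p (x, 0) := fun x u => by
    apply (radicalFrame U₀ τ).injective
    rw [apply_wittParam, radicalFrame_apply, apply_wittParam, radicalParam_apply]
    refine Prod.ext rfl (Prod.ext (Subsingleton.elim _ _) (Prod.ext ?_ ?_))
    · simp
    · rw [hp0, Subsingleton.elim u 0]
      ext y
      simp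
      ring
  constructor
  · rintro ⟨x, rfl⟩
    exact ⟨(x, 0), key x 0⟩
  · rintro ⟨⟨x, u⟩, rfl⟩
    exact ⟨x, key x u⟩

/-- In suitable charts, passing to the radical is given by a surjective linear map. -/
theorem WittData.exists_charts_radical [Unique U₀] (h : WittData β₁ β₂ r s)
    (J : BilinParam X K S) (hk : Module.finrank ℝ (X × U₁) = k) {l : ℕ}
    (hl : Module.finrank ℝ (X × U₀) = l)
    (hB : ∀ v w, B v w = wittForm β₁ β₂ (τ v) (τ w))
    (π : {W : Gr k V | HasSig (B.toQuadraticMap.restrict W.1) r s} →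
      {N : Gr l V | HasSig (B.toQuadraticMap.restrict N.1) 0 0})
    (hπ : ∀ W, (π W).1.1 = W.1.1 ⊓ B.orthogonal W.1.1)
    (W : {W : Gr k V | HasSig (B.toQuadraticMap.restrict W.1) r s})
    (hW : ∀ v, v ∈ W.1.1 ↔ (τ v).2.2 = 0) :
    ∃ (θ : OpenPartialHomeomorph (Gr k V) (WittSlice X U₁ U₂ K × S))
      (θ' : OpenPartialHomeomorph (Gr l V) (WittSlice X U₀ (U₁ × U₂) K × S))
      (G : WittSlice X U₁ U₂ K → WittSlice X U₀ (U₁ × U₂) K),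
      IsSliceChart (GrModel k V)
        (Subtype.val : {W : Gr k V | HasSig (B.toQuadraticMap.restrict W.1) r s} → Gr k V) θ ∧
      W.1 ∈ θ.source ∧ IsSliceChart (GrModel l V)
        (Subtype.val : {N : Gr l V | HasSig (B.toQuadraticMap.restrict N.1) 0 0} → Gr l V) θ' ∧
      (∀ᶠ s in 𝓝 W, (π s).1 ∈ θ'.source ∧ (θ' (π s).1).1 = G (θ s.1).1) ∧
      (∀ᶠ v in 𝓝 (θ W.1).1, ContDiffAt ℝ ∞ G v) ∧
      Function.Surjective (fderiv ℝ G (θ W.1).1) := by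
  obtain ⟨θ, hθ, hWs, hW0, h3, h4⟩ := h.exists_isSliceChart J hk hB W.1 hW
  have hB' : ∀ v w, B v w = wittForm (0 : U₀ →L[ℝ] U₀ →L[ℝ] ℝ) (sumForm β₁ β₂)
      (radicalFrame U₀ τ v) (radicalFrame U₀ τ w) := fun v w => by
    rw [wittForm_radicalFrame, hB]
  have hrad : ∀ s : {W : Gr k V | HasSig (B.toQuadraticMap.restrict W.1) r s}, s.1 ∈ θ.source →
      (π s).1 = wittGr J (0 : U₀ →L[ℝ] U₀ →L[ℝ] ℝ) (sumForm β₁ β₂) (radicalFrame U₀ τ) hl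
        (radicalParam X U₁ U₂ K U₀ (θ s.1).1, 0) := fun s hs => by
    apply Gr.ext
    rw [hπ]
    have h5 := radical_wittGr_eq_wittGr (J := J) (hk := hk) h hB (θ s.1)
      (h4 _ (θ.map_source hs)) ((hθ.mem_range_iff s.1 hs).1 ⟨s, rfl⟩) hl
    rwa [← h3, θ.left_inv hs] at h5
  -- The second chart is centred at the radical of `W`, whose parameters vanish since those of `W`
  -- do.
  obtain ⟨θ', hθ', hWs', hW0', h3', h4'⟩ := (h.radical (U₀ := U₀)).exists_isSliceChart J hl hB'
    (π W).1 (fun v => by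
      rw [hrad W hWs, hW0]
      have : (radicalParam X U₁ U₂ K U₀ (0 : WittSlice X U₁ U₂ K × S).1, (0 : S)) = 0 := by simp
      rw [this, mem_wittGr_zero_iff])
  refine ⟨θ, θ', radicalParam X U₁ U₂ K U₀, hθ, hWs, hθ', ?_, ?_, ?_⟩
  -- Near `W` the radical parameters stay in the target of `θ'` by continuity, so `θ'` inverts its
  -- own parametrization there.
  · have hc : ContinuousAt (fun s : {W : Gr k V | HasSig (B.toQuadraticMap.restrict W.1) r s} =>
        ((radicalParam X U₁ U₂ K U₀ (θ s.1).1, 0) : WittSlice X U₀ (U₁ × U₂) K × S)) W := by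
      have h6 : ContinuousAt (fun s : {W : Gr k V | HasSig (B.toQuadraticMap.restrict W.1) r s} =>
        θ s.1) W := (θ.continuousAt hWs).comp continuous_subtype_val.continuousAt
      exact ((radicalParam X U₁ U₂ K U₀).continuous.continuousAt.comp h6.fst).prodMk
        continuousAt_const
    have h7 : ((radicalParam X U₁ U₂ K U₀ (θ W.1).1, 0) : WittSlice X U₀ (U₁ × U₂) K × S) ∈
        θ'.target := by
      rw [hW0]
      have : (radicalParam X U₁ U₂ K U₀ (0 : WittSlice X U₁ U₂ K × S).1, (0 : S)) = 0 := by simp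
      rw [this, ← hW0']
      exact θ'.map_source hWs'
    have h8 := hc.eventually (θ'.open_target.mem_nhds h7)
    have h9 : ∀ᶠ s : {W : Gr k V | HasSig (B.toQuadraticMap.restrict W.1) r s} in 𝓝 W,
        s.1 ∈ θ.source :=
      continuous_subtype_val.continuousAt.eventually (θ.open_source.mem_nhds hWs)
    filter_upwards [h8, h9] with s hs1 hs2
    rw [hrad s hs2, ← h3']
    exact ⟨θ'.map_target hs1, by rw [θ'.right_inv hs1]⟩
  · exact Filter.Eventually.of_forall fun v => (radicalParam X U₁ U₂ K U₀).contDiff.contDiffAt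
  · rw [ContinuousLinearMap.fderiv]
    exact radicalParam_surjective

end WittSlices

end

noncomputable section

/-! ### Coefficients of symmetric and skew-symmetric forms -/

section CoordinateForms

variable {ν : ℕ}

/-- The bilinear form `(x, y) ↦ x i * y j`. -/
def coordForm (i j : Fin ν) : (Fin ν → ℝ) →L[ℝ] (Fin ν → ℝ) →L[ℝ] ℝ :=
  ContinuousLinearMap.smulRight (ContinuousLinearMap.proj (R := ℝ) (φ := fun _ : Fin ν => ℝ) i)
    (ContinuousLinearMap.proj (R := ℝ) (φ := fun _ : Fin ν => ℝ) j)

theorem coordForm_apply (i j : Fin ν) (x y : Fin ν → ℝ) : coordForm i j x y = x i * y j := by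
  simp [coordForm]

/-- Linear combinations of given vectors as a continuous linear map. -/
def combination {ι E : Type*} [Fintype ι] [NormedAddCommGroup E] [NormedSpace ℝ E] (v : ι → E) :
    (ι → ℝ) →L[ℝ] E :=
  LinearMap.toContinuousLinearMap (Fintype.linearCombination ℝ v)

theorem combination_apply {ι E : Type*} [Fintype ι] [NormedAddCommGroup E] [NormedSpace ℝ E]
    (v : ι → E) (c : ι → ℝ) : combination v c = ∑ a, c a • v a := rfl

/-- The symmetric bilinear form with given coefficients. -/
def symCoeff (ν : ℕ) :
    (Sym2 (Fin ν) → ℝ) →L[ℝ] (Fin ν → ℝ) →L[ℝ] (Fin ν → ℝ) →L[ℝ] ℝ :=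
  combination fun z => ∑ i, ∑ j, if s(i, j) = z then coordForm i j else 0

theorem ite_apply_apply {E F G : Type*} [NormedAddCommGroup E] [NormedSpace ℝ E]
    [NormedAddCommGroup F] [NormedSpace ℝ F] [NormedAddCommGroup G] [NormedSpace ℝ G]
    (P : Prop) [Decidable P] (T : E →L[ℝ] F →L[ℝ] G) (x : E) (y : F) :
    (if P then T else 0) x y = if P then T x y else 0 := by
  split_ifs <;> rfl

theorem symCoeff_apply (σ : Sym2 (Fin ν) → ℝ) (x y : Fin ν → ℝ) :
    symCoeff ν σ x y = ∑ i, ∑ j, σ s(i, j) * (x i * y j) := by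
  have h : symCoeff ν σ x y = ∑ z, σ z * ∑ i, ∑ j, if s(i, j) = z then x i * y j else 0 := by
    rw [symCoeff, combination_apply]
    simp only [sum_apply, smul_apply, ite_apply_apply, coordForm_apply, smul_eq_mul]
  rw [h]
  simp only [Finset.mul_sum]
  rw [Finset.sum_comm]
  refine Finset.sum_congr rfl fun i _ => ?_
  rw [Finset.sum_comm]
  refine Finset.sum_congr rfl fun j _ => ?_
  simp

/-- The skew-symmetric bilinear form with given coefficients. -/
def skewCoeff (ν : ℕ) : ({p : Fin ν × Fin ν // p.1 < p.2} → ℝ) →L[ℝ]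
    (Fin ν → ℝ) →L[ℝ] (Fin ν → ℝ) →L[ℝ] ℝ :=
  combination fun p => coordForm p.1.1 p.1.2 - coordForm p.1.2 p.1.1

theorem skewCoeff_apply (κ : {p : Fin ν × Fin ν // p.1 < p.2} → ℝ) (x y : Fin ν → ℝ) :
    skewCoeff ν κ x y = ∑ p, κ p * (x p.1.1 * y p.1.2 - x p.1.2 * y p.1.1) := by
  rw [skewCoeff, combination_apply]
  simp only [sum_apply, smul_apply, sub_apply, coordForm_apply, smul_eq_mul]

theorem symCoeff_single (σ : Sym2 (Fin ν) → ℝ) (i j : Fin ν) :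
    symCoeff ν σ (Pi.single i 1) (Pi.single j 1) = σ s(i, j) := by
  simp [symCoeff_apply, Pi.single_apply]

theorem skewCoeff_swap (κ : {p : Fin ν × Fin ν // p.1 < p.2} → ℝ) (x y : Fin ν → ℝ) :
    skewCoeff ν κ x y = -skewCoeff ν κ y x := by
  rw [skewCoeff_apply, skewCoeff_apply, ← Finset.sum_neg_distrib]
  refine Finset.sum_congr rfl fun p _ => ?_
  ring

theorem skewCoeff_single (κ : {p : Fin ν × Fin ν // p.1 < p.2} → ℝ) {i j : Fin ν} (h : i < j) :
    skewCoeff ν κ (Pi.single i 1) (Pi.single j 1) = κ ⟨(i, j), h⟩ := by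
  rw [skewCoeff_apply, Finset.sum_eq_single ⟨(i, j), h⟩]
  · simp [h.ne']
  · rintro ⟨⟨a, b⟩, hab⟩ - hne
    have hne' : ¬ (a = i ∧ b = j) := fun e => hne (Subtype.ext (Prod.ext e.1 e.2))
    have hne2 : ¬ (b = i ∧ a = j) := fun e => by
      obtain ⟨rfl, rfl⟩ := e
      exact lt_asymm h hab
    simp only [Pi.single_apply]
    split_ifs <;> simp_all
  · simp

theorem bilin_ext {T T' : (Fin ν → ℝ) →L[ℝ] (Fin ν → ℝ) →L[ℝ] ℝ}
    (h : ∀ i j, T (Pi.single i 1) (Pi.single j 1) = T' (Pi.single i 1) (Pi.single j 1)) :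
    T = T' := by
  have h1 : ∀ i y, T (Pi.single i 1) y = T' (Pi.single i 1) y := fun i y => by
    rw [← Finset.univ_sum_single y]
    simp only [map_sum]
    refine Finset.sum_congr rfl fun j _ => ?_
    have e : (Pi.single j (y j) : Fin ν → ℝ) = y j • Pi.single j 1 := by
      rw [← Pi.single_smul, smul_eq_mul, mul_one]
    rw [e, map_smul, map_smul, h]
  refine ContinuousLinearMap.ext fun x => ContinuousLinearMap.ext fun y => ?_
  rw [← Finset.univ_sum_single x]
  simp only [map_sum, sum_apply]
  refine Finset.sum_congr rfl fun j _ => ?_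
  have e : (Pi.single j (x j) : Fin ν → ℝ) = x j • Pi.single j 1 := by
    rw [← Pi.single_smul, smul_eq_mul, mul_one]
  rw [e, map_smul, map_smul, smul_apply, smul_apply, h1]

/-- The parametrizations of symmetric and skew-symmetric forms by coefficients. -/
def coeffParam (ν : ℕ) : BilinParam (Fin ν → ℝ) ({p : Fin ν × Fin ν // p.1 < p.2} → ℝ)
    (Sym2 (Fin ν) → ℝ) where
  skew := skewCoeff ν
  sym := symCoeff ν
  skew_swap := skewCoeff_swap
  sym_swap σ x y := by
    rw [symCoeff_apply, symCoeff_apply, Finset.sum_comm]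
    refine Finset.sum_congr rfl fun i _ => Finset.sum_congr rfl fun j _ => ?_
    rw [Sym2.eq_swap]
    ring
  skew_injective κ κ' h := by
    ext ⟨⟨i, j⟩, hij⟩
    rw [← skewCoeff_single κ hij, h, skewCoeff_single]
  sym_injective σ σ' h := by
    ext z
    induction z with | _ i j
    rw [← symCoeff_single σ, h, symCoeff_single]
  exists_sym_add_skew T := by
    -- The coefficients are those of the symmetric and the skew-symmetric part of `T`.
    refine ⟨fun z => Sym2.lift ⟨fun i j => (T (Pi.single i 1) (Pi.single j 1) +
      T (Pi.single j 1) (Pi.single i 1)) / 2, fun i j => by simp only [add_comm]⟩ z,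
      fun p => (T (Pi.single p.1.1 1) (Pi.single p.1.2 1) -
      T (Pi.single p.1.2 1) (Pi.single p.1.1 1)) / 2, ?_⟩
    refine bilin_ext fun i j => ?_
    rw [add_apply, add_apply, symCoeff_single]
    rcases lt_trichotomy i j with h | rfl | h
    · rw [skewCoeff_single _ h]
      simp
      ring
    -- On the diagonal the skew part vanishes, being equal to its own negative.
    · have := skewCoeff_swap (fun p => (T (Pi.single p.1.1 1) (Pi.single p.1.2 1) -
        T (Pi.single p.1.2 1) (Pi.single p.1.1 1)) / 2) (Pi.single i 1) (Pi.single i 1)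
      simp only [Sym2.lift_mk]
      linarith
    · rw [skewCoeff_swap, skewCoeff_single _ h]
      simp
      ring

/-- This count of unordered pairs with repetition is the source of the codimension of the orbit. -/
theorem finrank_symCoeff (ν : ℕ) : Module.finrank ℝ (Sym2 (Fin ν) → ℝ) = ν * (ν + 1) / 2 := by
  rw [Module.finrank_fintype_fun_eq_card, Sym2.card, Fintype.card_fin, Nat.choose_two_right]
  simp [mul_comm]

end CoordinateForms

end

noncomputable section

/-! ### Sylvester's normal form and the standard model spaces -/

section NormalForms

/-- Two maps between finite types with fibers of the same size differ by a bijection. -/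
theorem exists_equiv_of_card_fiber {α β γ : Type*} [Fintype α] [Fintype β] [DecidableEq γ]
    (f : α → γ) (g : β → γ)
    (h : ∀ c, Fintype.card {a // f a = c} = Fintype.card {b // g b = c}) :
    ∃ e : α ≃ β, ∀ a, g (e a) = f a :=
  ⟨Equiv.ofFiberEquiv fun c => Fintype.equivOfCardEq (h c), fun a => Equiv.ofFiberEquiv_map _ a⟩

/-- Sylvester's normal form of a possibly degenerate quadratic form. -/
theorem HasSig.exists_normalForm {M : Type*} [AddCommGroup M] [Module ℝ M] [FiniteDimensional ℝ M]
    {Q : QuadraticForm ℝ M} {r s n : ℕ} (h : HasSig Q r s)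
    (hn : Module.finrank ℝ M = r + s + n) :
    ∃ e : M ≃ₗ[ℝ] (Fin n → ℝ) × Rpq r s, ∀ m, Q m = stdForm r s (e m).2 (e m).2 := by
  obtain ⟨w, hw⟩ := Q.equivalent_signType_weighted_sum_squared
  have hpos := QuadraticForm.sigPos_of_equiv_weightedSumSquares hw
  have hneg := QuadraticForm.sigNeg_of_equiv_weightedSumSquares hw
  rw [h.1] at hpos
  rw [h.2] at hneg
  let g : Fin n ⊕ (Fin r ⊕ Fin s) → SignType := Sum.elim (fun _ => 0) (Sum.elim (fun _ => 1) fun _ => -1)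
  have c1 : Fintype.card {a // w a = 1} = r := by
    rw [hpos, ← Nat.card_coe_set_eq, Nat.card_eq_fintype_card]
    refine Fintype.card_congr (Equiv.subtypeEquivRight fun a => ?_)
    change _ ↔ (0 : ℝ) < (w a : ℝ)
    rcases w a with _ | _ | _ <;> simp
  have c2 : Fintype.card {a // w a = -1} = s := by
    rw [hneg, ← Nat.card_coe_set_eq, Nat.card_eq_fintype_card]
    refine Fintype.card_congr (Equiv.subtypeEquivRight fun a => ?_)
    change _ ↔ (w a : ℝ) < 0
    rcases w a with _ | _ | _ <;> simp
  -- The number of zero weights is obtained by counting all indices according to their sign.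
  have c3 : Fintype.card {a // w a = 0} + Fintype.card {a // w a = -1} +
      Fintype.card {a // w a = 1} = Module.finrank ℝ M := by
    have h1 : ∑ c : SignType, Fintype.card {a // w a = c} = Module.finrank ℝ M := by
      rw [← Fintype.card_sigma, Fintype.card_congr (Equiv.sigmaFiberEquiv w), Fintype.card_fin]
    have h2 : (Finset.univ : Finset SignType) = {0, -1, 1} := rfl
    rwa [h2, Finset.sum_insert (by decide), Finset.sum_insert (by decide), Finset.sum_singleton,
      ← add_assoc] at h1
  -- Both sign patterns take each value equally often, so the coordinates can be permuted into the
  -- order: zeros, positive, negative.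
  obtain ⟨ε, hε⟩ := exists_equiv_of_card_fiber g w (by
    have d : ∀ c, Fintype.card {a // g a = c} =
        (if c = 0 then n else 0) + ((if c = 1 then r else 0) + (if c = -1 then s else 0)) := by
      intro c
      rw [Fintype.card_subtype, Finset.card_filter, Fintype.sum_sum_type, Fintype.sum_sum_type]
      simp [g, eq_comm]
    intro c
    rw [d]
    rcases c with _ | _ | _
    · change n + (0 + 0) = Fintype.card {a // w a = 0}
      omega
    · change 0 + (0 + s) = Fintype.card {a // w a = -1}
      omega
    · change 0 + (r + 0) = Fintype.card {a // w a = 1}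
      omega)
  obtain ⟨I⟩ := hw
  refine ⟨I.toLinearEquiv.trans ((LinearEquiv.funCongrLeft ℝ ℝ ε).trans
    (LinearEquiv.sumArrowLequivProdArrow _ _ ℝ ℝ)), fun m => ?_⟩
  rw [← I.map_app m, QuadraticMap.weightedSumSquares_apply, ← Equiv.sum_comp ε,
    Fintype.sum_sum_type, Fintype.sum_sum_type, stdForm_apply]
  simp only [hε, g]
  simp [sub_eq_add_neg]

theorem stdForm_symm {a b : ℕ} (x y : Rpq a b) : stdForm a b x y = stdForm a b y x := by
  simp only [stdForm_apply, mul_comm]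

/-- A symmetric form is determined by its quadratic form. -/
theorem bilin_eq_of_quad_eq {M : Type*} [AddCommGroup M] [Module ℝ M]
    {B B' : LinearMap.BilinForm ℝ M} (hB : ∀ x y, B x y = B y x) (hB' : ∀ x y, B' x y = B' y x)
    (h : ∀ x, B x x = B' x x) (x y : M) : B x y = B' x y := by
  have h1 := h (x + y)
  simp only [map_add, LinearMap.add_apply, h, hB y x, hB' y x] at h1
  linarith

/-- The orthogonal sum of a hyperbolic space of dimension `2ν` and of `ℝ^(a,b)`. -/
abbrev WittSpace (ν a b : ℕ) : Type := (Fin ν → ℝ) × Rpq a b × ((Fin ν → ℝ) →L[ℝ] ℝ)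

/-- The form of signature `(a + ν, b + ν)` on `WittSpace ν a b`. -/
def wittBilin (ν a b : ℕ) : LinearMap.BilinForm ℝ (WittSpace ν a b) :=
  LinearMap.mk₂ ℝ (fun m m' => m.2.2 m'.1 + m'.2.2 m.1 + stdForm a b m.2.1 m'.2.1)
    (fun x y z => by simp; ring) (fun c x y => by simp; ring) (fun x y z => by simp; ring)
    (fun c x y => by simp; ring)

theorem wittBilin_apply {ν a b : ℕ} (m m' : WittSpace ν a b) :
    wittBilin ν a b m m' = m.2.2 m'.1 + m'.2.2 m.1 + stdForm a b m.2.1 m'.2.1 := rfl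

theorem wittBilin_symm {ν a b : ℕ} (m m' : WittSpace ν a b) :
    wittBilin ν a b m m' = wittBilin ν a b m' m := by
  rw [wittBilin_apply, wittBilin_apply, stdForm_symm, add_comm (m.2.2 m'.1)]

theorem stdForm_nondegenerate {a b : ℕ} {x : Rpq a b} (h : ∀ y, stdForm a b y x = 0) : x = 0 := by
  ext j
  rcases j with j | j
  · simpa [stdForm_apply, Pi.single_apply] using h (Pi.single (.inl j) 1)
  · simpa [stdForm_apply, Pi.single_apply] using h (Pi.single (.inr j) 1)

theorem wittBilin_nondegenerate {ν a b : ℕ} {m : WittSpace ν a b}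
    (h : ∀ m', wittBilin ν a b m' m = 0) : m = 0 := by
  obtain ⟨x, u, ξ⟩ := m
  have h1 : ξ = 0 := by
    ext y
    simpa [wittBilin_apply] using h (y, 0, 0)
  have h2 : u = 0 := stdForm_nondegenerate fun y => by
    simpa [wittBilin_apply] using h (0, y, 0)
  have h3 : x = 0 := by
    ext j
    simpa [wittBilin_apply] using h (0, 0, ContinuousLinearMap.proj j)
  rw [h1, h2, h3]
  rfl

theorem sum_mul_self_pos {ι : Type*} [Fintype ι] {x : ι → ℝ} (hx : x ≠ 0) :
    0 < ∑ j, x j * x j := by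
  obtain ⟨j, hj⟩ := Function.ne_iff.1 hx
  exact Finset.sum_pos' (fun i _ => mul_self_nonneg _) ⟨j, Finset.mem_univ _, mul_self_pos.2 hj⟩

theorem hasSig_stdForm (a b : ℕ) : HasSig (stdForm a b).toQuadraticMap a b := by
  let e := (LinearEquiv.sumArrowLequivProdArrow (Fin a) (Fin b) ℝ ℝ).symm.toLinearMap
  have h := hasSig_of_maps (Q := (stdForm a b).toQuadraticMap)
    (e ∘ₗ LinearMap.inl ℝ (Fin a → ℝ) (Fin b → ℝ)) (e ∘ₗ LinearMap.inr ℝ (Fin a → ℝ) (Fin b → ℝ))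
    (0 : (Fin 0 → ℝ) →ₗ[ℝ] Rpq a b) (fun x hx => ?_) (fun x hx => ?_)
    (fun x y _ => Subsingleton.elim _ _) (fun x m => by simp) (by simp)
  · simpa using h
  · have := sum_mul_self_pos hx
    simpa [e, stdForm_apply] using this
  · have := sum_mul_self_pos hx
    simpa [e, stdForm_apply] using this

/-- The dual vector of `x` for the standard scalar product. -/
def flatMap (ν : ℕ) : (Fin ν → ℝ) →ₗ[ℝ] ((Fin ν → ℝ) →L[ℝ] ℝ) :=
  Fintype.linearCombination ℝ fun j => ContinuousLinearMap.proj j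

theorem flatMap_apply {ν : ℕ} (x y : Fin ν → ℝ) : flatMap ν x y = ∑ j, x j * y j := by
  simp [flatMap, Fintype.linearCombination_apply]

theorem finrank_wittSpace (ν a b : ℕ) :
    Module.finrank ℝ (WittSpace ν a b) = (a + ν) + (b + ν) := by
  have : Module.finrank ℝ ((Fin ν → ℝ) →L[ℝ] ℝ) = ν := by
    rw [← (LinearMap.toContinuousLinearMap (𝕜 := ℝ) (E := Fin ν → ℝ) (F' := ℝ)).finrank_eq,
      Module.finrank_linearMap]
    simp
  simp [this]
  omega

/-- Inside the hyperbolic part the graphs of `flatMap` and of its negative are definite of opposite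
signs, so this part contributes ν to each index. -/
theorem hasSig_wittBilin (ν a b : ℕ) :
    HasSig (wittBilin ν a b).toQuadraticMap (a + ν) (b + ν) := by
  let e := (LinearEquiv.sumArrowLequivProdArrow (Fin a) (Fin b) ℝ ℝ).symm.toLinearMap
  let fP : ((Fin a → ℝ) × (Fin ν → ℝ)) →ₗ[ℝ] WittSpace ν a b :=
    (LinearMap.snd ℝ _ _).prod ((e ∘ₗ LinearMap.inl ℝ (Fin a → ℝ) (Fin b → ℝ) ∘ₗ
      LinearMap.fst ℝ _ _).prod (flatMap ν ∘ₗ LinearMap.snd ℝ _ _))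
  let fN : ((Fin b → ℝ) × (Fin ν → ℝ)) →ₗ[ℝ] WittSpace ν a b :=
    (LinearMap.snd ℝ _ _).prod ((e ∘ₗ LinearMap.inr ℝ (Fin a → ℝ) (Fin b → ℝ) ∘ₗ
      LinearMap.fst ℝ _ _).prod (-flatMap ν ∘ₗ LinearMap.snd ℝ _ _))
  have hz : ∀ {n : ℕ} (x : Fin n → ℝ), 0 ≤ ∑ j, x j * x j := fun x =>
    Finset.sum_nonneg fun j _ => mul_self_nonneg _
  have hpos : ∀ {n m : ℕ} (z : (Fin n → ℝ) × (Fin m → ℝ)), z ≠ 0 →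
      0 < (∑ j, z.1 j * z.1 j) + 2 * ∑ j, z.2 j * z.2 j := fun z hz0 => by
    have h1 := hz z.1
    have h2 := hz z.2
    by_cases h : z.1 = 0
    · have h' : z.2 ≠ 0 := fun h' => hz0 (Prod.ext h h')
      have := sum_mul_self_pos h'
      linarith
    · have := sum_mul_self_pos h
      linarith
  have h := hasSig_of_maps (Q := (wittBilin ν a b).toQuadraticMap) fP fN
    (0 : (Fin 0 → ℝ) →ₗ[ℝ] WittSpace ν a b) (fun z hz0 => ?_) (fun z hz0 => ?_)
    (fun x y _ => Subsingleton.elim _ _) (fun x m => by simp) (by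
      rw [finrank_wittSpace]
      simp)
  · simpa using h
  · have := hpos z hz0
    simp [fP, e, wittBilin_apply, stdForm_apply, flatMap_apply]
    linarith
  · have := hpos z hz0
    simp [fN, e, wittBilin_apply, stdForm_apply, flatMap_apply]
    linarith

/-- The decomposition `ℝ^(r+a, s+b) = ℝ^(r,s) ⊕ ℝ^(a,b)`. -/
def rpqSplit (r a s b : ℕ) : Rpq (r + a) (s + b) ≃ₗ[ℝ] Rpq r s × Rpq a b where
  toFun z := (fun x => z (Sum.map (Fin.castAdd a) (Fin.castAdd b) x),
    fun x => z (Sum.map (Fin.natAdd r) (Fin.natAdd s) x))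
  invFun w := Sum.elim (Fin.addCases (fun j => w.1 (.inl j)) fun j => w.2 (.inl j))
    (Fin.addCases (fun j => w.1 (.inr j)) fun j => w.2 (.inr j))
  left_inv z := by
    ext j
    rcases j with j | j <;> induction j using Fin.addCases <;> simp
  right_inv w := by
    refine Prod.ext ?_ ?_ <;> ext j <;> rcases j with j | j <;> simp
  map_add' _ _ := rfl
  map_smul' _ _ := rfl

theorem rpqSplit_inl {r a s b : ℕ} (z : Rpq (r + a) (s + b)) :
    (∀ j, z (.inl (Fin.castAdd a j)) = (rpqSplit r a s b z).1 (.inl j)) ∧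
    (∀ j, z (.inr (Fin.castAdd b j)) = (rpqSplit r a s b z).1 (.inr j)) ∧
    (∀ j, z (.inl (Fin.natAdd r j)) = (rpqSplit r a s b z).2 (.inl j)) ∧
    (∀ j, z (.inr (Fin.natAdd s j)) = (rpqSplit r a s b z).2 (.inr j)) :=
  ⟨fun _ => rfl, fun _ => rfl, fun _ => rfl, fun _ => rfl⟩

theorem stdForm_rpqSplit {r a s b : ℕ} (z w : Rpq (r + a) (s + b)) :
    stdForm (r + a) (s + b) z w = stdForm r s (rpqSplit r a s b z).1 (rpqSplit r a s b w).1 +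
      stdForm a b (rpqSplit r a s b z).2 (rpqSplit r a s b w).2 := by
  simp only [stdForm_apply, Fin.sum_univ_add, rpqSplit_inl]
  ring

theorem mem_coordSubspace_iff {r a s b : ℕ} (z : Rpq (r + a) (s + b)) :
    z ∈ coordSubspace (r + a) (s + b) r s ↔ (rpqSplit r a s b z).2 = 0 := by
  change (∀ x, x ∉ firstBlock r s → z x = 0) ↔ _
  constructor
  · intro h
    ext j
    rcases j with j | j
    · exact h _ (by simp [firstBlock])
    · exact h _ (by simp [firstBlock])
  · intro h x hx
    rcases x with j | j <;> induction j using Fin.addCases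
    · simp [firstBlock] at hx
    · rw [(rpqSplit_inl z).2.2.1, h]
      rfl
    · simp [firstBlock] at hx
    · rw [(rpqSplit_inl z).2.2.2, h]
      rfl

end NormalForms

/-! ### Adapted frames for a subspace of a nondegenerate space -/

section Frames

variable {V : Type*} [AddCommGroup V] [Module ℝ V] [FiniteDimensional ℝ V]
  {B : LinearMap.BilinForm ℝ V} {r s ν : ℕ}

/-- A subspace and the form on it in normal form. -/
theorem HasSig.exists_subspace_normalForm (hB : ∀ x y, B x y = B y x) {W : Submodule ℝ V}
    (h : HasSig (B.toQuadraticMap.restrict W) r s) (hW : Module.finrank ℝ W = r + s + ν) :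
    ∃ e : (Fin ν → ℝ) × Rpq r s →ₗ[ℝ] V, Function.Injective e ∧ LinearMap.range e = W ∧
      ∀ z w, B (e z) (e w) = stdForm r s z.2 w.2 := by
  obtain ⟨e, he⟩ := h.exists_normalForm hW
  refine ⟨W.subtype ∘ₗ e.symm.toLinearMap, ?_, ?_, fun z w => ?_⟩
  · exact W.injective_subtype.comp e.symm.injective
  · rw [LinearMap.range_comp, LinearEquiv.range, Submodule.map_top, Submodule.range_subtype]
  · have h1 := bilin_eq_of_quad_eq (B := B.comp (W.subtype ∘ₗ e.symm.toLinearMap)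
      (W.subtype ∘ₗ e.symm.toLinearMap)) (B' := (stdForm r s).comp (LinearMap.snd ℝ _ _)
      (LinearMap.snd ℝ _ _)) (fun x y => hB _ _) (fun x y => stdForm_symm _ _) (fun x => by
        have := he (e.symm x)
        rw [LinearEquiv.apply_symm_apply] at this
        exact this) z w
    exact h1

/-- An isotropic complement dual to the radical of a subspace and orthogonal to a complement of the
radical. -/
theorem exists_dual_section (hB : ∀ x y, B x y = B y x) (hB' : B.Nondegenerate)
    (e : (Fin ν → ℝ) × Rpq r s →ₗ[ℝ] V) (he : Function.Injective e)
    (heB : ∀ z w, B (e z) (e w) = stdForm r s z.2 w.2) :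
    ∃ t : ((Fin ν → ℝ) →L[ℝ] ℝ) →ₗ[ℝ] V, (∀ ξ z, B (t ξ) (e z) = ξ z.1) ∧
      ∀ ξ ξ', B (t ξ) (t ξ') = 0 := by
  -- Nondegeneracy makes every functional on the ambient space a pairing, and functionals extend
  -- along the injection `e`; so vectors with prescribed pairings against `W` exist.
  have hsurj : Function.Surjective (e.dualMap ∘ₗ B) := by
    intro f
    obtain ⟨g, rfl⟩ := LinearMap.dualMap_surjective_of_injective he f
    obtain ⟨v, rfl⟩ := (LinearMap.BilinForm.toDual B hB').surjective g
    exact ⟨v, rfl⟩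
  obtain ⟨t₀, ht₀⟩ := LinearMap.exists_rightInverse_of_surjective _ (LinearMap.range_eq_top.2 hsurj)
  let t₁ : ((Fin ν → ℝ) →L[ℝ] ℝ) →ₗ[ℝ] V :=
    t₀ ∘ₗ (LinearMap.fst ℝ (Fin ν → ℝ) (Rpq r s)).dualMap ∘ₗ
      (LinearMap.toContinuousLinearMap (𝕜 := ℝ) (E := Fin ν → ℝ) (F' := ℝ)).symm.toLinearMap
  have ht₁ : ∀ ξ z, B (t₁ ξ) (e z) = ξ z.1 := fun ξ z =>
    congrArg (fun f => f z) (LinearMap.congr_fun ht₀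
      ((LinearMap.fst ℝ (Fin ν → ℝ) (Rpq r s)).dualMap ξ.toLinearMap))
  -- The vector `c ξ` of the radical represents the functional `ξ' ↦ B (t₁ ξ) (t₁ ξ')`, which
  -- measures the failure of `t₁` to be isotropic.
  let c : ((Fin ν → ℝ) →L[ℝ] ℝ) →ₗ[ℝ] (Fin ν → ℝ) :=
    LinearMap.pi fun j => B.flip (t₁ (ContinuousLinearMap.proj j)) ∘ₗ t₁
  have hc : ∀ ξ ξ', ξ' (c ξ) = B (t₁ ξ) (t₁ ξ') := fun ξ ξ' => by
    have h1 : ξ' = ∑ j, ξ' (Pi.single j 1) • ContinuousLinearMap.proj (R := ℝ) j := by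
      ext x
      conv_lhs => rw [← Finset.univ_sum_single x, map_sum]
      simp only [sum_apply, smul_apply, ContinuousLinearMap.proj_apply, smul_eq_mul]
      refine Finset.sum_congr rfl fun j _ => ?_
      have e : (Pi.single j (x j) : Fin ν → ℝ) = x j • Pi.single j 1 := by
        rw [← Pi.single_smul, smul_eq_mul, mul_one]
      rw [e, map_smul, smul_eq_mul, mul_comm]
    conv_rhs => rw [h1]
    conv_lhs => rw [h1]
    simp [c]
  -- Correcting by half of `c` in each argument removes the pairing once in total. The pairings with
  -- `W` are unaffected, since the radical is orthogonal to `W`.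
  refine ⟨t₁ - (1 / 2 : ℝ) • (e ∘ₗ LinearMap.inl ℝ _ _ ∘ₗ c), fun ξ z => ?_, fun ξ ξ' => ?_⟩
  · simp [ht₁, heB]
  · have h2 : ∀ ξ z, B (e z) (t₁ ξ) = ξ z.1 := fun ξ z => by rw [hB, ht₁]
    simp [ht₁, heB, h2, hc, hB (t₁ ξ') (t₁ ξ)]
    ring

/-- Every subspace is in standard position with respect to a suitable isometry of the ambient space
with a standard space. -/
theorem exists_wittFrame (hB : ∀ x y, B x y = B y x) (hB' : B.Nondegenerate) {W : Submodule ℝ V}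
    (h : HasSig (B.toQuadraticMap.restrict W) r s) (hW : Module.finrank ℝ W = r + s + ν) :
    ∃ (a b : ℕ) (τ : V ≃ₗ[ℝ] WittSpace ν (r + a) (s + b)),
      (∀ v w, B v w = wittBilin ν (r + a) (s + b) (τ v) (τ w)) ∧
      ∀ v, v ∈ W ↔ (τ v).2.1 ∈ coordSubspace (r + a) (s + b) r s ∧ (τ v).2.2 = 0 := by
  obtain ⟨e, he, heW, heB⟩ := h.exists_subspace_normalForm hB hW
  obtain ⟨t, hte, htt⟩ := exists_dual_section hB hB' e he heB
  have het : ∀ ξ z, B (e z) (t ξ) = ξ z.1 := fun ξ z => by rw [hB, hte]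
  let F : WittSpace ν r s →ₗ[ℝ] V :=
    LinearMap.coprod (e ∘ₗ LinearMap.inl ℝ _ _) (LinearMap.coprod (e ∘ₗ LinearMap.inr ℝ _ _) t)
  have hF0 : ∀ m, F m = e (m.1, m.2.1) + t m.2.2 := fun m => by
    have : ((m.1, m.2.1) : (Fin ν → ℝ) × Rpq r s) = (m.1, 0) + (0, m.2.1) := by simp
    rw [this, map_add, add_assoc]
    rfl
  have hF : ∀ m m', B (F m) (F m') = wittBilin ν r s m m' := fun m m' => by
    rw [hF0, hF0, wittBilin_apply]
    simp only [map_add, LinearMap.add_apply, heB, hte, het, htt]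
    ring
  have hFinj : Function.Injective F := by
    rw [injective_iff_map_eq_zero]
    intro m hm
    exact wittBilin_nondegenerate fun m' => by rw [← hF, hm, map_zero]
  let D := LinearMap.range F
  -- The span `D` of `W` and the dual subspace is nondegenerate, so it splits off orthogonally.
  have hD : IsCompl D (B.orthogonal D) := by
    rw [LinearMap.BilinForm.isCompl_orthogonal_iff_disjoint (fun x y h => by rw [hB, h]),
      Submodule.disjoint_def]
    rintro _ ⟨m, rfl⟩ hm
    rw [wittBilin_nondegenerate (m := m) fun m' => by
      rw [← hF]
      exact hm _ ⟨m', rfl⟩, map_zero]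
  let Q := B.toQuadraticMap.restrict (B.orthogonal D)
  -- A vector of the complement orthogonal to the complement is orthogonal to `D` as well, hence to
  -- everything.
  have hQ : Q.radical = ⊥ := by
    rw [eq_bot_iff]
    intro z hz
    rw [QuadraticMap.mem_radical_iff'] at hz
    have h1 : ∀ w : B.orthogonal D, B w.1 z.1 = 0 := fun w => by
      have h2 : B (z.1 + w.1) (z.1 + w.1) = B w.1 w.1 := hz.2 w
      have h3 : B z.1 z.1 = 0 := hz.1
      simp only [map_add, LinearMap.add_apply, h3, hB z.1 w.1] at h2
      linarith
    rw [Submodule.mem_bot]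
    ext1
    refine hB'.2 z.1 fun v => ?_
    obtain ⟨x, hx, y, hy, rfl⟩ := Submodule.mem_sup.1
      (hD.sup_eq_top ▸ Submodule.mem_top : v ∈ D ⊔ B.orthogonal D)
    rw [map_add, LinearMap.add_apply, h1 ⟨y, hy⟩]
    have : B x z.1 = 0 := z.2 x hx
    rw [this, add_zero]
  obtain ⟨a, b, hQs⟩ : ∃ a b, HasSig Q a b := ⟨_, _, rfl, rfl⟩
  have hQd := hQs.finrank_radical
  rw [hQ, finrank_bot] at hQd
  obtain ⟨f, hf, hfD, hfB⟩ := hQs.exists_subspace_normalForm (ν := 0) hB (by omega)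
  let S := rpqSplit r a s b
  -- The complement of `D`, in normal form, is inserted as the last coordinates of the middle
  -- factor, so that `W` meets the middle factor in ℝ^(r,s).
  let T : WittSpace ν (r + a) (s + b) →ₗ[ℝ] V :=
    F ∘ₗ (LinearMap.fst ℝ _ _).prod
      ((LinearMap.fst ℝ _ _ ∘ₗ S.toLinearMap ∘ₗ LinearMap.fst ℝ _ _ ∘ₗ LinearMap.snd ℝ _ _).prod
        (LinearMap.snd ℝ _ _ ∘ₗ LinearMap.snd ℝ _ _)) +
    f ∘ₗ LinearMap.inr ℝ _ _ ∘ₗ LinearMap.snd ℝ _ _ ∘ₗ S.toLinearMap ∘ₗ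
      LinearMap.fst ℝ _ _ ∘ₗ LinearMap.snd ℝ _ _
  have hT : ∀ m, T m = F (m.1, (S m.2.1).1, m.2.2) + f (0, (S m.2.1).2) := fun m => rfl
  have hfO : ∀ z m, B (F m) (f z) = 0 := fun z m => by
    have : f z ∈ B.orthogonal D := hfD ▸ ⟨z, rfl⟩
    exact this _ ⟨m, rfl⟩
  have hTB : ∀ m m', B (T m) (T m') = wittBilin ν (r + a) (s + b) m m' := fun m m' => by
    rw [hT, hT]
    simp only [map_add, LinearMap.add_apply, hfO, hB (f _) (F _), hF, hfB, wittBilin_apply]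
    rw [stdForm_rpqSplit]
    ring
  have hTinj : Function.Injective T := by
    rw [injective_iff_map_eq_zero]
    intro m hm
    exact wittBilin_nondegenerate fun m' => by rw [← hTB, hm, map_zero]
  have hTsurj : Function.Surjective T := by
    intro v
    obtain ⟨_, ⟨x, rfl⟩, y, hy, rfl⟩ := Submodule.mem_sup.1
      (hD.sup_eq_top ▸ Submodule.mem_top : v ∈ D ⊔ B.orthogonal D)
    rw [← hfD] at hy
    obtain ⟨⟨y0, y⟩, rfl⟩ := hy
    refine ⟨(x.1, S.symm (x.2.1, y), x.2.2), ?_⟩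
    rw [hT, Subsingleton.elim y0 0]
    simp
  let τ₀ := LinearEquiv.ofBijective T ⟨hTinj, hTsurj⟩
  let τ := τ₀.symm
  have hτ : ∀ v, T (τ v) = v := fun v => τ₀.apply_symm_apply v
  refine ⟨a, b, τ, fun v w => by rw [← hTB, hτ, hτ], fun v => ?_⟩
  rw [mem_coordSubspace_iff]
  constructor
  · intro hv
    rw [← heW] at hv
    obtain ⟨z, rfl⟩ := hv
    have : τ (e z) = (z.1, S.symm (z.2, 0), 0) := by
      apply hTinj
      rw [hτ, hT, hF0]
      simp only [LinearEquiv.apply_symm_apply]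
      rw [map_zero t, add_zero]
      exact (add_zero (e z)).symm.trans (congrArg (e z + ·) (map_zero f).symm)
    rw [this]
    simp [S]
  · rintro ⟨h1, h2⟩
    rw [← hτ v, hT, hF0, h2, ← heW]
    refine ⟨((τ v).1, (S (τ v).2.1).1), ?_⟩
    have h1' : (S (τ v).2.1).2 = 0 := h1
    rw [h1']
    have : ((0, 0) : (Fin 0 → ℝ) × Rpq a b) = 0 := rfl
    rw [this]
    simp

end Frames

end

noncomputable section

/-! ### Frames of ℝ^(p,q) and subspaces in standard position -/

section StandardFrames

variable {p q r s ν a b : ℕ}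

theorem nondegenerate_stdForm (p q : ℕ) : (stdForm p q).Nondegenerate :=
  ⟨fun x h => stdForm_nondegenerate fun y => by rw [stdForm_symm, h],
    fun _ h => stdForm_nondegenerate h⟩

/-- The linear isomorphism `τ` is isometric from `ℝ^(p,q)` to the standard space. -/
def IsWittFrame (τ : Rpq p q ≃ₗ[ℝ] WittSpace ν a b) : Prop :=
  ∀ v w, stdForm p q v w = wittBilin ν a b (τ v) (τ w)

/-- The standard position of a subspace in `WittSpace ν a b`. -/
def InStandardPosition (τ : Rpq p q ≃ₗ[ℝ] WittSpace ν a b) (r s : ℕ) (W : Submodule ℝ (Rpq p q)) :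
    Prop :=
  ∀ v, v ∈ W ↔ (τ v).2.1 ∈ coordSubspace a b r s ∧ (τ v).2.2 = 0

/-- This is Sylvester's law of inertia applied to the frame, and the source of all numerical
constraints. -/
theorem IsWittFrame.add_eq {τ : Rpq p q ≃ₗ[ℝ] WittSpace ν a b} (hτ : IsWittFrame τ) :
    a + ν = p ∧ b + ν = q := by
  have h1 := hasSig_stdForm p q
  have h2 := (hasSig_congr (Q := (stdForm p q).toQuadraticMap)
    (Q' := (wittBilin ν a b).toQuadraticMap) τ fun v => (hτ v v).symm).2 (hasSig_wittBilin ν a b)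
  exact ⟨h2.1.symm.trans h1.1, h2.2.symm.trans h1.2⟩

/-- The law of inertia determines the sizes of the middle factor by `p`, `q` and `ν`, so one model
space serves for all subspaces of the same type. -/
theorem exists_frame_of_hasSig {W : Submodule ℝ (Rpq p q)}
    (h : HasSig ((stdForm p q).toQuadraticMap.restrict W) r s)
    (hW : Module.finrank ℝ W = r + s + ν) :
    r + ν ≤ p ∧ s + ν ≤ q ∧ ∀ a b, a + ν = p → b + ν = q →
      ∃ τ : Rpq p q ≃ₗ[ℝ] WittSpace ν a b, IsWittFrame τ ∧ InStandardPosition τ r s W := by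
  obtain ⟨a, b, τ, hτ, hτW⟩ := exists_wittFrame stdForm_symm (nondegenerate_stdForm p q) h hW
  obtain ⟨h1, h2⟩ := IsWittFrame.add_eq hτ
  refine ⟨by omega, by omega, fun a' b' ha hb => ?_⟩
  obtain rfl : a' = r + a := by omega
  obtain rfl : b' = s + b := by omega
  exact ⟨τ, hτ, hτW⟩

theorem exists_frame (ha : a + ν = p) (hb : b + ν = q) :
    ∃ τ : Rpq p q ≃ₗ[ℝ] WittSpace ν a b, IsWittFrame τ := by
  have h1 := hasSig_wittBilin ν a b
  rw [ha, hb] at h1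
  obtain ⟨e, he⟩ := h1.exists_normalForm (n := 0) (by rw [finrank_wittSpace, ha, hb]; rfl)
  let e' : WittSpace ν a b ≃ₗ[ℝ] Rpq p q := e.trans
    { toFun := Prod.snd
      invFun := fun x => (0, x)
      left_inv := fun x => Prod.ext (Subsingleton.elim _ _) rfl
      right_inv := fun _ => rfl
      map_add' := fun _ _ => rfl
      map_smul' := fun _ _ => rfl }
  refine ⟨e'.symm, fun v w => ?_⟩
  have := bilin_eq_of_quad_eq (B := wittBilin ν a b)
    (B' := (stdForm p q).comp e'.toLinearMap e'.toLinearMap) wittBilin_symm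
    (fun x y => stdForm_symm _ _) (fun x => he x) (e'.symm v) (e'.symm w)
  rw [this]
  simp

/-- The subspace in standard position for the given frame. -/
def standardSubspace (τ : Rpq p q ≃ₗ[ℝ] WittSpace ν a b) (r s : ℕ) : Submodule ℝ (Rpq p q) :=
  ((⊤ : Submodule ℝ (Fin ν → ℝ)).prod ((coordSubspace a b r s).prod ⊥)).comap τ.toLinearMap

theorem mem_standardSubspace (τ : Rpq p q ≃ₗ[ℝ] WittSpace ν a b) (v : Rpq p q) :
    v ∈ standardSubspace τ r s ↔ (τ v).2.1 ∈ coordSubspace a b r s ∧ (τ v).2.2 = 0 := by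
  simp [standardSubspace]

theorem inStandardPosition_iff {τ : Rpq p q ≃ₗ[ℝ] WittSpace ν a b} {W : Submodule ℝ (Rpq p q)} :
    InStandardPosition τ r s W ↔ W = standardSubspace τ r s := by
  rw [Submodule.ext_iff]
  simp only [mem_standardSubspace]
  rfl

theorem IsWittFrame.standardSubspace {τ : Rpq p q ≃ₗ[ℝ] WittSpace ν a b} (hτ : IsWittFrame τ)
    (hr : r ≤ a) (hs : s ≤ b) :
    HasSig ((stdForm p q).toQuadraticMap.restrict (standardSubspace τ r s)) r s ∧
      Module.finrank ℝ (standardSubspace τ r s) = r + s + ν := by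
  obtain ⟨a, rfl⟩ := Nat.exists_eq_add_of_le hr
  obtain ⟨b, rfl⟩ := Nat.exists_eq_add_of_le hs
  let f : ((Fin ν → ℝ) × Rpq r s) →ₗ[ℝ] Rpq p q :=
    τ.symm.toLinearMap ∘ₗ (LinearMap.fst ℝ _ _).prod
      (((rpqSplit r a s b).symm.toLinearMap ∘ₗ LinearMap.inl ℝ _ _ ∘ₗ LinearMap.snd ℝ _ _).prod 0)
  have hf : ∀ z, τ (f z) = (z.1, (rpqSplit r a s b).symm (z.2, 0), 0) := fun z => by simp [f]
  have hmem : ∀ z, f z ∈ _root_.standardSubspace τ r s := fun z => by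
    rw [mem_standardSubspace, hf, mem_coordSubspace_iff]
    simp
  let e : ((Fin ν → ℝ) × Rpq r s) ≃ₗ[ℝ] _root_.standardSubspace τ r s :=
    LinearEquiv.ofBijective (f.codRestrict _ hmem) ⟨fun z w h => by
      have h1 : τ (f z) = τ (f w) := congrArg (fun z => τ z.1) h
      rw [hf, hf] at h1
      have h2 := congrArg Prod.fst h1
      have h3 := congrArg (fun z => (rpqSplit r a s b z.2.1).1) h1
      simp only [LinearEquiv.apply_symm_apply] at h2 h3
      exact Prod.ext h2 h3, fun v => by
      have hv := v.2
      rw [mem_standardSubspace, mem_coordSubspace_iff] at hv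
      refine ⟨((τ v.1).1, (rpqSplit r a s b (τ v.1).2.1).1), ?_⟩
      ext1
      apply τ.injective
      refine (hf _).trans (Prod.ext rfl (Prod.ext ?_ hv.2.symm))
      apply (rpqSplit r a s b).injective
      simp only [LinearEquiv.apply_symm_apply]
      exact Prod.ext rfl hv.1.symm⟩
  constructor
  · let Q := ((stdForm p q).toQuadraticMap.restrict (_root_.standardSubspace τ r s)).comp
      e.toLinearMap
    refine (hasSig_congr (Q := Q) e fun x => rfl).1 ((hasSig_sum_iff 0 _ Q (fun z => ?_)
      (hasSig_stdForm r s) (by simp)).2 rfl)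
    change stdForm p q (f z) (f z) = _
    rw [hτ, hf, wittBilin_apply, stdForm_rpqSplit]
    simp
  · rw [← e.finrank_eq]
    simp
    omega

theorem radical_standardSubspace {τ : Rpq p q ≃ₗ[ℝ] WittSpace ν a b} (hτ : IsWittFrame τ)
    (v : Rpq p q) :
    v ∈ standardSubspace τ r s ⊓ (stdForm p q).orthogonal (standardSubspace τ r s) ↔
      (τ v).2 = 0 := by
  constructor
  · rintro ⟨h1, h2⟩
    have h1' := (mem_standardSubspace τ v).1 h1
    refine Prod.ext (stdForm_nondegenerate fun y => ?_) h1'.2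
    -- The middle component of `v` lives on the first block, so truncating a test vector to that
    -- block does not change the pairing, and the truncation lies in the subspace.
    let y' : Rpq a b := fun j => by
      classical
      exact if j ∈ firstBlock r s then y j else 0
    have hy' : y' ∈ coordSubspace a b r s := fun j hj => by simp [y', hj]
    have h3 : stdForm p q (τ.symm (0, y', 0)) v = 0 :=
      h2 _ ((mem_standardSubspace τ _).2 (by simpa using hy'))
    rw [hτ] at h3
    simp only [LinearEquiv.apply_symm_apply, wittBilin_apply, map_zero, zero_apply, zero_add] at h3
    have h4 : ∀ j, y j * (τ v).2.1 j = y' j * (τ v).2.1 j := fun j => by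
      by_cases hj : j ∈ firstBlock r s
      · simp only [y', if_pos hj]
      · rw [h1'.1 j hj, mul_zero, mul_zero]
    rw [← h3, stdForm_apply, stdForm_apply]
    simp only [h4]
  · intro h
    have h1 : v ∈ standardSubspace τ r s := by
      rw [mem_standardSubspace, h]
      exact ⟨zero_mem _, rfl⟩
    refine ⟨h1, fun w hw => ?_⟩
    rw [mem_standardSubspace] at hw
    change stdForm p q w v = 0
    rw [hτ, wittBilin_apply, h, hw.2]
    simp

/-- Total isotropy means that the restricted form is zero, so the frame for signature `(0, 0)`
applies, with zero as its coordinate subspace. -/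
theorem IsWittFrame.isotropic_iff {N : Submodule ℝ (Rpq p q)}
    (hN : Module.finrank ℝ N = ν) (ha : a + ν = p) (hb : b + ν = q) :
    (∀ x ∈ N, ∀ y ∈ N, stdForm p q x y = 0) ↔
      ∃ τ : Rpq p q ≃ₗ[ℝ] WittSpace ν a b, IsWittFrame τ ∧ ∀ v, v ∈ N ↔ (τ v).2 = 0 := by
  constructor
  · intro h
    have h1 : (stdForm p q).toQuadraticMap.restrict N = 0 := by
      ext x
      exact h x.1 x.2 x.1 x.2
    have h2 : HasSig ((stdForm p q).toQuadraticMap.restrict N) 0 0 := by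
      have h3 := hasSig_of_maps (Q := (stdForm p q).toQuadraticMap.restrict N)
        (0 : (Fin 0 → ℝ) →ₗ[ℝ] N) (0 : (Fin 0 → ℝ) →ₗ[ℝ] N) LinearMap.id
        (fun x hx => (hx (Subsingleton.elim _ _)).elim)
        (fun x hx => (hx (Subsingleton.elim _ _)).elim) (fun x y h => h)
        (fun x m => by rw [h1]; rfl) (by simp)
      simpa using h3
    obtain ⟨-, -, h4⟩ := exists_frame_of_hasSig (ν := ν) h2 (by rw [hN]; omega)
    obtain ⟨τ, hτ, hτN⟩ := h4 a b ha hb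
    refine ⟨τ, hτ, fun v => ?_⟩
    rw [hτN v, Prod.ext_iff]
    refine and_congr_left fun _ => ⟨fun h => funext fun x => h x ?_, fun h => by
      rw [h]
      exact zero_mem _⟩
    rcases x with j | j <;> simp [firstBlock]
  · rintro ⟨τ, hτ, h⟩ x hx y hy
    rw [hτ, wittBilin_apply, (h x).1 hx, (h y).1 hy]
    simp

end StandardFrames

end

noncomputable section

/-! ### Determinants of block endomorphisms -/

section Determinants

/-- The determinant of a block triangular endomorphism. -/
theorem LinearMap.det_of_map_inl {M N : Type*} [AddCommGroup M] [Module ℝ M]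
    [FiniteDimensional ℝ M] [AddCommGroup N] [Module ℝ N] [FiniteDimensional ℝ N]
    (f : M × N →ₗ[ℝ] M × N) (h : ∀ x, (f (x, 0)).2 = 0) :
    LinearMap.det f = LinearMap.det (LinearMap.fst ℝ M N ∘ₗ f ∘ₗ LinearMap.inl ℝ M N) *
      LinearMap.det (LinearMap.snd ℝ M N ∘ₗ f ∘ₗ LinearMap.inr ℝ M N) := by
  let v₁ := Module.finBasis ℝ M
  let v₂ := Module.finBasis ℝ N
  rw [← LinearMap.det_toMatrix (v₁.prod v₂), ← LinearMap.det_toMatrix v₁,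
    ← LinearMap.det_toMatrix v₂]
  have h1 : LinearMap.toMatrix (v₁.prod v₂) (v₁.prod v₂) f = Matrix.fromBlocks
      (LinearMap.toMatrix v₁ v₁ (LinearMap.fst ℝ M N ∘ₗ f ∘ₗ LinearMap.inl ℝ M N))
      (LinearMap.toMatrix v₂ v₁ (LinearMap.fst ℝ M N ∘ₗ f ∘ₗ LinearMap.inr ℝ M N)) 0
      (LinearMap.toMatrix v₂ v₂ (LinearMap.snd ℝ M N ∘ₗ f ∘ₗ LinearMap.inr ℝ M N)) := by
    ext i j
    rcases i with i | i <;> rcases j with j | j <;> simp [LinearMap.toMatrix_apply, h]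
  rw [h1, Matrix.det_fromBlocks_zero₂₁]

/-- There is an injective endomorphism with given determinant which is diagonal with respect to the
decomposition of a product. -/
theorem exists_prodMap_det {m n : ℕ} (hmn : 0 < m + n) (c : ℝ) :
    ∃ (A : Module.End ℝ (Fin m → ℝ)) (D : Module.End ℝ (Fin n → ℝ)),
      LinearMap.det (A.prodMap D) = c := by
  have key : ∀ {k : ℕ}, 0 < k → ∃ A : Module.End ℝ (Fin k → ℝ), LinearMap.det A = c := by
    intro k hk
    refine ⟨Matrix.toLin' (Matrix.diagonal (Function.update 1 ⟨0, hk⟩ c)), ?_⟩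
    rw [LinearMap.det_toLin', Matrix.det_diagonal, Finset.prod_update_of_mem (Finset.mem_univ _)]
    simp
  rcases Nat.eq_zero_or_pos m with hm | hm
  · obtain ⟨D, hD⟩ := key (k := n) (by omega)
    exact ⟨1, D, by rw [LinearMap.det_prodMap, hD, map_one, one_mul]⟩
  · obtain ⟨A, hA⟩ := key hm
    exact ⟨A, 1, by rw [LinearMap.det_prodMap, hA, map_one, mul_one]⟩

end Determinants

/-! ### The special linear group, its action on Grassmannians, and isometries -/

section SpecialLinear

variable {p q k : ℕ}

/-- The element of the special linear group with given linear map. -/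
def SLpq.ofLinear (f : Module.End ℝ (Rpq p q)) (h : LinearMap.det f = 1) : SLpq p q :=
  ⟨LinearMap.toMatrix' f, by rw [LinearMap.det_toMatrix', h]⟩

@[simp]
theorem SLpq.ofLinear_mulVec (f : Module.End ℝ (Rpq p q)) (h : LinearMap.det f = 1)
    (v : Rpq p q) : (SLpq.ofLinear f h).1 *ᵥ v = f v := by
  rw [← Matrix.toLin'_apply, SLpq.ofLinear, Matrix.toLin'_toMatrix']

@[simp]
theorem SLpq.mulVec_inv_mulVec (g : SLpq p q) (v : Rpq p q) :
    g.1 *ᵥ ((g⁻¹ : SLpq p q).1 *ᵥ v) = v := by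
  rw [Matrix.mulVec_mulVec]
  have : g.1 * (g⁻¹ : SLpq p q).1 = 1 := congrArg Subtype.val (mul_inv_cancel g)
  rw [this, Matrix.one_mulVec]

@[simp]
theorem SLpq.inv_mulVec_mulVec (g : SLpq p q) (v : Rpq p q) :
    (g⁻¹ : SLpq p q).1 *ᵥ (g.1 *ᵥ v) = v := by
  simpa using SLpq.mulVec_inv_mulVec g⁻¹ v

theorem SLpq.ext_mulVec {g h : SLpq p q} (H : ∀ v, g.1 *ᵥ v = h.1 *ᵥ v) : g = h := by
  refine Subtype.ext (Matrix.toLin'.injective (LinearMap.ext fun v => ?_))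
  rw [Matrix.toLin'_apply, Matrix.toLin'_apply]
  exact H v

theorem SLpq.mul_mulVec (g h : SLpq p q) (v : Rpq p q) :
    (g * h).1 *ᵥ v = g.1 *ᵥ (h.1 *ᵥ v) := by
  rw [Matrix.mulVec_mulVec]
  rfl

theorem Gr.mulVec_mem_smul {g : SLpq p q} {W : Gr k (Rpq p q)} {v : Rpq p q} :
    g.1 *ᵥ v ∈ (g • W).1 ↔ v ∈ W.1 := by
  constructor
  · rintro ⟨w, hw, h⟩
    have h' : g.1 *ᵥ w = g.1 *ᵥ v := h
    have := congrArg (fun z => (g⁻¹ : SLpq p q).1 *ᵥ z) h'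
    simp only [SLpq.inv_mulVec_mulVec] at this
    rwa [← this]
  · intro h
    exact ⟨v, h, rfl⟩

theorem Gr.mem_smul_iff {g : SLpq p q} {W : Gr k (Rpq p q)} {v : Rpq p q} :
    v ∈ (g • W).1 ↔ (g⁻¹ : SLpq p q).1 *ᵥ v ∈ W.1 := by
  have h := Gr.mulVec_mem_smul (g := g) (W := W) (v := (g⁻¹ : SLpq p q).1 *ᵥ v)
  rwa [SLpq.mulVec_inv_mulVec] at h

theorem Gr.eq_of_le {V : Type*} [AddCommGroup V] [Module ℝ V] [FiniteDimensional ℝ V]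
    {W W' : Gr k V} (h : W.1 ≤ W'.1) : W = W' :=
  Gr.ext (Submodule.eq_of_le_of_finrank_eq h (W.2.trans W'.2.symm))

theorem Gr.smul_eq_of_forall {g : SLpq p q} {W W' : Gr k (Rpq p q)}
    (h : ∀ v ∈ W.1, g.1 *ᵥ v ∈ W'.1) : g • W = W' :=
  Gr.eq_of_le (by rintro _ ⟨v, hv, rfl⟩; exact h v hv)

theorem Gr.exists_split {V : Type*} [AddCommGroup V] [Module ℝ V] [FiniteDimensional ℝ V]
    (W : Gr k V) : ∃ φ : GrSplit k V, ∀ v, v ∈ W.1 ↔ (φ v).2 = 0 := by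
  obtain ⟨C, hC⟩ := Submodule.exists_isCompl W.1
  have hd : Module.finrank ℝ C = Module.finrank ℝ V - k := by
    have := Submodule.finrank_add_eq_of_isCompl hC
    rw [W.2] at this
    omega
  let e1 : W.1 ≃ₗ[ℝ] (Fin k → ℝ) := LinearEquiv.ofFinrankEq _ _ (by rw [W.2]; simp)
  let e2 : C ≃ₗ[ℝ] (Fin (Module.finrank ℝ V - k) → ℝ) :=
    LinearEquiv.ofFinrankEq _ _ (by rw [hd]; simp)
  exact ⟨(Submodule.prodEquivOfIsCompl _ _ hC).symm.trans (e1.prodCongr e2), fun v => by simp⟩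

/-- The special linear group acts transitively on the Grassmannian. -/
theorem Gr.exists_smul_eq (W W' : Gr k (Rpq p q)) : ∃ g : SLpq p q, g • W = W' := by
  obtain ⟨φ, hφ⟩ := W.exists_split
  obtain ⟨ψ, hψ⟩ := W'.exists_split
  rcases Nat.eq_zero_or_pos (k + (Module.finrank ℝ (Rpq p q) - k)) with h0 | h0
  -- In a zero-dimensional space no determinant other than one occurs, and there is nothing to
  -- correct.
  · refine ⟨1, Gr.smul_eq_of_forall fun v _ => ?_⟩
    have hd : Module.finrank ℝ (Rpq p q) = 0 := by omega
    have := Module.finrank_zero_iff.1 hd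
    rw [Subsingleton.elim ((1 : SLpq p q).1 *ᵥ v) 0]
    exact zero_mem _
  · let d := LinearMap.det (ψ.symm.toLinearMap ∘ₗ φ.toLinearMap)
    have hd : d ≠ 0 := (LinearEquiv.isUnit_det' (φ.trans ψ.symm)).ne_zero
    -- The determinant of the coordinate change is corrected by a map which respects the splitting,
    -- hence does not move the subspace.
    obtain ⟨A, D, hAD⟩ := exists_prodMap_det h0 d⁻¹
    let T : Module.End ℝ (Rpq p q) := ψ.symm.toLinearMap ∘ₗ (A.prodMap D) ∘ₗ φ.toLinearMap
    have hT : T = (ψ.symm.toLinearMap ∘ₗ φ.toLinearMap) ∘ₗ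
        (φ.symm.toLinearMap ∘ₗ (A.prodMap D) ∘ₗ φ.symm.symm.toLinearMap) := by
      refine LinearMap.ext fun v => ?_
      simp [T]
    have hdet : LinearMap.det T = 1 := by
      rw [hT, LinearMap.det_comp, LinearMap.det_conj, hAD]
      exact mul_inv_cancel₀ hd
    refine ⟨SLpq.ofLinear T hdet, Gr.smul_eq_of_forall fun v hv => ?_⟩
    rw [SLpq.ofLinear_mulVec, hψ]
    rw [hφ] at hv
    simp [T, hv]

theorem indefiniteDiagonal_mul_self : LieAlgebra.Orthogonal.indefiniteDiagonal (Fin p) (Fin q) ℝ *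
    LieAlgebra.Orthogonal.indefiniteDiagonal (Fin p) (Fin q) ℝ = 1 := by
  rw [LieAlgebra.Orthogonal.indefiniteDiagonal, Matrix.diagonal_mul_diagonal, ← Matrix.diagonal_one]
  congr 1
  ext j
  rcases j with j | j <;> simp

/-- The matrices of the isometries of the standard form. -/
theorem isometry_iff_transpose_mul {h : Matrix (Fin p ⊕ Fin q) (Fin p ⊕ Fin q) ℝ} :
    (∀ x y, stdForm p q (h *ᵥ x) (h *ᵥ y) = stdForm p q x y) ↔
      hᵀ * LieAlgebra.Orthogonal.indefiniteDiagonal (Fin p) (Fin q) ℝ * h =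
        LieAlgebra.Orthogonal.indefiniteDiagonal (Fin p) (Fin q) ℝ := by
  rw [← (Matrix.toBilin' (R₁ := ℝ) (n := Fin p ⊕ Fin q)).injective.eq_iff, ← Matrix.toBilin'_comp]
  constructor
  · intro H
    exact LinearMap.ext fun x => LinearMap.ext fun y => H x y
  · intro H x y
    exact LinearMap.congr_fun (LinearMap.congr_fun H x) y

theorem det_isometry {f : Module.End ℝ (Rpq p q)}
    (h : ∀ x y, stdForm p q (f x) (f y) = stdForm p q x y) :
    LinearMap.det f = 1 ∨ LinearMap.det f = -1 := by
  rw [← LinearMap.det_toMatrix' f]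
  set M := LinearMap.toMatrix' f
  have h1 : ∀ v, M *ᵥ v = f v := fun v => by
    rw [← Matrix.toLin'_apply, Matrix.toLin'_toMatrix']
  have h2 := (isometry_iff_transpose_mul (h := M)).1 (fun x y => by rw [h1, h1, h])
  have h3 := congrArg Matrix.det h2
  have h4 := congrArg Matrix.det (indefiniteDiagonal_mul_self (p := p) (q := q))
  rw [Matrix.det_mul, Matrix.det_mul, Matrix.det_transpose] at h3
  rw [Matrix.det_mul, Matrix.det_one] at h4
  set J := (LieAlgebra.Orthogonal.indefiniteDiagonal (Fin p) (Fin q) ℝ).det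
  have h5 : M.det * M.det = 1 := by
    linear_combination J * h3 + (1 - M.det * M.det) * h4
  exact mul_self_eq_one_iff.1 h5

theorem conjForm_apply (g : SLpq p q) (x y : Rpq p q) :
    conjForm g x y = stdForm p q (g.1 *ᵥ x) (g.1 *ᵥ y) := by
  simp [conjForm]

theorem SOpq.smul_mem_grOrbit {i r s : ℕ} {W : Gr i (Rpq p q)} {h : SLpq p q} (hh : h ∈ SOpq p q)
    (hW : W ∈ grOrbit p q i r s) : h • W ∈ grOrbit p q i r s := by
  let e : W.1 ≃ₗ[ℝ] (h • W).1 :=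
    (Matrix.SpecialLinearGroup.toLin' h).submoduleMap W.1
  refine (hasSig_congr (Q := (stdForm p q).toQuadraticMap.restrict W.1) e fun x => ?_).1 hW
  exact hh x.1 x.1

/-- The reflection in a coordinate hyperplane. -/
def coordReflection {a b : ℕ} (j : Fin a ⊕ Fin b) : Module.End ℝ (Rpq a b) :=
  Matrix.toLin' (Matrix.diagonal (Function.update 1 j (-1)))

theorem coordReflection_apply {a b : ℕ} (j : Fin a ⊕ Fin b) (x : Rpq a b) (l : Fin a ⊕ Fin b) :
    coordReflection j x l = Function.update (1 : Rpq a b) j (-1) l * x l := by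
  simp [coordReflection, Matrix.mulVec_diagonal]

theorem coordReflection_sign {a b : ℕ} (j l : Fin a ⊕ Fin b) :
    Function.update (1 : Rpq a b) j (-1) l * Function.update (1 : Rpq a b) j (-1) l = 1 := by
  rcases eq_or_ne l j with rfl | h
  · simp
  · simp [h]

theorem stdForm_coordReflection {a b : ℕ} (j : Fin a ⊕ Fin b) (x y : Rpq a b) :
    stdForm a b (coordReflection j x) (coordReflection j y) = stdForm a b x y := by
  have h : ∀ l, coordReflection j x l * coordReflection j y l = x l * y l := fun l => by
    rw [coordReflection_apply, coordReflection_apply]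
    linear_combination x l * y l * coordReflection_sign j l
  simp only [stdForm_apply, h]

theorem det_coordReflection {a b : ℕ} (j : Fin a ⊕ Fin b) :
    LinearMap.det (coordReflection j) = -1 := by
  rw [coordReflection, LinearMap.det_toLin', Matrix.det_diagonal,
    Finset.prod_update_of_mem (Finset.mem_univ _)]
  simp

theorem coordReflection_mem {a b r s : ℕ} (j : Fin a ⊕ Fin b) {x : Rpq a b}
    (hx : x ∈ coordSubspace a b r s) : coordReflection j x ∈ coordSubspace a b r s := by
  intro l hl
  rw [coordReflection_apply, hx l hl, mul_zero]

end SpecialLinear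

/-! ### Orbits of the special orthogonal group -/

section Transitivity

variable {p q r s ν a b : ℕ}

/-- Two subspaces of the same type are related by an element of the special orthogonal group,
except when both are maximal isotropic subspaces of a split space. -/
theorem exists_smul_standardSubspace {τ τ' : Rpq p q ≃ₗ[ℝ] WittSpace ν a b}
    (hτ : IsWittFrame τ) (hτ' : IsWittFrame τ') (hab : 0 < a + b) :
    ∃ h ∈ SOpq p q, ∀ v ∈ standardSubspace τ r s, h.1 *ᵥ v ∈ standardSubspace τ' r s := by
  -- An isometry `R` of the middle factor preserving ℝ^(r,s) may be inserted between the two frames;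
  -- this freedom is used to adjust the determinant.
  have key : ∀ R : Module.End ℝ (Rpq a b), (∀ x y, stdForm a b (R x) (R y) = stdForm a b x y) →
      (∀ x ∈ coordSubspace a b r s, R x ∈ coordSubspace a b r s) →
      ∀ hdet : LinearMap.det (τ'.symm.toLinearMap ∘ₗ
        (LinearMap.id.prodMap (R.prodMap LinearMap.id)) ∘ₗ τ.toLinearMap) = 1,
      ∃ h ∈ SOpq p q, ∀ v ∈ standardSubspace τ r s, h.1 *ᵥ v ∈ standardSubspace τ' r s := by
    intro R hR hR' hdet
    refine ⟨SLpq.ofLinear _ hdet, fun x y => ?_, fun v hv => ?_⟩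
    · rw [SLpq.ofLinear_mulVec, SLpq.ofLinear_mulVec, hτ', hτ]
      simp [wittBilin_apply, hR]
    · rw [SLpq.ofLinear_mulVec, mem_standardSubspace]
      rw [mem_standardSubspace] at hv
      simpa [hv.2] using hR' _ hv.1
  obtain h1 | h1 := det_isometry (f := τ'.symm.toLinearMap ∘ₗ τ.toLinearMap) (fun x y => by
    rw [hτ', hτ]
    simp)
  · refine key LinearMap.id (fun _ _ => rfl) (fun _ h => h) ?_
    rw [← h1, LinearMap.prodMap_id, LinearMap.prodMap_id, LinearMap.id_comp]
  -- A reflection needs a coordinate in the middle factor. This is where the split case with maximal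
  -- isotropic subspaces is excluded.
  · obtain ⟨j⟩ : Nonempty (Fin a ⊕ Fin b) := by
      rw [← Fintype.card_pos_iff]
      simpa using hab
    refine key (coordReflection j) (stdForm_coordReflection j)
      (fun _ h => coordReflection_mem j h) ?_
    have h2 : τ'.symm.toLinearMap ∘ₗ (LinearMap.id.prodMap
        ((coordReflection j).prodMap LinearMap.id)) ∘ₗ τ.toLinearMap =
        (τ'.symm.toLinearMap ∘ₗ τ.toLinearMap) ∘ₗ (τ.symm.toLinearMap ∘ₗ (LinearMap.id.prodMap
        ((coordReflection j).prodMap LinearMap.id)) ∘ₗ τ.symm.symm.toLinearMap) := by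
      refine LinearMap.ext fun v => ?_
      simp
    rw [h2, LinearMap.det_comp, LinearMap.det_conj, h1, LinearMap.det_prodMap,
      LinearMap.det_prodMap, det_coordReflection]
    simp

/-- Given `r + ν ≤ p` and `s + ν ≤ q`, the excluded case is precisely the vanishing of both `p - ν`
and `q - ν`. -/
theorem grOrbit_exists_smul {i : ℕ} (hi : i = r + s + ν) (hpq : r + s ≠ 0 ∨ p ≠ ν ∨ q ≠ ν)
    {W W' : Gr i (Rpq p q)} (hW : W ∈ grOrbit p q i r s) (hW' : W' ∈ grOrbit p q i r s) :
    ∃ h ∈ SOpq p q, h • W = W' := by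
  obtain ⟨h1, h2, h3⟩ := exists_frame_of_hasSig hW (W.2.trans hi)
  obtain ⟨-, -, h3'⟩ := exists_frame_of_hasSig hW' (W'.2.trans hi)
  obtain ⟨τ, hτ, hτW⟩ := h3 (p - ν) (q - ν) (by omega) (by omega)
  obtain ⟨τ', hτ', hτW'⟩ := h3' (p - ν) (q - ν) (by omega) (by omega)
  obtain ⟨h, hh, H⟩ := exists_smul_standardSubspace (r := r) (s := s) hτ hτ' (by omega)
  rw [inStandardPosition_iff] at hτW hτW'
  exact ⟨h, hh, Gr.smul_eq_of_forall (by rwa [hτW, hτW'])⟩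

theorem grOrbit_eq_orbit {i : ℕ} (hi : i = r + s + ν) (hpq : r + s ≠ 0 ∨ p ≠ ν ∨ q ≠ ν)
    {W : Gr i (Rpq p q)} (hW : W ∈ grOrbit p q i r s) :
    MulAction.orbit (SOpq p q) W = grOrbit p q i r s := by
  ext W'
  constructor
  · rintro ⟨h, rfl⟩
    exact SOpq.smul_mem_grOrbit h.2 hW
  · intro hW'
    obtain ⟨h, hh, e⟩ := grOrbit_exists_smul hi hpq hW hW'
    exact ⟨⟨h, hh⟩, e⟩

theorem grOrbit_nonempty_iff {i : ℕ} (hi : i = r + s + ν) (hr : r ≤ p) (hs : s ≤ q) :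
    (grOrbit p q i r s).Nonempty ↔ ν ≤ min (p - r) (q - s) := by
  constructor
  · rintro ⟨W, hW⟩
    obtain ⟨h1, h2, h3⟩ := exists_frame_of_hasSig hW (W.2.trans hi)
    rw [le_min_iff]
    omega
  · intro h
    rw [le_min_iff] at h
    obtain ⟨τ, hτ⟩ := exists_frame (p := p) (q := q) (ν := ν) (a := p - ν) (b := q - ν)
      (by omega) (by omega)
    obtain ⟨h1, h2⟩ := hτ.standardSubspace (r := r) (s := s) (by omega) (by omega)
    exact ⟨⟨standardSubspace τ r s, h2.trans hi.symm⟩, h1⟩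

end Transitivity

end

noncomputable section

/-! ### The stabilizer of the isotropic subspace and its graded pieces -/

section WittStabilizer

variable {ν a b r s : ℕ}

/-- The isometries of `WittSpace ν a b` of determinant one which preserve the isotropic subspace
`ℝ^ν`. -/
def wittStab (ν a b : ℕ) : Subgroup (WittSpace ν a b ≃ₗ[ℝ] WittSpace ν a b) where
  carrier := {T | (∀ m m', wittBilin ν a b (T m) (T m') = wittBilin ν a b m m') ∧
    LinearMap.det T.toLinearMap = 1 ∧ ∀ m, (T m).2 = 0 ↔ m.2 = 0}
  one_mem' := ⟨fun _ _ => rfl, LinearMap.det_id, fun _ => Iff.rfl⟩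
  mul_mem' {T T'} h h' := ⟨fun m m' => (h.1 _ _).trans (h'.1 _ _), by
    have : (T * T').toLinearMap = T.toLinearMap ∘ₗ T'.toLinearMap := rfl
    rw [this, LinearMap.det_comp, h.2.1, h'.2.1, one_mul],
    fun m => (h.2.2 _).trans (h'.2.2 m)⟩
  inv_mem' {T} h := by
    have e : ∀ m, T (T⁻¹ m) = m := fun m => T.apply_symm_apply m
    refine ⟨fun m m' => ?_, ?_, fun m => ?_⟩
    · rw [← h.1, e, e]
    · have h1 : T.toLinearMap ∘ₗ (T⁻¹).toLinearMap = LinearMap.id := LinearMap.ext e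
      have h2 := congrArg LinearMap.det h1
      rwa [LinearMap.det_comp, h.2.1, one_mul, LinearMap.det_id] at h2
    · rw [← h.2.2, e]

/-- The endomorphism of `ℝ^ν` induced by an element of `wittStab ν a b`. -/
def wittRadEnd (T : wittStab ν a b) : Module.End ℝ (Fin ν → ℝ) :=
  LinearMap.fst ℝ _ _ ∘ₗ T.1.toLinearMap ∘ₗ LinearMap.inl ℝ _ _

/-- The endomorphism of `ℝ^(a,b)` induced by an element of `wittStab ν a b`. -/
def wittMidEnd (T : wittStab ν a b) : Module.End ℝ (Rpq a b) :=
  LinearMap.fst ℝ _ _ ∘ₗ LinearMap.snd ℝ _ _ ∘ₗ T.1.toLinearMap ∘ₗ LinearMap.inr ℝ _ _ ∘ₗ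
    LinearMap.inl ℝ _ _

/-- The endomorphism of the dual of `ℝ^ν` induced by an element of `wittStab ν a b`. -/
def wittDualEnd (T : wittStab ν a b) : Module.End ℝ ((Fin ν → ℝ) →L[ℝ] ℝ) :=
  LinearMap.snd ℝ _ _ ∘ₗ LinearMap.snd ℝ _ _ ∘ₗ T.1.toLinearMap ∘ₗ LinearMap.inr ℝ _ _ ∘ₗ
    LinearMap.inr ℝ _ _

theorem wittStab.apply_rad (T : wittStab ν a b) (x : Fin ν → ℝ) :
    T.1 (x, 0) = (wittRadEnd T x, 0) :=
  Prod.ext rfl ((T.2.2.2 _).2 rfl)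

/-- Invariance of the pairing with ℝ^ν shows that the component on the dual is contragredient to the
action on ℝ^ν. -/
theorem wittStab.apply_snd_snd (T : wittStab ν a b) (m : WittSpace ν a b) :
    (T.1 m).2.2 ∘L LinearMap.toContinuousLinearMap (wittRadEnd T) = m.2.2 := by
  ext x
  have h := T.2.1 m (x, 0)
  rw [wittStab.apply_rad, wittBilin_apply, wittBilin_apply] at h
  simpa using h

theorem wittRadEnd_bijective (T : wittStab ν a b) : Function.Bijective (wittRadEnd T) := by
  have h : Function.Injective (wittRadEnd T) := by
    rw [injective_iff_map_eq_zero]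
    intro x hx
    have h1 := wittStab.apply_rad T x
    rw [hx] at h1
    have h2 : T.1 (x, 0) = 0 := h1
    rw [LinearEquiv.map_eq_zero_iff] at h2
    exact congrArg Prod.fst h2
  exact ⟨h, LinearMap.surjective_of_injective h⟩

/-- The vanishing of the last component describes the orthogonal space of ℝ^ν, which is preserved
along with ℝ^ν; the induced map on the quotient is `wittMidEnd`. -/
theorem wittStab.apply_perp (T : wittStab ν a b) {m : WittSpace ν a b} (hm : m.2.2 = 0) :
    (T.1 m).2 = (wittMidEnd T m.2.1, 0) := by
  have h : ∀ m : WittSpace ν a b, m.2.2 = 0 → (T.1 m).2.2 = 0 := fun m hm => by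
    have h1 := wittStab.apply_snd_snd T m
    rw [hm] at h1
    ext1 x
    obtain ⟨y, rfl⟩ := (wittRadEnd_bijective T).2 x
    exact congrArg (fun f => f y) h1
  refine Prod.ext ?_ (h m hm)
  have h2 : m = (m.1, 0) + (0, (m.2.1, 0)) := Prod.ext (by simp) (Prod.ext (by simp) (by simp [hm]))
  have h3 : T.1 m = T.1 (m.1, 0) + T.1 (0, (m.2.1, 0)) := by rw [← map_add, ← h2]
  rw [h3, wittStab.apply_rad]
  simp [wittMidEnd]

theorem stdForm_wittMidEnd (T : wittStab ν a b) (u u' : Rpq a b) :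
    stdForm a b (wittMidEnd T u) (wittMidEnd T u') = stdForm a b u u' := by
  have h := T.2.1 (0, (u, 0)) (0, (u', 0))
  rw [wittBilin_apply, wittBilin_apply, wittStab.apply_perp T rfl, wittStab.apply_perp T rfl] at h
  simpa using h

/-- The determinant of an endomorphism preserving the filtration of `WittSpace ν a b`. -/
theorem det_of_filtered {T : Module.End ℝ (WittSpace ν a b)} (h1 : ∀ x, (T (x, 0)).2 = 0)
    (h2 : ∀ m, m.2.2 = 0 → (T m).2.2 = 0) :
    LinearMap.det T = LinearMap.det (LinearMap.fst ℝ _ _ ∘ₗ T ∘ₗ LinearMap.inl ℝ _ _) *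
      (LinearMap.det (LinearMap.fst ℝ _ _ ∘ₗ LinearMap.snd ℝ _ _ ∘ₗ T ∘ₗ LinearMap.inr ℝ _ _ ∘ₗ
        LinearMap.inl ℝ _ _) *
      LinearMap.det (LinearMap.snd ℝ _ _ ∘ₗ LinearMap.snd ℝ _ _ ∘ₗ T ∘ₗ LinearMap.inr ℝ _ _ ∘ₗ
        LinearMap.inr ℝ _ _)) := by
  rw [LinearMap.det_of_map_inl T h1, LinearMap.det_of_map_inl (LinearMap.snd ℝ _ _ ∘ₗ T ∘ₗ
    LinearMap.inr ℝ _ _) fun u => h2 _ rfl]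
  rfl

theorem det_mul_det_of_dual {A : Module.End ℝ (Fin ν → ℝ)}
    {D : Module.End ℝ ((Fin ν → ℝ) →L[ℝ] ℝ)}
    (h : ∀ ξ x, D ξ (A x) = ξ x) : LinearMap.det A * LinearMap.det D = 1 := by
  let c := LinearMap.toContinuousLinearMap (𝕜 := ℝ) (E := Fin ν → ℝ) (F' := ℝ)
  have h1 : A.dualMap ∘ₗ (c.symm.toLinearMap ∘ₗ D ∘ₗ c.symm.symm.toLinearMap) = LinearMap.id := by
    refine LinearMap.ext fun ξ => LinearMap.ext fun x => ?_
    exact h (c ξ) x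
  have h2 := congrArg LinearMap.det h1
  rwa [LinearMap.det_comp, LinearMap.det_conj, LinearMap.det_dualMap, LinearMap.det_id] at h2

/-- The determinants on ℝ^ν and on its dual are inverse to each other, so the middle piece carries
the whole determinant. This is why the image lies in SO(a,b) and not merely in O(a,b). -/
theorem det_wittMidEnd (T : wittStab ν a b) : LinearMap.det (wittMidEnd T) = 1 := by
  have h1 := det_of_filtered (T := T.1.toLinearMap) (fun x => (T.2.2.2 _).2 rfl)
    (fun m hm => congrArg Prod.snd (wittStab.apply_perp T hm))
  have h2 : LinearMap.det (wittRadEnd T) * LinearMap.det (wittDualEnd T) = 1 :=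
    det_mul_det_of_dual fun ξ x =>
      congrArg (fun f => f x) (wittStab.apply_snd_snd T (0, (0, ξ)))
  rw [T.2.2.1] at h1
  have h3 : (1 : ℝ) = LinearMap.det (wittRadEnd T) * (LinearMap.det (wittMidEnd T) *
    LinearMap.det (wittDualEnd T)) := h1
  linear_combination -(LinearMap.det (wittMidEnd T)) * h2 - h3

/-- The homomorphism to `GL(ν, ℝ)`. -/
def wittRad (ν a b : ℕ) : wittStab ν a b →* GL (Fin ν) ℝ :=
  -- A multiplicative map from a group to matrices takes values in units, so no inverse needs to be
  -- exhibited.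
  MonoidHom.toHomUnits
    { toFun := fun T => LinearMap.toMatrix' (wittRadEnd T)
      map_one' := by
        have : wittRadEnd (1 : wittStab ν a b) = LinearMap.id := rfl
        rw [this, LinearMap.toMatrix'_id]
      map_mul' := fun T T' => by
        have : wittRadEnd (T * T') = wittRadEnd T ∘ₗ wittRadEnd T' := by
          refine LinearMap.ext fun x => ?_
          change (T.1 (T'.1 (x, 0))).1 = (T.1 ((T'.1 (x, 0)).1, 0)).1
          rw [wittStab.apply_rad]
        rw [this, LinearMap.toMatrix'_comp] }

theorem wittRad_mulVec (T : wittStab ν a b) (x : Fin ν → ℝ) :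
    (wittRad ν a b T).1 *ᵥ x = (T.1 (x, 0)).1 := by
  change LinearMap.toMatrix' (wittRadEnd T) *ᵥ x = _
  rw [← Matrix.toLin'_apply, Matrix.toLin'_toMatrix']
  rfl

/-- The homomorphism to `SO(a, b)`. -/
def wittMid (ν a b : ℕ) : wittStab ν a b →* SOpq a b :=
  MonoidHom.mk' (fun T => ⟨SLpq.ofLinear (wittMidEnd T) (det_wittMidEnd T), fun x y => by
    rw [SLpq.ofLinear_mulVec, SLpq.ofLinear_mulVec, stdForm_wittMidEnd]⟩) fun T T' => by
      refine Subtype.ext (SLpq.ext_mulVec fun v => ?_)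
      have : wittMidEnd (T * T') v = wittMidEnd T (wittMidEnd T' v) := by
        change (T.1 (T'.1 (0, v, 0))).2.1 = _
        have h : (T'.1 (0, v, 0)).2.2 = 0 := by rw [wittStab.apply_perp T' rfl]
        rw [wittStab.apply_perp T h, wittStab.apply_perp T' rfl]
      rw [Subgroup.coe_mul, SLpq.mul_mulVec, SLpq.ofLinear_mulVec, SLpq.ofLinear_mulVec,
        SLpq.ofLinear_mulVec, this]

theorem wittMid_mulVec (T : wittStab ν a b) (u : Rpq a b) :
    (wittMid ν a b T).1.1 *ᵥ u = wittMidEnd T u :=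
  SLpq.ofLinear_mulVec _ (det_wittMidEnd T) _

theorem wittMid_mulVec_apply (T : wittStab ν a b) {m : WittSpace ν a b} (hm : m.2.2 = 0) :
    (wittMid ν a b T).1.1 *ᵥ m.2.1 = (T.1 m).2.1 := by
  rw [wittMid_mulVec, wittStab.apply_perp T hm]

/-- The action on the dual space which corresponds to an element of `GL(ν, ℝ)`. -/
def dualAction (A : GL (Fin ν) ℝ) : ((Fin ν → ℝ) →L[ℝ] ℝ) ≃ₗ[ℝ] ((Fin ν → ℝ) →L[ℝ] ℝ) where
  toFun ξ := ξ ∘L LinearMap.toContinuousLinearMap (Matrix.toLin' (A⁻¹).1)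
  invFun ξ := ξ ∘L LinearMap.toContinuousLinearMap (Matrix.toLin' A.1)
  map_add' _ _ := rfl
  map_smul' _ _ := rfl
  left_inv ξ := by
    ext1 x
    simp [Matrix.mulVec_mulVec]
  right_inv ξ := by
    ext1 x
    simp [Matrix.mulVec_mulVec]

theorem dualAction_apply (A : GL (Fin ν) ℝ) (ξ : (Fin ν → ℝ) →L[ℝ] ℝ) (x : Fin ν → ℝ) :
    dualAction A ξ (A.1 *ᵥ x) = ξ x := by
  simp [dualAction, Matrix.mulVec_mulVec]

/-- The elements of `wittStab ν a b` with given components. -/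
theorem exists_wittStab (A : GL (Fin ν) ℝ) (L : SOpq a b) :
    ∃ T : wittStab ν a b, wittRad ν a b T = A ∧ wittMid ν a b T = L ∧
      ∀ m, T.1 m = (A.1 *ᵥ m.1, L.1.1 *ᵥ m.2.1, dualAction A m.2.2) := by
  let E : (Fin ν → ℝ) ≃ₗ[ℝ] (Fin ν → ℝ) := Matrix.GeneralLinearGroup.toLin A |>.toLinearEquiv
  let T : WittSpace ν a b ≃ₗ[ℝ] WittSpace ν a b :=
    LinearEquiv.prodCongr E
      (LinearEquiv.prodCongr (Matrix.SpecialLinearGroup.toLin' L.1) (dualAction A))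
  have hT : ∀ m, T m = (A.1 *ᵥ m.1, L.1.1 *ᵥ m.2.1, dualAction A m.2.2) := fun m => rfl
  have hmem : T ∈ wittStab ν a b := by
    refine ⟨fun m m' => ?_, ?_, fun m => ?_⟩
    · rw [hT, hT, wittBilin_apply, wittBilin_apply, dualAction_apply, dualAction_apply, L.2]
    · have h1 : T.toLinearMap = E.toLinearMap.prodMap ((Matrix.toLin' L.1.1).prodMap
        (dualAction A).toLinearMap) := rfl
      have h2 := det_mul_det_of_dual (A := E.toLinearMap) (D := (dualAction A).toLinearMap)
        fun ξ x => dualAction_apply A ξ x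
      rw [h1, LinearMap.det_prodMap, LinearMap.det_prodMap, LinearMap.det_toLin', L.1.2, one_mul, h2]
    · exact (LinearEquiv.prodCongr (Matrix.SpecialLinearGroup.toLin' L.1)
        (dualAction A)).map_eq_zero_iff
  refine ⟨⟨T, hmem⟩, ?_, ?_, hT⟩
  · refine Units.ext (Matrix.toLin'.injective (LinearMap.ext fun x => ?_))
    rw [Matrix.toLin'_apply, Matrix.toLin'_apply, wittRad_mulVec, hT]
  · refine Subtype.ext (SLpq.ext_mulVec fun u => ?_)
    rw [wittMid_mulVec]
    rfl

end WittStabilizer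

end

noncomputable section

/-! ### Block diagonal isometries as a stabilizer and as a fixed point group -/

section BlockDiagonal

variable {a b r s : ℕ}

/-- By equality of dimensions an invertible map sending `C` into itself maps it onto itself. -/
theorem SLpq.inv_mulVec_mem {C : Submodule ℝ (Rpq a b)} {h : SLpq a b}
    (H : ∀ z ∈ C, h.1 *ᵥ z ∈ C) {z : Rpq a b} (hz : z ∈ C) :
    (h⁻¹ : SLpq a b).1 *ᵥ z ∈ C := by
  have h1 : C.map (Matrix.SpecialLinearGroup.toLin' h).toLinearMap = C := by
    refine Submodule.eq_of_le_of_finrank_eq ?_ (LinearEquiv.finrank_map_eq _ _)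
    rintro _ ⟨w, hw, rfl⟩
    exact H w hw
  rw [← h1] at hz
  obtain ⟨w, hw, rfl⟩ := hz
  have : (h⁻¹ : SLpq a b).1 *ᵥ (h.1 *ᵥ w) ∈ C := by rwa [SLpq.inv_mulVec_mulVec]
  exact this

theorem single_mem_coordSubspace {y : Fin a ⊕ Fin b} (hy : y ∈ firstBlock r s) :
    Pi.single y 1 ∈ coordSubspace a b r s := by
  intro x hx
  exact Pi.single_eq_of_ne (fun e : x = y => hx (by rwa [e])) _

theorem stdForm_single (y : Fin a ⊕ Fin b) (z : Rpq a b) :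
    stdForm a b z (Pi.single y 1) = Sum.elim (fun _ => 1) (fun _ => -1) y * z y := by
  rcases y with j | j <;> simp [stdForm_apply, Pi.single_apply]

/-- The group `S(O(r,s) × O(a-r,b-s))` is the stabilizer of `ℝ^(r,s)`. -/
theorem mem_SOO_iff {h : SOpq a b} :
    h ∈ SOO a b r s ↔ ∀ z ∈ coordSubspace a b r s, h.1.1 *ᵥ z ∈ coordSubspace a b r s := by
  constructor
  · intro H z hz x hx
    change ∑ y, h.1.1 x y * z y = 0
    refine Finset.sum_eq_zero fun y _ => ?_
    by_cases hy : y ∈ firstBlock r s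
    · have : h.1.1 x y = 0 := H x y (by tauto)
      rw [this, zero_mul]
    · rw [hz y hy, mul_zero]
  · intro H x y hxy
    by_cases hy : y ∈ firstBlock r s
    · have h1 := H _ (single_mem_coordSubspace hy) x (by tauto)
      simpa using h1
    -- Stability of ℝ^(r,s) gives only one off-diagonal block directly. For the other one, isometry
    -- turns the entry of `h`, up to sign, into an entry of the inverse, which also preserves
    -- ℝ^(r,s).
    · have hx : x ∈ firstBlock r s := by tauto
      have h1 := SLpq.inv_mulVec_mem H (single_mem_coordSubspace hx) y hy
      have h2 := h.2 (Pi.single y 1) ((h.1⁻¹ : SLpq a b).1 *ᵥ Pi.single x 1)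
      rw [SLpq.mulVec_inv_mulVec, stdForm_single, stdForm_symm, stdForm_single, h1, mul_zero] at h2
      rcases x with x | x <;> simpa using h2

open Classical in
/-- The diagonal matrix with entries `1` on the first block and `-1` elsewhere. -/
def blockSign (a b r s : ℕ) : Matrix (Fin a ⊕ Fin b) (Fin a ⊕ Fin b) ℝ :=
  Matrix.diagonal fun x => if x ∈ firstBlock r s then (1 : ℝ) else -1

theorem blockSign_mul_self : blockSign a b r s * blockSign a b r s = 1 := by
  classical
  rw [blockSign, Matrix.diagonal_mul_diagonal, ← Matrix.diagonal_one]
  congr 1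
  ext x
  split_ifs <;> simp

theorem stdForm_blockSign (x y : Rpq a b) :
    stdForm a b (blockSign a b r s *ᵥ x) (blockSign a b r s *ᵥ y) = stdForm a b x y := by
  classical
  have h : ∀ l, (blockSign a b r s *ᵥ x) l * (blockSign a b r s *ᵥ y) l = x l * y l := fun l => by
    simp only [blockSign, Matrix.mulVec_diagonal]
    split_ifs <;> ring
  simp only [stdForm_apply, h]

/-- The involution of `SO(a,b)` whose fixed points are the block diagonal matrices. -/
def blockInvolution (a b r s : ℕ) : SOpq a b ≃* SOpq a b where
  toFun h := ⟨⟨blockSign a b r s * h.1.1 * blockSign a b r s, by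
    have h1 := congrArg Matrix.det (blockSign_mul_self (a := a) (b := b) (r := r) (s := s))
    rw [Matrix.det_mul, Matrix.det_one] at h1
    rw [Matrix.det_mul, Matrix.det_mul, h.1.2, mul_one, h1]⟩, fun x y => by
      simp only [← Matrix.mulVec_mulVec, stdForm_blockSign]
      exact (h.2 _ _).trans (stdForm_blockSign x y)⟩
  invFun h := ⟨⟨blockSign a b r s * h.1.1 * blockSign a b r s, by
    have h1 := congrArg Matrix.det (blockSign_mul_self (a := a) (b := b) (r := r) (s := s))
    rw [Matrix.det_mul, Matrix.det_one] at h1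
    rw [Matrix.det_mul, Matrix.det_mul, h.1.2, mul_one, h1]⟩, fun x y => by
      simp only [← Matrix.mulVec_mulVec, stdForm_blockSign]
      exact (h.2 _ _).trans (stdForm_blockSign x y)⟩
  left_inv h := by
    refine Subtype.ext (Subtype.ext ?_)
    change blockSign a b r s * (blockSign a b r s * h.1.1 * blockSign a b r s) * blockSign a b r s
      = h.1.1
    simp only [mul_assoc, blockSign_mul_self, mul_one]
    rw [← mul_assoc, blockSign_mul_self, one_mul]
  right_inv h := by
    refine Subtype.ext (Subtype.ext ?_)
    change blockSign a b r s * (blockSign a b r s * h.1.1 * blockSign a b r s) * blockSign a b r s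
      = h.1.1
    simp only [mul_assoc, blockSign_mul_self, mul_one]
    rw [← mul_assoc, blockSign_mul_self, one_mul]
  map_mul' h h' := by
    refine Subtype.ext (Subtype.ext ?_)
    change blockSign a b r s * (h.1.1 * h'.1.1) * blockSign a b r s =
      (blockSign a b r s * h.1.1 * blockSign a b r s) *
        (blockSign a b r s * h'.1.1 * blockSign a b r s)
    have : blockSign a b r s * (blockSign a b r s * (h'.1.1 * blockSign a b r s)) =
        h'.1.1 * blockSign a b r s := by rw [← mul_assoc, blockSign_mul_self, one_mul]
    simp only [mul_assoc, this]

/-- A matrix is fixed by conjugation with `blockSign` if and only if it commutes with it, which is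
block diagonality by `blockDiagonal_iff_commute`. -/
theorem exists_blockInvolution (a b r s : ℕ) : ∃ σ : SOpq a b ≃* SOpq a b,
    Continuous σ ∧ (∀ h, σ (σ h) = h) ∧ ∀ h, σ h = h ↔ h ∈ SOO a b r s := by
  classical
  refine ⟨blockInvolution a b r s, ?_, (blockInvolution a b r s).left_inv, fun h => ?_⟩
  · refine Continuous.subtype_mk (Continuous.subtype_mk ?_ _) _
    have h1 : Continuous fun h : SOpq a b => h.1.1 :=
      continuous_subtype_val.comp continuous_subtype_val
    exact (continuous_const.matrix_mul h1).matrix_mul continuous_const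
  · have h1 : h ∈ SOO a b r s ↔ Commute h.1.1 (blockSign a b r s) := by
      convert! blockDiagonal_iff_commute (firstBlock r s) h.1.1
    rw [h1]
    constructor
    · intro e
      have e' : blockSign a b r s * h.1.1 * blockSign a b r s = h.1.1 :=
        congrArg (fun z => z.1.1) e
      have e2 := congrArg (blockSign a b r s * ·) e'
      simp only [← mul_assoc, blockSign_mul_self, one_mul] at e2
      exact e2
    · intro e
      refine Subtype.ext (Subtype.ext ?_)
      change blockSign a b r s * h.1.1 * blockSign a b r s = h.1.1
      rw [mul_assoc, e.eq, ← mul_assoc, blockSign_mul_self, one_mul]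

end BlockDiagonal

/-! ### Matrix groups acting through a frame -/

section FrameStabilizer

variable {p q r s ν a b : ℕ} (τ : Rpq p q ≃ₗ[ℝ] WittSpace ν a b)

/-- The action of a group of matrices on the standard space. -/
def frameHom (K : Subgroup (SLpq p q))
    (h1 : ∀ k ∈ K, ∀ x y, wittBilin ν a b (τ (k.1 *ᵥ x)) (τ (k.1 *ᵥ y)) =
      wittBilin ν a b (τ x) (τ y))
    (h2 : ∀ k ∈ K, ∀ v, (τ (k.1 *ᵥ v)).2 = 0 ↔ (τ v).2 = 0) : K →* wittStab ν a b :=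
  MonoidHom.mk' (fun k => ⟨τ.symm.trans ((Matrix.SpecialLinearGroup.toLin' k.1).trans τ),
    fun m m' => by
      have := h1 k.1 k.2 (τ.symm m) (τ.symm m')
      rw [LinearEquiv.apply_symm_apply, LinearEquiv.apply_symm_apply] at this
      exact this, by
      have e : (τ.symm.trans ((Matrix.SpecialLinearGroup.toLin' k.1).trans τ)).toLinearMap =
        τ.toLinearMap ∘ₗ (Matrix.toLin' k.1.1) ∘ₗ τ.symm.toLinearMap := rfl
      rw [e, LinearMap.det_conj, LinearMap.det_toLin', k.1.2], fun m => by
      have := h2 k.1 k.2 (τ.symm m)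
      rw [LinearEquiv.apply_symm_apply] at this
      exact this⟩) fun k l => by
    refine Subtype.ext (LinearEquiv.ext fun m => ?_)
    change τ ((k.1 * l.1).1 *ᵥ τ.symm m) = τ (k.1.1 *ᵥ τ.symm (τ (l.1.1 *ᵥ τ.symm m)))
    rw [LinearEquiv.symm_apply_apply, SLpq.mul_mulVec]

variable {τ}

theorem frameHom_apply {K : Subgroup (SLpq p q)}
    {h1 : ∀ k ∈ K, ∀ x y, wittBilin ν a b (τ (k.1 *ᵥ x)) (τ (k.1 *ᵥ y)) =
      wittBilin ν a b (τ x) (τ y)}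
    {h2 : ∀ k ∈ K, ∀ v, (τ (k.1 *ᵥ v)).2 = 0 ↔ (τ v).2 = 0} (k : K) (v : Rpq p q) :
    (frameHom τ K h1 h2 k).1 (τ v) = τ (k.1.1 *ᵥ v) := by
  change τ (k.1.1 *ᵥ τ.symm (τ v)) = _
  rw [LinearEquiv.symm_apply_apply]

theorem exists_mulVec_eq_of_wittStab (τ : Rpq p q ≃ₗ[ℝ] WittSpace ν a b) (T : wittStab ν a b) :
    ∃ k : SLpq p q, ∀ v, τ (k.1 *ᵥ v) = T.1 (τ v) := by
  have h : LinearMap.det (τ.symm.toLinearMap ∘ₗ T.1.toLinearMap ∘ₗ τ.symm.symm.toLinearMap) = 1 := by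
    rw [LinearMap.det_conj, T.2.2.1]
  refine ⟨SLpq.ofLinear _ h, fun v => ?_⟩
  rw [SLpq.ofLinear_mulVec]
  simp

end FrameStabilizer

/-! ### Fibers of the radical map as homogeneous spaces -/

section Fibers

variable {p q r s ν a b i : ℕ} {τ : Rpq p q ≃ₗ[ℝ] WittSpace ν a b}

/-- The frame in which the action of `h` on `ℝ^(a,b)` has been undone. -/
def twistFrame (τ : Rpq p q ≃ₗ[ℝ] WittSpace ν a b) (h : SOpq a b) :
    Rpq p q ≃ₗ[ℝ] WittSpace ν a b :=
  τ.trans ((LinearEquiv.refl ℝ (Fin ν → ℝ)).prodCongr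
    ((Matrix.SpecialLinearGroup.toLin' (h⁻¹).1).prodCongr
      (LinearEquiv.refl ℝ ((Fin ν → ℝ) →L[ℝ] ℝ))))

theorem twistFrame_apply (h : SOpq a b) (v : Rpq p q) :
    twistFrame τ h v = ((τ v).1, (h⁻¹).1.1 *ᵥ (τ v).2.1, (τ v).2.2) := rfl

theorem twistFrame_snd (h : SOpq a b) (v : Rpq p q) :
    (twistFrame τ h v).2 = 0 ↔ (τ v).2 = 0 :=
  ((Matrix.SpecialLinearGroup.toLin' (h⁻¹).1).prodCongr
      (LinearEquiv.refl ℝ ((Fin ν → ℝ) →L[ℝ] ℝ))).map_eq_zero_iff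

theorem IsWittFrame.twistFrame (hτ : IsWittFrame τ) (h : SOpq a b) :
    IsWittFrame (twistFrame τ h) := fun v w => by
  rw [hτ, twistFrame_apply, twistFrame_apply, wittBilin_apply, wittBilin_apply]
  simp only
  rw [(h⁻¹).2]

/-- The subspace which in the given frame is `ℝ^ν × h ℝ^(r,s)`. -/
def fiberGr (hτ : IsWittFrame τ) (hr : r ≤ a) (hs : s ≤ b) (hi : i = r + s + ν)
    (h : SOpq a b) : Gr i (Rpq p q) :=
  ⟨standardSubspace (twistFrame τ h) r s, ((hτ.twistFrame h).standardSubspace hr hs).2.trans hi.symm⟩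

variable {hτ : IsWittFrame τ} {hr : r ≤ a} {hs : s ≤ b} {hi : i = r + s + ν}

theorem mem_fiberGr {h : SOpq a b} {v : Rpq p q} : v ∈ (fiberGr hτ hr hs hi h).1 ↔
    (h⁻¹).1.1 *ᵥ (τ v).2.1 ∈ coordSubspace a b r s ∧ (τ v).2.2 = 0 :=
  mem_standardSubspace _ _

theorem fiberGr_mem_grOrbit (h : SOpq a b) : fiberGr hτ hr hs hi h ∈ grOrbit p q i r s :=
  ((hτ.twistFrame h).standardSubspace hr hs).1

theorem mem_radical_fiberGr (h : SOpq a b) (v : Rpq p q) : v ∈ (fiberGr hτ hr hs hi h).1 ⊓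
    (stdForm p q).orthogonal (fiberGr hτ hr hs hi h).1 ↔ (τ v).2 = 0 := by
  rw [← twistFrame_snd h]
  exact radical_standardSubspace (hτ.twistFrame h) v

/-- The subspaces agree exactly when `h` and `h'` send ℝ^(r,s) to the same subspace, and `SOO` is
its stabilizer by `mem_SOO_iff`. -/
theorem fiberGr_eq_iff (h h' : SOpq a b) :
    fiberGr hτ hr hs hi h = fiberGr hτ hr hs hi h' ↔ h⁻¹ * h' ∈ SOO a b r s := by
  have key : ∀ h h' : SOpq a b, h⁻¹ * h' ∈ SOO a b r s → ∀ v, v ∈ (fiberGr hτ hr hs hi h').1 →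
      v ∈ (fiberGr hτ hr hs hi h).1 := by
    intro h h' H v hv
    rw [mem_fiberGr] at hv ⊢
    refine ⟨?_, hv.2⟩
    have h1 := mem_SOO_iff.1 H _ hv.1
    rwa [← SLpq.mul_mulVec, ← Subgroup.coe_mul, mul_assoc, mul_inv_cancel, mul_one] at h1
  constructor
  · intro e
    rw [mem_SOO_iff]
    intro z hz
    have h1 : τ.symm (0, h'.1.1 *ᵥ z, 0) ∈ (fiberGr hτ hr hs hi h').1 := by
      rw [mem_fiberGr, LinearEquiv.apply_symm_apply]
      refine ⟨?_, rfl⟩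
      change (h'⁻¹).1.1 *ᵥ (h'.1.1 *ᵥ z) ∈ _
      rwa [← SLpq.mul_mulVec, ← Subgroup.coe_mul, inv_mul_cancel, Subgroup.coe_one,
        Matrix.SpecialLinearGroup.coe_one, Matrix.one_mulVec]
    rw [← e, mem_fiberGr, LinearEquiv.apply_symm_apply] at h1
    rw [Subgroup.coe_mul, SLpq.mul_mulVec]
    exact h1.1
  · intro H
    have H' : h'⁻¹ * h ∈ SOO a b r s := by
      have := inv_mem H
      rwa [mul_inv_rev, inv_inv] at this
    exact Gr.ext (le_antisymm (key h' h H') (key h h' H))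

/-- The stabilizer of an isotropic subspace acts through isometries of the standard space. -/
def isotropicHom (τ : Rpq p q ≃ₗ[ℝ] WittSpace ν a b) (hτ : IsWittFrame τ) (N : Gr ν (Rpq p q))
    (hN : ∀ v, v ∈ N.1 ↔ (τ v).2 = 0) :
    ↥(SOpq p q ⊓ MulAction.stabilizer (SLpq p q) N) →* wittStab ν a b :=
  frameHom τ _ (fun k hk x y => by rw [← hτ, ← hτ, hk.1]) fun k hk v => by
    rw [← hN, ← hN]
    have : k • N = N := hk.2
    rw [← Gr.mulVec_mem_smul (g := k) (v := v), this]

theorem isotropicHom_surjective (N : Gr ν (Rpq p q))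
    (hN : ∀ v, v ∈ N.1 ↔ (τ v).2 = 0) : Function.Surjective (isotropicHom τ hτ N hN) := by
  intro T
  obtain ⟨k, hk⟩ := exists_mulVec_eq_of_wittStab τ T
  refine ⟨⟨k, fun x y => by rw [hτ, hτ, hk, hk, T.2.1], ?_⟩, ?_⟩
  · refine Gr.smul_eq_of_forall fun v hv => ?_
    rw [hN, hk, T.2.2.2, ← hN]
    exact hv
  · refine Subtype.ext (LinearEquiv.ext fun m => ?_)
    obtain ⟨v, rfl⟩ := τ.surjective m
    exact (frameHom_apply _ v).trans (hk v)

/-- All members of the fiber lie between `N` and its orthogonal space, and on the quotient of these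
`k` acts by its middle component. -/
theorem smul_fiberGr (N : Gr ν (Rpq p q)) (hN : ∀ v, v ∈ N.1 ↔ (τ v).2 = 0)
    (k : ↥(SOpq p q ⊓ MulAction.stabilizer (SLpq p q) N)) (h : SOpq a b) :
    k.1 • fiberGr hτ hr hs hi h =
      fiberGr hτ hr hs hi (wittMid ν a b (isotropicHom τ hτ N hN k) * h) := by
  refine Gr.smul_eq_of_forall fun v hv => ?_
  rw [mem_fiberGr] at hv ⊢
  have h1 : (isotropicHom τ hτ N hN k).1 (τ v) = τ (k.1.1 *ᵥ v) := frameHom_apply k v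
  rw [← h1, wittStab.apply_perp _ hv.2]
  refine ⟨?_, rfl⟩
  simp only
  rw [← wittMid_mulVec, ← SLpq.mul_mulVec, ← Subgroup.coe_mul, mul_inv_rev, mul_assoc,
    inv_mul_cancel, mul_one]
  exact hv.1

/-- An isometry moving the base member to `W` carries one radical to the other; both are `N`, so it
stabilizes `N` and its middle component is the required element. For `a + b = 0` transitivity may
fail, but then the fiber consists of `N` alone. -/
theorem exists_fiberGr_eq (N : Gr ν (Rpq p q)) (hN : ∀ v, v ∈ N.1 ↔ (τ v).2 = 0)
    {W : Gr i (Rpq p q)} (hW : W ∈ grOrbit p q i r s)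
    (hWN : W.1 ⊓ (stdForm p q).orthogonal W.1 = N.1) : ∃ h, fiberGr hτ hr hs hi h = W := by
  have hNv : ∀ W' : Gr i (Rpq p q), W'.1 ⊓ (stdForm p q).orthogonal W'.1 = N.1 → N.1 ≤ W'.1 :=
    fun W' e => by
      rw [← e]
      exact inf_le_left
  have hN1 : ∀ h, (fiberGr hτ hr hs hi h).1 ⊓
      (stdForm p q).orthogonal (fiberGr hτ hr hs hi h).1 = N.1 := fun h => by
    ext v
    rw [mem_radical_fiberGr, hN]
  rcases Nat.eq_zero_or_pos (a + b) with h0 | h0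
  · have key : ∀ W' : Gr i (Rpq p q), W'.1 ⊓ (stdForm p q).orthogonal W'.1 = N.1 → N.1 = W'.1 :=
      fun W' e => Submodule.eq_of_le_of_finrank_eq (hNv W' e) (by
        rw [N.2, W'.2]
        omega)
    exact ⟨1, Gr.ext ((key _ (hN1 1)).symm.trans (key W hWN))⟩
  · obtain ⟨ha, hb⟩ := hτ.add_eq
    obtain ⟨-, -, h3⟩ := exists_frame_of_hasSig hW (W.2.trans hi)
    obtain ⟨τ', hτ', hτW⟩ := h3 a b ha hb
    rw [inStandardPosition_iff] at hτW
    obtain ⟨k, hk, hk'⟩ := exists_smul_standardSubspace (r := r) (s := s) (hτ.twistFrame 1) hτ' h0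
    have hkW : k • fiberGr hτ hr hs hi 1 = W := Gr.smul_eq_of_forall (by rwa [hτW])
    have hkN : k • N = N := by
      refine Gr.smul_eq_of_forall fun v hv => ?_
      rw [← hN1 1] at hv
      rw [← hWN, ← hkW]
      refine ⟨Gr.mulVec_mem_smul.2 hv.1, ?_⟩
      rintro _ ⟨w, hw, rfl⟩
      exact (hk w v).trans (hv.2 w hw)
    refine ⟨_, (smul_fiberGr N hN ⟨k, hk, hkN⟩ 1).symm.trans hkW⟩

theorem mem_fiber_iff {S X : Type} {M : Set S} {π : M → X} {x : X} {m : S} :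
    m ∈ fiber π x ↔ ∃ h : m ∈ M, π ⟨m, h⟩ = x := by
  constructor
  · rintro ⟨y, hy, rfl⟩
    exact ⟨y.2, hy⟩
  · rintro ⟨h, e⟩
    exact ⟨⟨m, h⟩, e, rfl⟩

variable {π : grOrbit p q i r s → IGr ν p q}

theorem mem_fiber_radical_iff (hπ : ∀ W, (π W).1.1 = W.1.1 ⊓ (stdForm p q).orthogonal W.1.1)
    (N : IGr ν p q) (W : Gr i (Rpq p q)) : W ∈ fiber π N ↔ W ∈ grOrbit p q i r s ∧
      W.1 ⊓ (stdForm p q).orthogonal W.1 = N.1.1 := by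
  rw [mem_fiber_iff]
  constructor
  · rintro ⟨h, rfl⟩
    exact ⟨h, (hπ ⟨W, h⟩).symm⟩
  · rintro ⟨h, e⟩
    exact ⟨h, Subtype.ext (Gr.ext ((hπ ⟨W, h⟩).trans e))⟩

/-- The map from the group to a fiber which induces its identification with a symmetric space. -/
def fiberMap (hπ : ∀ W, (π W).1.1 = W.1.1 ⊓ (stdForm p q).orthogonal W.1.1)
    (hτ : IsWittFrame τ) (hr : r ≤ a) (hs : s ≤ b) (hi : i = r + s + ν) (N : IGr ν p q)
    (hN : ∀ v, v ∈ N.1.1 ↔ (τ v).2 = 0) (h : SOpq a b) : fiber π N :=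
  ⟨fiberGr hτ hr hs hi h, (mem_fiber_radical_iff hπ N _).2 ⟨fiberGr_mem_grOrbit h, by
    ext v
    rw [mem_radical_fiberGr, hN]⟩⟩

/-- The identification of a fiber with a symmetric space. -/
def fiberEquiv (hπ : ∀ W, (π W).1.1 = W.1.1 ⊓ (stdForm p q).orthogonal W.1.1)
    (hτ : IsWittFrame τ) (hr : r ≤ a) (hs : s ≤ b) (hi : i = r + s + ν) (N : IGr ν p q)
    (hN : ∀ v, v ∈ N.1.1 ↔ (τ v).2 = 0) : (SOpq a b ⧸ SOO a b r s) ≃ fiber π N :=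
  Equiv.ofBijective (fun x : SOpq a b ⧸ SOO a b r s =>
      Quotient.liftOn' x (fiberMap hπ hτ hr hs hi N hN) fun h h' e =>
        Subtype.ext ((fiberGr_eq_iff (hτ := hτ) (hr := hr) (hs := hs) (hi := hi) h h').2
          (QuotientGroup.leftRel_apply.1 e))) ⟨by
    rintro ⟨h⟩ ⟨h'⟩ e
    exact QuotientGroup.eq.2
      ((fiberGr_eq_iff (hτ := hτ) (hr := hr) (hs := hs) (hi := hi) h h').1
        (congrArg Subtype.val e)), by
    rintro ⟨W, hW⟩
    obtain ⟨h1, h2⟩ := (mem_fiber_radical_iff hπ N W).1 hW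
    obtain ⟨h, e⟩ := exists_fiberGr_eq (hτ := hτ) (hr := hr) (hs := hs) (hi := hi) N.1 hN h1 h2
    exact ⟨(QuotientGroup.mk h : SOpq a b ⧸ SOO a b r s),
      Subtype.ext (a1 := fiberMap hπ hτ hr hs hi N hN h) e⟩⟩

/-- The homomorphism takes the middle component. It is onto because each isometry of the middle
factor extends by the identity on the hyperbolic part. -/
theorem exists_fiber_hom (hπ : ∀ W, (π W).1.1 = W.1.1 ⊓ (stdForm p q).orthogonal W.1.1)
    (N : IGr ν p q) (hN : ∀ v, v ∈ N.1.1 ↔ (τ v).2 = 0) :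
    ∃ ρ : ↥(SOpq p q ⊓ MulAction.stabilizer (SLpq p q) N.1) →* SOpq a b,
      Function.Surjective ρ ∧ ∀ k x, (fiberEquiv hπ hτ hr hs hi N hN (ρ k • x)).1 =
        k.1 • (fiberEquiv hπ hτ hr hs hi N hN x).1 := by
  refine ⟨(wittMid ν a b).comp (isotropicHom τ hτ N.1 hN), ?_, ?_⟩
  · refine Function.Surjective.comp (g := wittMid ν a b) (fun L => ?_)
      (isotropicHom_surjective (hτ := hτ) N.1 hN)
    obtain ⟨T, -, hT, -⟩ := exists_wittStab 1 L
    exact ⟨T, hT⟩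
  · rintro k ⟨h⟩
    exact (smul_fiberGr (hr := hr) (hs := hs) (hi := hi) N.1 hN k h).symm

end Fibers

end

noncomputable section

/-! ### The isotropy group and its natural homomorphism -/

section Isotropy

variable {p q r s ν a b i : ℕ} {τ : Rpq p q ≃ₗ[ℝ] WittSpace ν a b} {o : Gr i (Rpq p q)}
  {g : SLpq p q}

/-- The frame `τ` is isometric for the form of `g` and puts `o` in standard position. -/
structure IsAdaptedFrame (τ : Rpq p q ≃ₗ[ℝ] WittSpace ν a b) (o : Gr i (Rpq p q)) (g : SLpq p q)
    (r s : ℕ) : Prop where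
  isometric : ∀ v w, conjForm g v w = wittBilin ν a b (τ v) (τ w)
  mem_iff : ∀ v, v ∈ o.1 ↔ (τ v).2.1 ∈ coordSubspace a b r s ∧ (τ v).2.2 = 0

/-- A frame adapted to `g • o` becomes one adapted to `o` and the form of `g` when precomposed with
`g`. -/
theorem exists_isAdaptedFrame (hi : i = r + s + ν) (ho : g • o ∈ grOrbit p q i r s)
    (ha : a + ν = p) (hb : b + ν = q) :
    ∃ τ : Rpq p q ≃ₗ[ℝ] WittSpace ν a b, IsAdaptedFrame τ o g r s := by
  obtain ⟨-, -, h⟩ := exists_frame_of_hasSig ho ((g • o).2.trans hi)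
  obtain ⟨τ, hτ, hτW⟩ := h a b ha hb
  refine ⟨(Matrix.SpecialLinearGroup.toLin' g).trans τ, fun v w => ?_, fun v => ?_⟩
  · rw [conjForm_apply]
    exact hτ _ _
  · rw [← Gr.mulVec_mem_smul (g := g)]
    exact hτW _

theorem IsAdaptedFrame.mem_radical_iff (h : IsAdaptedFrame τ o g r s) (v : Rpq p q) :
    v ∈ o.1 ⊓ (conjForm g).orthogonal o.1 ↔ (τ v).2 = 0 := by
  let τ' := (Matrix.SpecialLinearGroup.toLin' g).symm.trans τ
  have hτ' : IsWittFrame τ' := fun v w => by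
    have h1 := h.isometric ((Matrix.SpecialLinearGroup.toLin' g).symm v)
      ((Matrix.SpecialLinearGroup.toLin' g).symm w)
    rw [conjForm_apply] at h1
    have e : ∀ v, g.1 *ᵥ ((Matrix.SpecialLinearGroup.toLin' g).symm v) = v := fun v =>
      (Matrix.SpecialLinearGroup.toLin' g).apply_symm_apply v
    rw [e, e] at h1
    exact h1
  have hv : τ' (g.1 *ᵥ v) = τ v := by
    change τ ((Matrix.SpecialLinearGroup.toLin' g).symm (Matrix.SpecialLinearGroup.toLin' g v)) = _
    rw [LinearEquiv.symm_apply_apply]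
  have h0 : standardSubspace τ' r s = (g • o).1 := by
    ext w
    obtain ⟨w, rfl⟩ := (Matrix.SpecialLinearGroup.toLin' g).surjective w
    rw [mem_standardSubspace]
    change _ ↔ g.1 *ᵥ w ∈ _
    rw [Gr.mulVec_mem_smul, h.mem_iff]
    change (τ ((Matrix.SpecialLinearGroup.toLin' g).symm _)).2.1 ∈ _ ∧
      (τ ((Matrix.SpecialLinearGroup.toLin' g).symm _)).2.2 = 0 ↔ _
    rw [LinearEquiv.symm_apply_apply]
  have h1 := radical_standardSubspace (r := r) (s := s) hτ' (g.1 *ᵥ v)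
  rw [hv, h0] at h1
  rw [← h1]
  refine and_congr Gr.mulVec_mem_smul.symm ⟨?_, ?_⟩
  · rintro H _ ⟨w, hw, rfl⟩
    have := H w hw
    rwa [conjForm_apply] at this
  · intro H w hw
    rw [conjForm_apply]
    exact H _ (Gr.mulVec_mem_smul.2 hw)

theorem isotropy_map_mem_iff (k : isotropy o g) {v : Rpq p q} :
    k.1.1 *ᵥ v ∈ o.1 ↔ v ∈ o.1 := by
  have h : k.1 • o = o := k.2.2
  rw [← Gr.mulVec_mem_smul (g := k.1) (v := v), h]

theorem isotropy_map_mem_radical_iff (k : isotropy o g) {v : Rpq p q} :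
    k.1.1 *ᵥ v ∈ o.1 ⊓ (conjForm g).orthogonal o.1 ↔ v ∈ o.1 ⊓ (conjForm g).orthogonal o.1 := by
  refine and_congr (isotropy_map_mem_iff k) ⟨fun H w hw => ?_, fun H w hw => ?_⟩
  · exact (conjForm_isotropy k w v).symm.trans (H _ ((isotropy_map_mem_iff k).2 hw))
  · have h1 := H _ ((isotropy_map_mem_iff k⁻¹).2 hw)
    have h2 := conjForm_isotropy k ((k⁻¹).1.1 *ᵥ w) v
    rw [isotropy_mul_inv_mulVec] at h2
    exact h2.trans h1

/-- The action of the isotropy group on the standard space. -/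
def isotropyHom (h : IsAdaptedFrame τ o g r s) : isotropy o g →* wittStab ν a b :=
  frameHom τ _ (fun k hk x y => by
    rw [← h.isometric, ← h.isometric]
    exact conjForm_isotropy ⟨k, hk⟩ x y) fun k hk v => by
    rw [← h.mem_radical_iff, ← h.mem_radical_iff]
    exact isotropy_map_mem_radical_iff ⟨k, hk⟩

theorem isotropyHom_apply (h : IsAdaptedFrame τ o g r s) (k : isotropy o g) (v : Rpq p q) :
    (isotropyHom h k).1 (τ v) = τ (k.1.1 *ᵥ v) :=
  frameHom_apply k v

theorem wittMid_isotropyHom_mem (h : IsAdaptedFrame τ o g r s) (k : isotropy o g) :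
    wittMid ν a b (isotropyHom h k) ∈ SOO a b r s := by
  rw [mem_SOO_iff]
  intro z hz
  have h1 : τ.symm (0, z, 0) ∈ o.1 := by
    rw [h.mem_iff, LinearEquiv.apply_symm_apply]
    exact ⟨hz, rfl⟩
  have h2 := (isotropy_map_mem_iff k).2 h1
  rw [h.mem_iff, ← isotropyHom_apply h, LinearEquiv.apply_symm_apply,
    wittStab.apply_perp _ rfl] at h2
  rw [wittMid_mulVec]
  exact h2.1

/-- The natural homomorphism from the isotropy group. -/
def naturalHom (h : IsAdaptedFrame τ o g r s) : isotropy o g →* GL (Fin ν) ℝ × SOO a b r s :=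
  ((wittRad ν a b).comp (isotropyHom h)).prod
    (((wittMid ν a b).comp (isotropyHom h)).codRestrict _ (wittMid_isotropyHom_mem h))

theorem naturalHom_fst_mulVec (h : IsAdaptedFrame τ o g r s) (k : isotropy o g) (x : Fin ν → ℝ) :
    (naturalHom h k).1.1 *ᵥ x = (τ (k.1.1 *ᵥ τ.symm (x, 0))).1 := by
  rw [← isotropyHom_apply h, LinearEquiv.apply_symm_apply]
  exact wittRad_mulVec _ x

theorem naturalHom_snd_mulVec (h : IsAdaptedFrame τ o g r s) (k : isotropy o g) {v : Rpq p q}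
    (hv : (τ v).2.2 = 0) : (naturalHom h k).2.1.1.1 *ᵥ (τ v).2.1 = (τ (k.1.1 *ᵥ v)).2.1 := by
  rw [← isotropyHom_apply h]
  exact wittMid_mulVec_apply _ hv

theorem apply_isotropy_rad (h : IsAdaptedFrame τ o g r s) (k : isotropy o g) (x : Fin ν → ℝ) :
    τ (k.1.1 *ᵥ τ.symm (x, 0)) = ((naturalHom h k).1.1 *ᵥ x, 0) := by
  rw [naturalHom_fst_mulVec h]
  refine Prod.ext rfl ?_
  rw [← isotropyHom_apply h, LinearEquiv.apply_symm_apply, wittStab.apply_rad]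

/-- The block diagonal isometry built from `A`, `L` and the contragredient of `A` preserves `o`,
since `L` preserves ℝ^(r,s). -/
theorem naturalHom_surjective (h : IsAdaptedFrame τ o g r s) :
    Function.Surjective (naturalHom h) := by
  rintro ⟨A, L⟩
  obtain ⟨T, hA, hL, hT⟩ := exists_wittStab A L.1
  obtain ⟨k, hk⟩ := exists_mulVec_eq_of_wittStab τ T
  have hk1 : k ∈ isotropy o g := by
    constructor
    · change MulAut.conj g k ∈ SOpq p q
      intro x y
      have e : ∀ z, (MulAut.conj g k).1 *ᵥ z = g.1 *ᵥ (k.1 *ᵥ ((g⁻¹ : SLpq p q).1 *ᵥ z)) := by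
        intro z
        rw [MulAut.conj_apply, SLpq.mul_mulVec, SLpq.mul_mulVec]
      rw [e, e, ← conjForm_apply, h.isometric, hk, hk, T.2.1, ← h.isometric, conjForm_apply,
        SLpq.mulVec_inv_mulVec, SLpq.mulVec_inv_mulVec]
    · refine Gr.smul_eq_of_forall fun v hv => ?_
      rw [h.mem_iff] at hv ⊢
      rw [hk, hT, hv.2, map_zero]
      exact ⟨mem_SOO_iff.1 L.2 _ hv.1, rfl⟩
  have hT' : isotropyHom h ⟨k, hk1⟩ = T := by
    refine Subtype.ext (LinearEquiv.ext fun m => ?_)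
    obtain ⟨v, rfl⟩ := τ.surjective m
    exact (isotropyHom_apply h ⟨k, hk1⟩ v).trans (hk v)
  refine ⟨⟨k, hk1⟩, Prod.ext ?_ (Subtype.ext ?_)⟩
  · change wittRad ν a b (isotropyHom h ⟨k, hk1⟩) = A
    rw [hT', hA]
  · change wittMid ν a b (isotropyHom h ⟨k, hk1⟩) = L.1
    rw [hT', hL]

theorem continuous_matrix_of_mulVec {X m n : Type*} [TopologicalSpace X] [Fintype m] [Fintype n]
    [DecidableEq n] {M : X → Matrix m n ℝ} (h : ∀ v, Continuous fun x => M x *ᵥ v) :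
    Continuous M := by
  refine continuous_matrix fun i j => ?_
  have h1 := (continuous_apply i).comp (h (Pi.single j 1))
  convert! h1 using 2 with x
  simp

theorem continuous_naturalHom (h : IsAdaptedFrame τ o g r s) : Continuous (naturalHom h) := by
  have hk : ∀ v : Rpq p q, Continuous fun k : isotropy o g => τ (k.1.1 *ᵥ v) := fun v => by
    have h1 : Continuous fun k : isotropy o g => k.1.1 :=
      continuous_subtype_val.comp continuous_subtype_val
    exact (LinearMap.continuous_of_finiteDimensional τ.toLinearMap).comp
      (h1.matrix_mulVec continuous_const)
  have hA : Continuous fun k : isotropy o g => (naturalHom h k).1.1 :=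
    continuous_matrix_of_mulVec fun v => by
      simp only [naturalHom_fst_mulVec]
      exact (hk _).fst
  refine Continuous.prodMk ?_ ?_
  -- The topology of the unit group also requires continuity of the inverse matrix, which is
  -- obtained from continuity of `k ↦ k⁻¹`.
  · rw [Units.continuous_iff]
    refine ⟨hA, ?_⟩
    have h2 : Continuous fun k : isotropy o g => (naturalHom h k⁻¹).1.1 := hA.comp continuous_inv
    have h3 : ∀ k : isotropy o g, (naturalHom h k⁻¹).1.1 = ((naturalHom h k).1⁻¹).1 := fun k => by
      rw [map_inv]
      rfl
    simp only [h3] at h2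
    exact h2
  · refine continuous_induced_rng.2 (continuous_induced_rng.2 (continuous_induced_rng.2 ?_))
    refine continuous_matrix_of_mulVec fun v => ?_
    have h2 : ∀ k, (naturalHom h k).2.1.1.1 *ᵥ v = (τ (k.1.1 *ᵥ τ.symm (0, v, 0))).2.1 := fun k => by
      have := naturalHom_snd_mulVec h k (v := τ.symm (0, v, 0)) (by simp)
      rwa [LinearEquiv.apply_symm_apply] at this
    change Continuous fun k => (naturalHom h k).2.1.1.1 *ᵥ v
    simp only [h2]
    exact (hk _).snd.fst

theorem IsAdaptedFrame.mem_orthogonal_radical_iff (h : IsAdaptedFrame τ o g r s) (v : Rpq p q) :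
    v ∈ (conjForm g).orthogonal (o.1 ⊓ (conjForm g).orthogonal o.1) ↔ (τ v).2.2 = 0 := by
  constructor
  · intro H
    ext x
    have h1 : τ.symm (x, 0) ∈ o.1 ⊓ (conjForm g).orthogonal o.1 := by
      rw [h.mem_radical_iff, LinearEquiv.apply_symm_apply]
    have h2 : conjForm g (τ.symm (x, 0)) v = 0 := H _ h1
    rw [h.isometric, LinearEquiv.apply_symm_apply, wittBilin_apply] at h2
    simpa using h2
  · intro hv w hw
    rw [h.mem_radical_iff] at hw
    change conjForm g w v = 0
    rw [h.isometric, wittBilin_apply, hw, hv]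
    simp

end Isotropy

/-! ### Naturality of the homomorphism -/

section IsotropyNatural

variable {p q r s ν i : ℕ} {τ : Rpq p q ≃ₗ[ℝ] WittSpace ν (p - ν) (q - ν)} {o : Gr i (Rpq p q)}
  {g : SLpq p q}

/-- The first coordinate of the frame identifies the radical with ℝ^ν. The middle coordinate,
restricted to the orthogonal space of the radical, is the quotient map required as `γ`. -/
theorem isNaturalHom_naturalHom (h : IsAdaptedFrame τ o g r s) :
    IsNaturalHom o g (naturalHom h) := by
  refine ⟨_, rfl, ?_⟩
  let α : (Fin ν → ℝ) ≃ₗ[ℝ] ↥(o.1 ⊓ (conjForm g).orthogonal o.1) :=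
    LinearEquiv.ofBijective ((τ.symm.toLinearMap ∘ₗ LinearMap.inl ℝ _ _).codRestrict _ fun x => by
      rw [h.mem_radical_iff]
      simp) ⟨fun x y e => by
        have e' : τ.symm (x, 0) = τ.symm (y, 0) := congrArg Subtype.val e
        exact congrArg Prod.fst (τ.symm.injective e'), fun v => ⟨(τ v.1).1, by
          ext1
          have hv := (h.mem_radical_iff v.1).1 v.2
          change τ.symm ((τ v.1).1, 0) = v.1
          rw [LinearEquiv.symm_apply_eq]
          exact Prod.ext rfl hv.symm⟩⟩
  have hα : ∀ x, (α x).1 = τ.symm (x, 0) := fun x => rfl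
  let γ : (conjForm g).orthogonal (o.1 ⊓ (conjForm g).orthogonal o.1) →ₗ[ℝ]
      Rpq (p - ν) (q - ν) :=
    LinearMap.fst ℝ _ _ ∘ₗ LinearMap.snd ℝ _ _ ∘ₗ τ.toLinearMap ∘ₗ Submodule.subtype _
  have hγ : ∀ x, γ x = (τ x.1).2.1 := fun x => rfl
  have hz : ∀ x : (conjForm g).orthogonal (o.1 ⊓ (conjForm g).orthogonal o.1), (τ x.1).2.2 = 0 :=
    fun x => (h.mem_orthogonal_radical_iff x.1).1 x.2
  refine ⟨α, γ, fun u => ?_, fun x => ?_, fun x y => ?_, fun x => ?_, fun k v => ?_,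
    fun k x y hxy => ?_⟩
  · refine ⟨⟨τ.symm (0, u, 0), ?_⟩, ?_⟩
    · rw [h.mem_orthogonal_radical_iff, LinearEquiv.apply_symm_apply]
    · rw [hγ, LinearEquiv.apply_symm_apply]
  · rw [h.mem_radical_iff, hγ]
    exact ⟨fun e => Prod.ext e (hz x), fun e => congrArg Prod.fst e⟩
  · rw [h.isometric, wittBilin_apply, hz, hz, hγ, hγ]
    simp
  · rw [h.mem_iff, hγ]
    exact ⟨fun e => ⟨e, hz x⟩, fun e => e.1⟩
  · rw [hα, hα, LinearEquiv.symm_apply_eq, apply_isotropy_rad h]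
  · rw [hγ, hγ, naturalHom_snd_mulVec h k (hz x), hxy]

end IsotropyNatural

end

noncomputable section

/-! ### The infinitesimal transversal -/

section Transversal

variable {p q r s ν a b i : ℕ} {τ : Rpq p q ≃ₗ[ℝ] WittSpace ν a b} {o : Gr i (Rpq p q)}
  {g : SLpq p q}

/-- A matrix which is skew with respect to a nondegenerate symmetric form has trace zero. -/
theorem trace_eq_zero_of_skew {n : Type*} [Fintype n] [DecidableEq n]
    {B : LinearMap.BilinForm ℝ (n → ℝ)}
    (hB : B.Nondegenerate) {X : Matrix n n ℝ} (hX : ∀ x y, B (X *ᵥ x) y + B x (X *ᵥ y) = 0) :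
    X.trace = 0 := by
  set M := LinearMap.BilinForm.toMatrix' B with hM
  have hdet : IsUnit M.det := by
    rw [isUnit_iff_ne_zero]
    exact (LinearMap.BilinForm.nondegenerate_toMatrix'_iff.2 hB).det_ne_zero
  have h1 : Xᵀ * M = -(M * X) := by
    have h2 : B.comp (Matrix.toLin' X) LinearMap.id = B.comp LinearMap.id (Matrix.toLin' (-X)) := by
      refine LinearMap.ext fun x => LinearMap.ext fun y => ?_
      have := hX x y
      simp only [LinearMap.BilinForm.comp_apply, Matrix.toLin'_apply, LinearMap.id_apply, map_neg,
        LinearMap.neg_apply]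
      linarith
    have h3 := congrArg LinearMap.BilinForm.toMatrix' h2
    rw [LinearMap.BilinForm.toMatrix'_comp, LinearMap.BilinForm.toMatrix'_comp] at h3
    simpa using h3
  have h2 : Xᵀ = -(M * X * M⁻¹) := by
    rw [← neg_mul, ← h1, mul_assoc, Matrix.mul_nonsing_inv _ hdet, mul_one]
  have h3 := congrArg Matrix.trace h2
  rw [Matrix.trace_transpose, Matrix.trace_neg, Matrix.trace_mul_comm, ← mul_assoc,
    Matrix.nonsing_inv_mul _ hdet, one_mul] at h3
  linarith

theorem IsAdaptedFrame.nondegenerate (h : IsAdaptedFrame τ o g r s) :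
    (conjForm g).Nondegenerate := by
  have h0 : ∀ v, (∀ w, conjForm g w v = 0) → v = 0 := fun v hv => by
    rw [← τ.map_eq_zero_iff]
    refine wittBilin_nondegenerate fun m => ?_
    obtain ⟨w, rfl⟩ := τ.surjective m
    rw [← h.isometric, hv]
  refine ⟨fun v hv => h0 v fun w => ?_, h0⟩
  rw [h.isometric, wittBilin_symm, ← h.isometric, hv]

theorem conjForm_symm (g : SLpq p q) (x y : Rpq p q) : conjForm g x y = conjForm g y x := by
  rw [conjForm_apply, conjForm_apply, stdForm_symm]

/-- The symmetric form on the radical induced by a matrix. -/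
def transversalForm (τ : Rpq p q ≃ₗ[ℝ] WittSpace ν a b) (g : SLpq p q) :
    slpq p q →ₗ[ℝ] symForms ν where
  toFun X := ⟨LinearMap.mk₂ ℝ (fun x y : Fin ν → ℝ =>
      conjForm g (X.1 *ᵥ τ.symm (x, 0)) (τ.symm (y, 0)) +
        conjForm g (τ.symm (x, 0)) (X.1 *ᵥ τ.symm (y, 0)))
      (fun x x' y => by
        have e : τ.symm (x + x', 0) = τ.symm (x, 0) + τ.symm (x', 0) := by
          rw [← map_add, Prod.mk_add_mk, add_zero]
        rw [e, Matrix.mulVec_add]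
        simp only [map_add, LinearMap.add_apply]
        ring)
      (fun c x y => by
        have e : τ.symm (c • x, 0) = c • τ.symm (x, 0) := by
          rw [← map_smul, Prod.smul_mk, smul_zero]
        rw [e, Matrix.mulVec_smul]
        simp only [map_smul, LinearMap.smul_apply, smul_eq_mul]
        ring)
      (fun x y y' => by
        have e : τ.symm (y + y', 0) = τ.symm (y, 0) + τ.symm (y', 0) := by
          rw [← map_add, Prod.mk_add_mk, add_zero]
        rw [e, Matrix.mulVec_add]
        simp only [map_add]
        ring)
      (fun c x y => by
        have e : τ.symm (c • y, 0) = c • τ.symm (y, 0) := by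
          rw [← map_smul, Prod.smul_mk, smul_zero]
        rw [e, Matrix.mulVec_smul]
        simp only [map_smul, smul_eq_mul]
        ring), fun x y => by
      rw [LinearMap.mk₂_apply, LinearMap.mk₂_apply, conjForm_symm g _ (τ.symm (y, 0)),
        conjForm_symm g (τ.symm (x, 0)), add_comm]⟩
  map_add' X Y := by
    refine Subtype.ext (LinearMap.ext fun x => LinearMap.ext fun y => ?_)
    simp only [Submodule.coe_add, LinearMap.add_apply, LinearMap.mk₂_apply, Matrix.add_mulVec,
      map_add]
    ring
  map_smul' c X := by
    refine Subtype.ext (LinearMap.ext fun x => LinearMap.ext fun y => ?_)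
    simp only [Submodule.coe_smul, LinearMap.smul_apply, LinearMap.mk₂_apply, Matrix.smul_mulVec,
      map_smul, smul_eq_mul, RingHom.id_apply]
    ring

theorem transversalForm_apply (X : slpq p q) (x y : Fin ν → ℝ) :
    (transversalForm τ g X).1 x y = conjForm g (X.1 *ᵥ τ.symm (x, 0)) (τ.symm (y, 0)) +
      conjForm g (τ.symm (x, 0)) (X.1 *ᵥ τ.symm (y, 0)) := rfl

/-- An element of 𝔭 maps the radical into `o`, and `o` is orthogonal to the radical. -/
theorem parabolicAlg_le_ker (h : IsAdaptedFrame τ o g r s) :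
    parabolicAlg o ≤ LinearMap.ker (transversalForm τ g) := by
  intro X hX
  refine LinearMap.mem_ker.2 (Subtype.ext (LinearMap.ext fun x => LinearMap.ext fun y => ?_))
  have h0 : ∀ x, τ.symm (x, 0) ∈ o.1 ⊓ (conjForm g).orthogonal o.1 := fun x => by
    rw [h.mem_radical_iff, LinearEquiv.apply_symm_apply]
  rw [transversalForm_apply, conjForm_symm g (τ.symm (x, 0)),
    (h0 y).2 _ (hX _ (h0 x).1), (h0 x).2 _ (hX _ (h0 y).1)]
  simp

theorem conjSOAlg_le_ker : conjSOAlg g ≤ LinearMap.ker (transversalForm τ g) := fun _ hX =>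
  LinearMap.mem_ker.2 (Subtype.ext (LinearMap.ext fun _ => LinearMap.ext fun _ => hX _ _))

open Classical in
/-- The projection of `ℝ^(a,b)` to `ℝ^(r,s)`. -/
def blockProj (a b r s : ℕ) : Rpq a b →ₗ[ℝ] Rpq a b where
  toFun u j := if j ∈ firstBlock r s then u j else 0
  map_add' u v := by
    ext j
    by_cases hj : j ∈ firstBlock r s <;> simp [hj]
  map_smul' c u := by
    ext j
    by_cases hj : j ∈ firstBlock r s <;> simp [hj]

theorem blockProj_eq_self {u : Rpq a b} (hu : u ∈ coordSubspace a b r s) :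
    blockProj a b r s u = u := by
  ext j
  by_cases hj : j ∈ firstBlock r s
  · simp [blockProj, hj]
  · simp [blockProj, hj, hu j hj]

/-- A matrix for which the associated form on the radical vanishes differs from a skew one by one
which preserves the subspace. -/
theorem ker_transversalForm_le (h : IsAdaptedFrame τ o g r s) :
    LinearMap.ker (transversalForm τ g) ≤ parabolicAlg o ⊔ conjSOAlg g := by
  intro X hX
  have hX' : ∀ x y, conjForm g (X.1 *ᵥ τ.symm (x, 0)) (τ.symm (y, 0)) +
      conjForm g (τ.symm (x, 0)) (X.1 *ᵥ τ.symm (y, 0)) = 0 := fun x y => by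
    rw [← transversalForm_apply, LinearMap.mem_ker.1 hX]
    rfl
  -- Here `N`, `C` and `D` project to the radical, to ℝ^(r,s) and to the rest of the middle factor.
  -- Thus `o` is the image of `N + C` and its orthogonal space the image of `N + D`.
  let N : Rpq p q →ₗ[ℝ] Rpq p q :=
    τ.symm.toLinearMap ∘ₗ LinearMap.inl ℝ _ _ ∘ₗ LinearMap.fst ℝ _ _ ∘ₗ τ.toLinearMap
  let mid : Rpq a b →ₗ[ℝ] Rpq p q :=
    τ.symm.toLinearMap ∘ₗ LinearMap.inr ℝ _ _ ∘ₗ LinearMap.inl ℝ _ _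
  let snd : Rpq p q →ₗ[ℝ] Rpq a b := LinearMap.fst ℝ _ _ ∘ₗ LinearMap.snd ℝ _ _ ∘ₗ τ.toLinearMap
  let C : Rpq p q →ₗ[ℝ] Rpq p q := mid ∘ₗ blockProj a b r s ∘ₗ snd
  let D : Rpq p q →ₗ[ℝ] Rpq p q := mid ∘ₗ (LinearMap.id - blockProj a b r s) ∘ₗ snd
  let θ : LinearMap.BilinForm ℝ (Rpq p q) := (conjForm g).comp (Matrix.toLin' X.1) LinearMap.id
  have hθ : ∀ v w, θ v w = conjForm g (X.1 *ᵥ v) w := fun v w => by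
    simp [θ]
  have hN : ∀ v w, θ (N v) (N w) + θ (N w) (N v) = 0 := fun v w => by
    have := hX' (τ v).1 (τ w).1
    rw [conjForm_symm g (τ.symm ((τ v).1, 0)), ← hθ, ← hθ] at this
    exact this
  -- `Ω` is a skew form which agrees with `θ` whenever the first argument is in `o` and the second
  -- in the orthogonal space of `o`. These spaces overlap in the radical, where `hN` says that `θ`
  -- is already skew; the factor 1/2 antisymmetrizes it there.
  let Ω : LinearMap.BilinForm ℝ (Rpq p q) :=
    θ.comp (N + C) D - (θ.comp (N + C) D).flip + θ.comp C N - (θ.comp C N).flip +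
      (1 / 2 : ℝ) • (θ.comp N N - (θ.comp N N).flip)
  have hΩ : ∀ v w, Ω v w = θ (N v + C v) (D w) - θ (N w + C w) (D v) + θ (C v) (N w) -
      θ (C w) (N v) + (1 / 2 : ℝ) * (θ (N v) (N w) - θ (N w) (N v)) := fun v w => rfl
  let S : Module.End ℝ (Rpq p q) :=
    ((conjForm g).toDual h.nondegenerate).symm.toLinearMap ∘ₗ Ω
  have hS : ∀ v w, conjForm g (S v) w = Ω v w := fun v w => by
    exact LinearMap.BilinForm.apply_toDual_symm_apply (hB := h.nondegenerate) (Ω v) w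
  have hY : ∀ v, LinearMap.toMatrix' S *ᵥ v = S v := fun v => by
    rw [← Matrix.toLin'_apply, Matrix.toLin'_toMatrix']
  have hskew : ∀ v w, conjForm g (LinearMap.toMatrix' S *ᵥ v) w +
      conjForm g v (LinearMap.toMatrix' S *ᵥ w) = 0 := fun v w => by
    rw [hY, hY, conjForm_symm g v, hS, hS, hΩ, hΩ]
    ring
  let Y : slpq p q := ⟨LinearMap.toMatrix' S, LinearMap.mem_ker.2
    (trace_eq_zero_of_skew h.nondegenerate hskew)⟩
  have hXY : X - Y ∈ parabolicAlg o := by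
    intro v hv
    have hv' := (h.mem_iff v).1 hv
    have e1 : N v + C v = v := by
      apply τ.injective
      rw [map_add]
      change τ (τ.symm ((τ v).1, 0)) + τ (τ.symm (0, (blockProj a b r s (τ v).2.1, 0))) = _
      rw [LinearEquiv.apply_symm_apply, LinearEquiv.apply_symm_apply, blockProj_eq_self hv'.1]
      exact Prod.ext (by simp) (Prod.ext (by simp) (by simp [hv'.2]))
    have e2 : D v = 0 := by
      change mid ((τ v).2.1 - blockProj a b r s (τ v).2.1) = 0
      rw [blockProj_eq_self hv'.1, sub_self, map_zero]
    -- The conditions on `w` say that it is orthogonal to `o`. Since `o` is its own double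
    -- orthogonal, this is enough to place `(X - Y) v` in `o`.
    have key : ∀ w, C w = 0 → N w + D w = w → conjForm g ((X - Y).1 *ᵥ v) w = 0 := by
      intro w hw1 hw2
      have e3 : (X - Y).1 *ᵥ v = X.1 *ᵥ v - S v := by
        rw [← hY, ← Matrix.sub_mulVec]
        rfl
      have e4 : θ v w = θ (N v + C v) (D w) + θ (C v) (N w) + θ (N v) (N w) := by
        conv_lhs => rw [← e1, ← hw2]
        simp only [map_add, LinearMap.add_apply]
        ring
      rw [e3, map_sub, LinearMap.sub_apply, hS, hΩ, ← hθ, e4, hw1, e2]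
      simp only [map_zero, LinearMap.zero_apply]
      linear_combination (1 / 2 : ℝ) * hN v w
    rw [h.mem_iff]
    constructor
    · intro j hj
      have hp : blockProj a b r s (Pi.single j 1) = 0 := by
        ext l
        by_cases hl : l ∈ firstBlock r s
        · have : l ≠ j := fun e => hj (e ▸ hl)
          simp [blockProj, this]
        · simp [blockProj, hl]
      have h1 := key (τ.symm (0, (Pi.single j 1, 0)))
        (by
          change mid (blockProj a b r s (τ (τ.symm _)).2.1) = 0
          rw [LinearEquiv.apply_symm_apply, hp, map_zero])
        (by
          change τ.symm ((τ (τ.symm _)).1, 0) +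
            mid ((τ (τ.symm _)).2.1 - blockProj a b r s (τ (τ.symm _)).2.1) = _
          rw [LinearEquiv.apply_symm_apply, hp]
          have : ((0 : Fin ν → ℝ), (0 : Rpq a b × ((Fin ν → ℝ) →L[ℝ] ℝ))) = 0 := rfl
          rw [this, map_zero, zero_add, sub_zero]
          rfl)
      rw [h.isometric, LinearEquiv.apply_symm_apply, wittBilin_apply] at h1
      rcases j with j | j <;> simpa [stdForm_apply, Pi.single_apply] using h1
    · ext x
      have h1 := key (τ.symm (x, 0))
        (by
          change mid (blockProj a b r s (τ (τ.symm _)).2.1) = 0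
          rw [LinearEquiv.apply_symm_apply]
          simp)
        (by
          change τ.symm ((τ (τ.symm _)).1, 0) +
            mid ((τ (τ.symm _)).2.1 - blockProj a b r s (τ (τ.symm _)).2.1) = _
          rw [LinearEquiv.apply_symm_apply]
          simp)
      rw [h.isometric, LinearEquiv.apply_symm_apply, wittBilin_apply] at h1
      simpa using h1
  rw [← sub_add_cancel X Y]
  exact Submodule.add_mem_sup hXY hskew

/-- A given form is realized by a map from the radical to its dual that kills everything else. It
squares to zero, so its trace vanishes. The factor 1/2 compensates for the two equal terms of
`transversalForm`. -/
theorem transversalForm_surjective (h : IsAdaptedFrame τ o g r s) :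
    Function.Surjective (transversalForm τ g) := by
  intro S
  let c := LinearMap.toContinuousLinearMap (𝕜 := ℝ) (E := Fin ν → ℝ) (F' := ℝ)
  let T : Module.End ℝ (WittSpace ν a b) := LinearMap.inr ℝ _ _ ∘ₗ LinearMap.inr ℝ _ _ ∘ₗ
    c.toLinearMap ∘ₗ ((1 / 2 : ℝ) • S.1) ∘ₗ LinearMap.fst ℝ _ _
  have hT : ∀ m, T m = (0, (0, c ((1 / 2 : ℝ) • S.1 m.1))) := fun m => rfl
  let X := LinearMap.toMatrix' (τ.symm.toLinearMap ∘ₗ T ∘ₗ τ.toLinearMap)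
  have hX : ∀ v, X *ᵥ v = τ.symm (T (τ v)) := fun v => by
    rw [← Matrix.toLin'_apply, Matrix.toLin'_toMatrix']
    rfl
  have hX2 : X * X = 0 := by
    refine Matrix.toLin'.injective (LinearMap.ext fun v => ?_)
    rw [Matrix.toLin'_apply, ← Matrix.mulVec_mulVec, hX, hX, LinearEquiv.apply_symm_apply, hT,
      hT]
    simp
  have htr : X.trace = 0 :=
    (Matrix.isNilpotent_trace_of_isNilpotent ⟨2, by rw [pow_two, hX2]⟩).eq_zero
  refine ⟨⟨X, htr⟩, Subtype.ext (LinearMap.ext fun x => LinearMap.ext fun y => ?_)⟩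
  rw [transversalForm_apply]
  simp only [hX, h.isometric, LinearEquiv.apply_symm_apply, wittBilin_apply, hT]
  have h1 := S.2 y x
  have e : ∀ x y, c ((1 / 2 : ℝ) • S.1 x) y = 1 / 2 * S.1 x y := fun x y => rfl
  simp only [e, map_zero, LinearMap.zero_apply, h1]
  simp
  ring

/-- Invariance of the form moves `k` to the other argument as `k⁻¹`, and `k⁻¹` acts on the radical
through the inverse of the first component of `naturalHom`. -/
theorem transversalForm_adRep (h : IsAdaptedFrame τ o g r s) (k : isotropy o g) (X : slpq p q) :
    transversalForm τ g (adRep p q k.1 X) = symRep ν (naturalHom h k).1 (transversalForm τ g X) := by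
  refine Subtype.ext (LinearMap.ext fun x => LinearMap.ext fun y => ?_)
  have e : ∀ x, τ.symm (((naturalHom h k).1⁻¹).1 *ᵥ x, 0) = (k⁻¹).1.1 *ᵥ τ.symm (x, 0) := fun x => by
    rw [LinearEquiv.symm_apply_eq, apply_isotropy_rad h, map_inv]
    rfl
  have e2 : (symRep ν (naturalHom h k).1 (transversalForm τ g X)).1 x y =
      (transversalForm τ g X).1 (((naturalHom h k).1⁻¹).1 *ᵥ x) (((naturalHom h k).1⁻¹).1 *ᵥ y) := by
    simp [symRep]
  have e3 : ∀ v, (adRep p q k.1 X).1 *ᵥ v = k.1.1 *ᵥ (X.1 *ᵥ ((k⁻¹).1.1 *ᵥ v)) := fun v => by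
    rw [Matrix.mulVec_mulVec, Matrix.mulVec_mulVec]
    rfl
  have e4 : ∀ v w, conjForm g (k.1.1 *ᵥ v) w = conjForm g v ((k⁻¹).1.1 *ᵥ w) := fun v w => by
    rw [← conjForm_isotropy k v, isotropy_mul_inv_mulVec]
  rw [e2, transversalForm_apply, transversalForm_apply, e, e, e3, e3, e4,
    conjForm_symm g (τ.symm (x, 0)), e4, conjForm_symm g ((k⁻¹).1.1 *ᵥ τ.symm (x, 0))]

/-- A surjective linear map on `E` with kernel `P ⊔ H` identifies the iterated quotient of `E`. -/
theorem exists_iteratedQuotient_equiv {E F : Type*} [AddCommGroup E] [Module ℝ E]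
    [AddCommMonoid F] [Module ℝ F] {P H : Submodule ℝ E} {f : E →ₗ[ℝ] F}
    (hP : P ≤ LinearMap.ker f) (hH : H ≤ LinearMap.ker f) (hf : LinearMap.ker f ≤ P ⊔ H)
    (hs : Function.Surjective f) : ∃ e : ((E ⧸ P) ⧸ H.map P.mkQ) ≃ₗ[ℝ] F,
      ∀ X, e (Submodule.Quotient.mk (Submodule.Quotient.mk X)) = f X := by
  let _ : AddCommGroup F := Module.addCommMonoidToAddCommGroup ℝ
  let e₀ : ((E ⧸ P) ⧸ H.map P.mkQ) →ₗ[ℝ] F := Submodule.liftQ _ (P.liftQ f hP) (by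
    rintro _ ⟨X, hX, rfl⟩
    exact hH hX)
  have he : ∀ X, e₀ (Submodule.Quotient.mk (Submodule.Quotient.mk X)) = f X := fun X => rfl
  refine ⟨LinearEquiv.ofBijective e₀ ⟨?_, fun S => ?_⟩, he⟩
  · rw [injective_iff_map_eq_zero]
    intro z hz
    obtain ⟨z, rfl⟩ := Submodule.Quotient.mk_surjective _ z
    obtain ⟨X, rfl⟩ := Submodule.Quotient.mk_surjective _ z
    rw [he] at hz
    obtain ⟨A, hA, Y, hY, rfl⟩ := Submodule.mem_sup.1 (hf hz)
    rw [Submodule.Quotient.mk_eq_zero]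
    refine ⟨Y, hY, ?_⟩
    rw [Submodule.mkQ_apply, Submodule.Quotient.mk_add, (Submodule.Quotient.mk_eq_zero _).2 hA,
      zero_add]
  · obtain ⟨X, rfl⟩ := hs S
    exact ⟨_, he X⟩

/-- The infinitesimal transversal is the representation on symmetric forms. -/
theorem nonempty_transversalRep_equiv (h : IsAdaptedFrame τ o g r s) :
    Nonempty (Representation.Equiv (transversalRep o g)
      ((symRep ν).comp ((MonoidHom.fst _ _).comp (naturalHom h)))) := by
  obtain ⟨e, he⟩ := exists_iteratedQuotient_equiv (parabolicAlg_le_ker h) conjSOAlg_le_ker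
    (ker_transversalForm_le h) (transversalForm_surjective h)
  refine ⟨Representation.Equiv.mk e fun k => ?_⟩
  refine LinearMap.ext fun z => ?_
  obtain ⟨z, rfl⟩ := Submodule.Quotient.mk_surjective _ z
  obtain ⟨X, rfl⟩ := Submodule.Quotient.mk_surjective _ z
  have h1 : transversalRep o g k (Submodule.Quotient.mk (Submodule.Quotient.mk X)) =
    Submodule.Quotient.mk (Submodule.Quotient.mk (adRep p q k.1 X)) := rfl
  change e (transversalRep o g k _) = symRep ν (naturalHom h k).1 (e _)
  rw [h1, he, he]
  exact transversalForm_adRep h k X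

end Transversal

end

noncomputable section

/-! ### The orbit and the isotropic Grassmannian as submanifolds -/

section OrbitManifolds

open Topology

/-- The standard form as a continuous bilinear map. -/
def stdClm (a b : ℕ) : Rpq a b →L[ℝ] Rpq a b →L[ℝ] ℝ :=
  LinearMap.toContinuousBilinearMap (stdForm a b)

@[simp]
theorem stdClm_apply {a b : ℕ} (x y : Rpq a b) : stdClm a b x y = stdForm a b x y := by
  simp [stdClm]

theorem wittData_stdClm (r s a b : ℕ) : WittData (stdClm r s) (stdClm a b) r s where
  bijective := by
    have h : Function.Injective (stdClm r s).toLinearMap := by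
      rw [injective_iff_map_eq_zero]
      intro x hx
      refine stdForm_nondegenerate fun y => ?_
      rw [stdForm_symm, ← stdClm_apply]
      exact congrArg (fun f => f y) hx
    refine ⟨h, (LinearMap.injective_iff_surjective_of_finrank_eq_finrank ?_).1 h⟩
    rw [← (LinearMap.toContinuousLinearMap (𝕜 := ℝ) (E := Rpq r s) (F' := ℝ)).finrank_eq,
      Module.finrank_linearMap]
    simp
  symm₁ x y := by rw [stdClm_apply, stdClm_apply, stdForm_symm]
  symm₂ x y := by rw [stdClm_apply, stdClm_apply, stdForm_symm]
  finrank_eq := by simp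
  hasSig := by
    have h : quadOf (stdClm r s) = (stdForm r s).toQuadraticMap := by
      ext x
      exact stdClm_apply x x
    rw [h]
    exact hasSig_stdForm r s

variable {p q r s ν a b i : ℕ}

/-- The frame with values in a product of four factors which is obtained by decomposing the middle
factor of the standard space. -/
def splitFrame (τ : Rpq p q ≃ₗ[ℝ] WittSpace ν (r + a) (s + b)) :
    Rpq p q ≃ₗ[ℝ] (Fin ν → ℝ) × Rpq r s × Rpq a b × ((Fin ν → ℝ) →L[ℝ] ℝ) :=
  τ.trans ((LinearEquiv.refl ℝ (Fin ν → ℝ)).prodCongr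
    (((rpqSplit r a s b).prodCongr (LinearEquiv.refl ℝ _)).trans (LinearEquiv.prodAssoc ℝ _ _ _)))

theorem splitFrame_apply (τ : Rpq p q ≃ₗ[ℝ] WittSpace ν (r + a) (s + b)) (v : Rpq p q) :
    splitFrame τ v = ((τ v).1, (rpqSplit r a s b (τ v).2.1).1, (rpqSplit r a s b (τ v).2.1).2,
      (τ v).2.2) := rfl

theorem IsWittFrame.wittForm_splitFrame {τ : Rpq p q ≃ₗ[ℝ] WittSpace ν (r + a) (s + b)}
    (hτ : IsWittFrame τ) (v w : Rpq p q) :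
    stdForm p q v w = wittForm (stdClm r s) (stdClm a b) (splitFrame τ v) (splitFrame τ w) := by
  rw [hτ, wittBilin_apply, stdForm_rpqSplit, wittForm, splitFrame_apply, splitFrame_apply]
  simp only [stdClm_apply]
  ring

theorem splitFrame_snd_eq_zero_iff (τ : Rpq p q ≃ₗ[ℝ] WittSpace ν (r + a) (s + b)) (v : Rpq p q) :
    (splitFrame τ v).2 = 0 ↔ (τ v).2 = 0 := by
  constructor
  · intro h
    have h2 : (rpqSplit r a s b (τ v).2.1).1 = 0 := congrArg Prod.fst h
    have h3 : (rpqSplit r a s b (τ v).2.1).2 = 0 := congrArg (fun z => z.2.1) h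
    have h1 : rpqSplit r a s b (τ v).2.1 = 0 := Prod.ext h2 h3
    exact Prod.ext ((rpqSplit r a s b).map_eq_zero_iff.1 h1) (congrArg (fun z => z.2.2) h)
  · intro h
    rw [splitFrame_apply, h, Prod.fst_zero, map_zero]
    rfl

theorem splitFrame_snd_snd_eq_zero_iff (τ : Rpq p q ≃ₗ[ℝ] WittSpace ν (r + a) (s + b))
    (v : Rpq p q) : (splitFrame τ v).2.2 = 0 ↔
      (τ v).2.1 ∈ coordSubspace (r + a) (s + b) r s ∧ (τ v).2.2 = 0 := by
  rw [splitFrame_apply, mem_coordSubspace_iff, Prod.ext_iff]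
  rfl

/-- Describing isotropy by a signature makes the slice charts for signatures available for the
isotropic Grassmannian. -/
theorem mem_IGr_iff {N : Gr ν (Rpq p q)} (ha : a + ν = p) (hb : b + ν = q) :
    N ∈ IGr ν p q ↔ HasSig ((stdForm p q).toQuadraticMap.restrict N.1) 0 0 := by
  constructor
  · intro h
    have h1 : (stdForm p q).toQuadraticMap.restrict N.1 = 0 := by
      ext x
      exact h x.1 x.2 x.1 x.2
    have h3 := hasSig_of_maps (Q := (stdForm p q).toQuadraticMap.restrict N.1)
      (0 : (Fin 0 → ℝ) →ₗ[ℝ] N.1) (0 : (Fin 0 → ℝ) →ₗ[ℝ] N.1) LinearMap.id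
      (fun x hx => (hx (Subsingleton.elim _ _)).elim)
      (fun x hx => (hx (Subsingleton.elim _ _)).elim) (fun x y h => h)
      (fun x m => by rw [h1]; rfl) (by simp)
    simpa using h3
  · intro h x hx y hy
    obtain ⟨-, -, h4⟩ := exists_frame_of_hasSig (ν := ν) h (by rw [N.2]; omega)
    obtain ⟨τ, hτ, hτN⟩ := h4 a b ha hb
    have h0 : ∀ z ∈ coordSubspace a b 0 0, z = 0 := fun z hz => funext fun j => hz j (by
      rcases j with j | j <;> simp [firstBlock])
    rw [hτ, wittBilin_apply, h0 _ ((hτN x).1 hx).1, ((hτN x).1 hx).2, ((hτN y).1 hy).2]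
    simp

/-- The space of parameters of the slice in the charts around a point of an orbit. -/
abbrev OrbitModel (ν r s a b : ℕ) : Type :=
  WittSlice (Fin ν → ℝ) (Rpq r s) (Rpq a b) ({p : Fin ν × Fin ν // p.1 < p.2} → ℝ)

/-- The space of parameters of the slice in the charts around an isotropic subspace. -/
abbrev IsotropicModel (ν r s a b : ℕ) : Type :=
  WittSlice (Fin ν → ℝ) (Fin 0 → ℝ) (Rpq r s × Rpq a b) ({p : Fin ν × Fin ν // p.1 < p.2} → ℝ)

/-- No counting is needed: `wittDeriv` is already a linear isomorphism of the parameters with the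
space of linear maps modelling the Grassmannian. -/
theorem finrank_wittSlice {X U₁ U₂ K S : Type} [NormedAddCommGroup X] [NormedSpace ℝ X]
    [FiniteDimensional ℝ X]
    [NormedAddCommGroup U₁] [NormedSpace ℝ U₁] [FiniteDimensional ℝ U₁]
    [NormedAddCommGroup U₂] [NormedSpace ℝ U₂] [FiniteDimensional ℝ U₂]
    [NormedAddCommGroup K] [NormedSpace ℝ K] [FiniteDimensional ℝ K]
    [NormedAddCommGroup S] [NormedSpace ℝ S] [FiniteDimensional ℝ S]
    {V : Type} [AddCommGroup V] [Module ℝ V] [FiniteDimensional ℝ V] {k : ℕ}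
    (J : BilinParam X K S) {β₁ : U₁ →L[ℝ] U₁ →L[ℝ] ℝ} (hβ : Function.Bijective β₁)
    (hβ' : ∀ x y, β₁ x y = β₁ y x) (τ : V ≃ₗ[ℝ] X × U₁ × U₂ × (X →L[ℝ] ℝ)) (hk : Module.finrank ℝ (X × U₁) = k) :
    Module.finrank ℝ (WittSlice X U₁ U₂ K × S) = Module.finrank ℝ (GrModel k V) := by
  rw [(graphModelEquiv (τ.trans (wittSplit X U₁ U₂)) hk).toLinearEquiv.finrank_eq]
  exact (LinearEquiv.ofBijective (wittDeriv J β₁) (bijective_wittDeriv J β₁ hβ hβ')).finrank_eq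

theorem finrank_orbitParam (ν r s : ℕ) : Module.finrank ℝ ((Fin ν → ℝ) × Rpq r s) = r + s + ν := by
  simp
  omega

/-- The orbit and the isotropic Grassmannian are embedded submanifolds and passing to the radical is
a submersion. -/
theorem exists_radical_submersion (hi : i = r + s + ν) (ha : r + a + ν = p) (hb : s + b + ν = q)
    {I : Set (Gr ν (Rpq p q))}
    (hI : I = {N | HasSig ((stdForm p q).toQuadraticMap.restrict N.1) 0 0})
    (π : grOrbit p q i r s → I) (hπ : ∀ W, (π W).1.1 = W.1.1 ⊓ (stdForm p q).orthogonal W.1.1) :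
    ∃ (dO dI : ℕ) (mO : EmbeddedManifold (GrModel i (Rpq p q))
          (Subtype.val : grOrbit p q i r s → Gr i (Rpq p q)) dO)
      (mI : EmbeddedManifold (GrModel ν (Rpq p q)) (Subtype.val : I → Gr ν (Rpq p q)) dI),
      dO + ν * (ν + 1) / 2 = Module.finrank ℝ (GrModel i (Rpq p q)) ∧ mO.IsSubmersion mI π := by
  subst hI
  have hd := wittData_stdClm r s a b
  have hk : Module.finrank ℝ ((Fin ν → ℝ) × Rpq r s) = i := (finrank_orbitParam ν r s).trans hi.symm
  have hl : Module.finrank ℝ ((Fin ν → ℝ) × (Fin 0 → ℝ)) = ν := by simp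
  -- This frame serves only to compare dimensions; charts use frames adapted to each point.
  obtain ⟨τ₀, hτ₀⟩ := exists_frame ha hb
  have hdO := finrank_wittSlice (coeffParam ν) hd.bijective hd.symm₁ (splitFrame τ₀) hk
  have hdI := finrank_wittSlice (coeffParam ν) (hd.radical (U₀ := Fin 0 → ℝ)).bijective
    (hd.radical (U₀ := Fin 0 → ℝ)).symm₁ (radicalFrame (Fin 0 → ℝ) (splitFrame τ₀)) hl
  let eO : (OrbitModel ν r s a b × (Sym2 (Fin ν) → ℝ)) ≃L[ℝ] GrModel i (Rpq p q) :=
    ContinuousLinearEquiv.ofFinrankEq hdO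
  let eI : (IsotropicModel ν r s a b × (Sym2 (Fin ν) → ℝ)) ≃L[ℝ] GrModel ν (Rpq p q) :=
    ContinuousLinearEquiv.ofFinrankEq hdI
  have hO : ∀ W : grOrbit p q i r s, ∃ τ : Rpq p q ≃ₗ[ℝ] WittSpace ν (r + a) (s + b),
      IsWittFrame τ ∧ ∀ v, v ∈ W.1.1 ↔ (splitFrame τ v).2.2 = 0 := fun W => by
    obtain ⟨-, -, h⟩ := exists_frame_of_hasSig W.2 (W.1.2.trans hi)
    obtain ⟨τ, hτ, hτW⟩ := h (r + a) (s + b) ha hb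
    exact ⟨τ, hτ, fun v => by rw [hτW v, splitFrame_snd_snd_eq_zero_iff]⟩
  choose τ hτ hW using hO
  have hchart := fun W : grOrbit p q i r s => hd.exists_charts_radical (U₀ := Fin 0 → ℝ)
    (coeffParam ν) hk hl (hτ W).wittForm_splitFrame π hπ W (hW W)
  refine ⟨_, _, EmbeddedManifold.ofSlices IsEmbedding.subtypeVal
    (toEuclidean (E := OrbitModel ν r s a b)) eO (fun W => ?_),
    EmbeddedManifold.ofSlices IsEmbedding.subtypeVal
      (toEuclidean (E := IsotropicModel ν r s a b)) eI (fun N => ?_), ?_,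
    EmbeddedManifold.isSubmersion_ofSlices IsEmbedding.subtypeVal _ eO _
      IsEmbedding.subtypeVal _ eI _ π hchart⟩
  · obtain ⟨θ, -, -, h1, h2, -⟩ := hchart W
    exact ⟨θ, h1, h2⟩
  · have hN := (mem_IGr_iff ha hb).2 N.2
    obtain ⟨τ, hτ, hτN⟩ := (IsWittFrame.isotropic_iff N.1.2 ha hb).1 hN
    obtain ⟨θ, h1, h2, -⟩ := (hd.radical (U₀ := Fin 0 → ℝ)).exists_isSliceChart (coeffParam ν) hl
      (τ := radicalFrame (Fin 0 → ℝ) (splitFrame τ))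
      (fun v w => by rw [wittForm_radicalFrame, hτ.wittForm_splitFrame]) N.1 (fun v => by
        rw [hτN, ← splitFrame_snd_eq_zero_iff, radicalFrame_apply]
        simp only [Prod.ext_iff, Prod.fst_zero, Prod.snd_zero, and_assoc])
    exact ⟨θ, h1, h2⟩
  -- The factor complementary to the slice is the space of coefficients of symmetric forms.
  · rw [← hdO, Module.finrank_prod (M := OrbitModel ν r s a b), finrank_symCoeff]

end OrbitManifolds

end

noncomputable section

/-! ### The special orthogonal group as a submanifold of the matrix space -/

section SpecialOrthogonal

open Topology

variable {a b : ℕ}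

local notation "𝕁" => LieAlgebra.Orthogonal.indefiniteDiagonal (Fin _) (Fin _) ℝ

/-- The matrix of the form `(x, y) ↦ b(X x, Y y)`. -/
def gramMatrix (X Y : Matrix (Fin a ⊕ Fin b) (Fin a ⊕ Fin b) ℝ) :
    Matrix (Fin a ⊕ Fin b) (Fin a ⊕ Fin b) ℝ := Xᵀ * 𝕁 * Y

theorem gramMatrix_add_left (X X' Y : Matrix (Fin a ⊕ Fin b) (Fin a ⊕ Fin b) ℝ) :
    gramMatrix (X + X') Y = gramMatrix X Y + gramMatrix X' Y := by
  simp [gramMatrix, add_mul]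

theorem gramMatrix_add_right (X Y Y' : Matrix (Fin a ⊕ Fin b) (Fin a ⊕ Fin b) ℝ) :
    gramMatrix X (Y + Y') = gramMatrix X Y + gramMatrix X Y' := by
  simp [gramMatrix, mul_add]

theorem gramMatrix_smul_left (c : ℝ) (X Y : Matrix (Fin a ⊕ Fin b) (Fin a ⊕ Fin b) ℝ) :
    gramMatrix (c • X) Y = c • gramMatrix X Y := by
  simp [gramMatrix]

theorem gramMatrix_smul_right (c : ℝ) (X Y : Matrix (Fin a ⊕ Fin b) (Fin a ⊕ Fin b) ℝ) :
    gramMatrix X (c • Y) = c • gramMatrix X Y := by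
  simp [gramMatrix]

theorem gramMatrix_transpose (X Y : Matrix (Fin a ⊕ Fin b) (Fin a ⊕ Fin b) ℝ) :
    (gramMatrix X Y)ᵀ = gramMatrix Y X := by
  have h : (LieAlgebra.Orthogonal.indefiniteDiagonal (Fin a) (Fin b) ℝ)ᵀ = 𝕁 :=
    Matrix.diagonal_transpose _
  rw [gramMatrix, gramMatrix, Matrix.transpose_mul, Matrix.transpose_mul, h,
    Matrix.transpose_transpose, mul_assoc]

/-- Multiplying the isometry equation by `𝕁` on the right shows that `X * 𝕁` inverts `Xᵀ * 𝕁`. -/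
theorem bijective_gramMatrix {X : Matrix (Fin a ⊕ Fin b) (Fin a ⊕ Fin b) ℝ}
    (h : gramMatrix X X = 𝕁) : Function.Bijective (gramMatrix X) := by
  have h1 : (Xᵀ * 𝕁) * (X * 𝕁) = 1 := by
    rw [← mul_assoc]
    rw [gramMatrix] at h
    rw [h, indefiniteDiagonal_mul_self]
  have h2 := mul_eq_one_comm.1 h1
  constructor
  · intro Y Z e
    have e1 := congrArg (fun Z => (X * 𝕁) * Z) e
    simp only [gramMatrix] at e1
    rw [← mul_assoc, ← mul_assoc (X * _) (Xᵀ * _) Z, h2] at e1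
    simpa using e1
  · intro Z
    refine ⟨(X * 𝕁) * Z, ?_⟩
    rw [gramMatrix, ← mul_assoc, h1, one_mul]

/-- The matrix of the form `(x, y) ↦ b(X x, Y y)` as a continuous bilinear map. -/
def gram (a b : ℕ) : MatSpace a b →L[ℝ] MatSpace a b →L[ℝ] MatSpace a b :=
  LinearMap.toContinuousBilinearMap (LinearMap.mk₂ ℝ
    (fun X Y : MatSpace a b => (gramMatrix X Y : MatSpace a b)) gramMatrix_add_left
    gramMatrix_smul_left gramMatrix_add_right gramMatrix_smul_right)

theorem gram_apply (X Y : MatSpace a b) : gram a b X Y = gramMatrix X Y := rfl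

/-- The transpose of matrices. -/
def transposeLin (a b : ℕ) : MatSpace a b →ₗ[ℝ] MatSpace a b where
  toFun X j k := X k j
  map_add' _ _ := rfl
  map_smul' _ _ := rfl

theorem transposeLin_transposeLin (X : MatSpace a b) :
    transposeLin a b (transposeLin a b X) = X := rfl

theorem transposeLin_gram (X Y : MatSpace a b) :
    transposeLin a b (gram a b X Y) = gram a b Y X :=
  gramMatrix_transpose X Y

/-- The skew-symmetric matrices. -/
abbrev skewMat (a b : ℕ) : Submodule ℝ (MatSpace a b) :=
  LinearMap.ker (transposeLin a b + LinearMap.id)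

/-- The symmetric matrices. -/
abbrev symMat (a b : ℕ) : Submodule ℝ (MatSpace a b) :=
  LinearMap.ker (transposeLin a b - LinearMap.id)

theorem mem_skewMat {X : MatSpace a b} : X ∈ skewMat a b ↔ transposeLin a b X = -X :=
  eq_neg_iff_add_eq_zero.symm

theorem mem_symMat {X : MatSpace a b} : X ∈ symMat a b ↔ transposeLin a b X = X :=
  sub_eq_zero

/-- The skew-symmetric part of a matrix, up to a factor. -/
def toSkew (a b : ℕ) : MatSpace a b →L[ℝ] skewMat a b :=
  LinearMap.toContinuousLinearMap ((LinearMap.id - transposeLin a b).codRestrict _ fun X => by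
    rw [mem_skewMat]
    simp [transposeLin_transposeLin])

/-- The symmetric part of a matrix, up to a factor. -/
def toSym (a b : ℕ) : MatSpace a b →L[ℝ] symMat a b :=
  LinearMap.toContinuousLinearMap ((LinearMap.id + transposeLin a b).codRestrict _ fun X => by
    rw [mem_symMat]
    simp [transposeLin_transposeLin, add_comm])

theorem coe_toSym (X : MatSpace a b) : (toSym a b X).1 = X + transposeLin a b X := rfl

theorem toSym_eq_zero_iff {X : MatSpace a b} (hX : transposeLin a b X = X) :
    toSym a b X = 0 ↔ X = 0 := by
  rw [Subtype.ext_iff, coe_toSym, hX, ← two_smul ℝ X]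
  simp

/-- The map whose second component vanishes on the isometries. -/
def isometryMap (h : MatSpace a b) (X : MatSpace a b) : skewMat a b × symMat a b :=
  (toSkew a b (gram a b h X), toSym a b (gram a b X X - gram a b h h))

/-- The derivative of `isometryMap h` at `h`. -/
def isometryDeriv (h : MatSpace a b) : MatSpace a b →L[ℝ] skewMat a b × symMat a b :=
  (toSkew a b ∘L gram a b h).prod ((2 : ℝ) • (toSym a b ∘L gram a b h))

theorem contDiff_isometryMap (h : MatSpace a b) : ContDiff ℝ ∞ (isometryMap h) :=
  ((toSkew a b).contDiff.comp (gram a b h).contDiff).prodMk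
    ((toSym a b).contDiff.comp (((gram a b).contDiff.clm_apply contDiff_id).sub contDiff_const))

theorem hasFDerivAt_isometryMap (h : MatSpace a b) :
    HasFDerivAt (isometryMap h) (isometryDeriv h) h := by
  have h1 : HasFDerivAt (fun X => gram a b X X - gram a b h h) _ h :=
    (((gram a b).hasFDerivAt (x := h)).clm_apply (hasFDerivAt_id h)).sub_const (gram a b h h)
  have h2 := ((toSkew a b ∘L gram a b h).hasFDerivAt (x := h)).prodMk
    ((toSym a b).hasFDerivAt.comp h h1)
  refine h2.congr_fderiv (ContinuousLinearMap.ext fun δ => Prod.ext rfl (Subtype.ext ?_))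
  -- The two terms of the differentiated Gram matrix are transposes of each other, so symmetrizing
  -- doubles their sum; hence the factor 2 in `isometryDeriv`.
  change gram a b h δ + gram a b δ h + transposeLin a b (gram a b h δ + gram a b δ h) =
    (2 : ℝ) • (gram a b h δ + transposeLin a b (gram a b h δ))
  rw [map_add, transposeLin_gram, transposeLin_gram, two_smul]
  abel

theorem gramMatrix_self_of_mem (h : SOpq a b) : gramMatrix h.1.1 h.1.1 = 𝕁 :=
  isometry_iff_transpose_mul.1 h.2

theorem bijective_gram (h : SOpq a b) :
    Function.Bijective (gram a b (SOpq.entries a b h)) :=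
  bijective_gramMatrix (gramMatrix_self_of_mem h)

/-- In terms of `Z = gram h δ`, which runs bijectively over all matrices, the derivative is the
decomposition into skew and symmetric parts up to factors. -/
theorem bijective_isometryDeriv (h : SOpq a b) :
    Function.Bijective (isometryDeriv (SOpq.entries a b h)) := by
  obtain ⟨h1, h2⟩ := bijective_gram h
  constructor
  · rw [injective_iff_map_eq_zero]
    intro δ hδ
    set Z := gram a b (SOpq.entries a b h) δ with hZ
    have e1 : Z - transposeLin a b Z = 0 := congrArg (fun z => z.1.1) hδ
    have e2 : (2 : ℝ) • (Z + transposeLin a b Z) = 0 := congrArg (fun z => z.2.1) hδ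
    have e3 : Z = 0 := by
      have e4 : (4 : ℝ) • Z = (2 : ℝ) • (Z - transposeLin a b Z) +
        (2 : ℝ) • (Z + transposeLin a b Z) := by module
      rw [e1, e2] at e4
      simpa using e4
    exact h1 (e3.trans (map_zero _).symm)
  · rintro ⟨⟨K, hK⟩, ⟨S, hS⟩⟩
    rw [mem_skewMat] at hK
    rw [mem_symMat] at hS
    -- These coefficients solve `Z - Zᵀ = K` and `2 (Z + Zᵀ) = S`.
    obtain ⟨δ, hδ⟩ := h2 ((1 / 2 : ℝ) • K + (1 / 4 : ℝ) • S)
    refine ⟨δ, Prod.ext (Subtype.ext ?_) (Subtype.ext ?_)⟩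
    · change gram a b (SOpq.entries a b h) δ - transposeLin a b (gram a b (SOpq.entries a b h) δ) = K
      rw [hδ, map_add, map_smul, map_smul, hK, hS]
      module
    · change (2 : ℝ) • (gram a b (SOpq.entries a b h) δ +
        transposeLin a b (gram a b (SOpq.entries a b h) δ)) = S
      rw [hδ, map_add, map_smul, map_smul, hK, hS]
      module

/-- Isometries have determinant ±1, so the open condition of positive determinant selects the
special ones and no further equation is needed. -/
theorem mem_range_entries_iff {X : Matrix (Fin a ⊕ Fin b) (Fin a ⊕ Fin b) ℝ} (hX : 0 < X.det) :
    (X : MatSpace a b) ∈ Set.range (SOpq.entries a b) ↔ gramMatrix X X = 𝕁 := by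
  constructor
  · rintro ⟨h, rfl⟩
    exact gramMatrix_self_of_mem h
  · intro e
    have h1 := isometry_iff_transpose_mul.2 e
    have h2 : X.det = 1 := by
      rcases det_isometry (f := Matrix.toLin' X) (fun x y => by
        rw [Matrix.toLin'_apply, Matrix.toLin'_apply, h1]) with h | h
      · rwa [LinearMap.det_toLin'] at h
      · rw [LinearMap.det_toLin'] at h
        linarith
    exact ⟨⟨⟨X, h2⟩, h1⟩, rfl⟩

theorem isEmbedding_entries : IsEmbedding (SOpq.entries a b) := by
  have h1 : IsEmbedding (Subtype.val : SLpq a b → Matrix (Fin a ⊕ Fin b) (Fin a ⊕ Fin b) ℝ) :=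
    ⟨⟨rfl⟩, Subtype.val_injective⟩
  exact h1.comp IsEmbedding.subtypeVal

/-- Charts of the space of matrices in which the special orthogonal group is the zero locus of one
component. -/
theorem exists_isSliceChart_entries (h : SOpq a b) :
    ∃ θ : OpenPartialHomeomorph (MatSpace a b) (skewMat a b × symMat a b),
      IsSliceChart (MatSpace a b) (SOpq.entries a b) θ ∧ SOpq.entries a b h ∈ θ.source ∧
      (∀ X, θ X = isometryMap (SOpq.entries a b h) X) := by
  have hbij := bijective_isometryDeriv h
  rw [← (hasFDerivAt_isometryMap (SOpq.entries a b h)).fderiv] at hbij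
  obtain ⟨ψ, h1, h2, h3, h4⟩ :=
    (contDiff_isometryMap (SOpq.entries a b h)).exists_openPartialHomeomorph_of_bijective hbij
  let U : Set (MatSpace a b) := {X | 0 < Matrix.det (X : Matrix (Fin a ⊕ Fin b) (Fin a ⊕ Fin b) ℝ)}
  have hU : IsOpen U := by
    refine isOpen_lt continuous_const ?_
    exact Continuous.matrix_det (A := fun X : MatSpace a b =>
      (X : Matrix (Fin a ⊕ Fin b) (Fin a ⊕ Fin b) ℝ)) continuous_id
  refine ⟨ψ.restrOpen U hU, ⟨?_, ?_, ?_⟩, ⟨h2, ?_⟩, h1⟩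
  · rw [contMDiffOn_iff_contDiffOn]
    exact h3.mono fun X hX => hX.1
  · rw [contMDiffOn_iff_contDiffOn]
    exact h4.mono fun X hX => hX.1
  · rintro X ⟨hX1, hX2⟩
    refine (mem_range_entries_iff hX2).trans ?_
    change _ ↔ (ψ X).2 = 0
    rw [h1]
    have h5 : transposeLin a b (gram a b X X - gram a b (SOpq.entries a b h) (SOpq.entries a b h)) =
        gram a b X X - gram a b (SOpq.entries a b h) (SOpq.entries a b h) := by
      rw [map_sub, transposeLin_gram, transposeLin_gram]
    change _ ↔ toSym a b (gram a b X X - gram a b (SOpq.entries a b h) (SOpq.entries a b h)) = 0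
    rw [toSym_eq_zero_iff h5, sub_eq_zero, gram_apply, gram_apply]
    change _ ↔ gramMatrix X X = gramMatrix h.1.1 h.1.1
    rw [gramMatrix_self_of_mem]
  · change 0 < Matrix.det h.1.1
    rw [h.1.2]
    exact one_pos

/-- The space of matrices as the sum of the skew-symmetric and the symmetric ones. -/
def matSplit (a b : ℕ) : (skewMat a b × symMat a b) ≃L[ℝ] MatSpace a b :=
  (LinearEquiv.ofBijective (isometryDeriv (SOpq.entries a b 1)).toLinearMap
    (bijective_isometryDeriv 1)).toContinuousLinearEquiv.symm

end SpecialOrthogonal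

end

noncomputable section

/-! ### The submersion from the special orthogonal group to a fiber -/

section FiberManifolds

open Topology

/-- The structure of a manifold on the special orthogonal group. -/
def SOpq.manifold (a b : ℕ) : EmbeddedManifold (MatSpace a b) (SOpq.entries a b)
    (Module.finrank ℝ (skewMat a b)) :=
  EmbeddedManifold.ofSlices isEmbedding_entries (toEuclidean (E := skewMat a b)) (matSplit a b)
    fun h => by
      obtain ⟨θ, h1, h2, -⟩ := exists_isSliceChart_entries h
      exact ⟨θ, h1, h2⟩

/-- Composition of matrices with fixed linear maps on both sides. -/
def sandwich {n U U' : Type} [Fintype n] [DecidableEq n] [NormedAddCommGroup U] [NormedSpace ℝ U]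
    [FiniteDimensional ℝ U] [NormedAddCommGroup U'] [NormedSpace ℝ U'] [FiniteDimensional ℝ U']
    (P : (n → ℝ) →ₗ[ℝ] U') (Q : U →ₗ[ℝ] (n → ℝ)) : (n → n → ℝ) →L[ℝ] (U →L[ℝ] U') :=
  LinearMap.toContinuousLinearMap
    { toFun := fun X => LinearMap.toContinuousLinearMap (P ∘ₗ Matrix.toLin' (Matrix.of X) ∘ₗ Q)
      map_add' := fun X Y => by
        refine ContinuousLinearMap.ext fun u => ?_
        change P (Matrix.toLin' (Matrix.of X + Matrix.of Y) (Q u)) = _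
        rw [map_add, LinearMap.add_apply, map_add]
        rfl
      map_smul' := fun c X => by
        refine ContinuousLinearMap.ext fun u => ?_
        change P (Matrix.toLin' (c • Matrix.of X) (Q u)) = _
        rw [map_smul, LinearMap.smul_apply, map_smul]
        rfl }

variable {p q r s ν a b i : ℕ}

/-- The components in `ℝ^(r,s)` of the images of `ℝ^(r,s)` under `h⁻¹ X`. -/
def colFst (h : SOpq (r + a) (s + b)) :
    MatSpace (r + a) (s + b) →L[ℝ] (Rpq r s →L[ℝ] Rpq r s) :=
  sandwich (LinearMap.fst ℝ _ _ ∘ₗ (rpqSplit r a s b).toLinearMap ∘ₗ Matrix.toLin' (h⁻¹).1.1)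
    ((rpqSplit r a s b).symm.toLinearMap ∘ₗ LinearMap.inl ℝ _ _)

/-- The components in `ℝ^(a,b)` of the images of `ℝ^(r,s)` under `h⁻¹ X`. -/
def colSnd (h : SOpq (r + a) (s + b)) :
    MatSpace (r + a) (s + b) →L[ℝ] (Rpq r s →L[ℝ] Rpq a b) :=
  sandwich (LinearMap.snd ℝ _ _ ∘ₗ (rpqSplit r a s b).toLinearMap ∘ₗ Matrix.toLin' (h⁻¹).1.1)
    ((rpqSplit r a s b).symm.toLinearMap ∘ₗ LinearMap.inl ℝ _ _)

theorem colFst_apply (h : SOpq (r + a) (s + b))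
    (X : Matrix (Fin (r + a) ⊕ Fin (s + b)) (Fin (r + a) ⊕ Fin (s + b)) ℝ) (u : Rpq r s) :
    colFst h X u = (rpqSplit r a s b ((h⁻¹).1.1 *ᵥ (X *ᵥ (rpqSplit r a s b).symm (u, 0)))).1 := rfl

theorem colSnd_apply (h : SOpq (r + a) (s + b))
    (X : Matrix (Fin (r + a) ⊕ Fin (s + b)) (Fin (r + a) ⊕ Fin (s + b)) ℝ) (u : Rpq r s) :
    colSnd h X u = (rpqSplit r a s b ((h⁻¹).1.1 *ᵥ (X *ᵥ (rpqSplit r a s b).symm (u, 0)))).2 := rfl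

theorem SOpq.inv_mulVec_mulVec {a b : ℕ} (h : SOpq a b) (v : Rpq a b) :
    (h⁻¹).1.1 *ᵥ (h.1.1 *ᵥ v) = v :=
  SLpq.inv_mulVec_mulVec h.1 v

theorem SOpq.mulVec_inv_mulVec {a b : ℕ} (h : SOpq a b) (v : Rpq a b) :
    h.1.1 *ᵥ ((h⁻¹).1.1 *ᵥ v) = v :=
  SLpq.mulVec_inv_mulVec h.1 v

theorem colFst_self (h : SOpq (r + a) (s + b)) :
    colFst h (SOpq.entries (r + a) (s + b) h) = 1 := by
  refine ContinuousLinearMap.ext fun u => ?_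
  refine (colFst_apply h h.1.1 u).trans ?_
  rw [SOpq.inv_mulVec_mulVec, LinearEquiv.apply_symm_apply]
  rfl

theorem colSnd_self (h : SOpq (r + a) (s + b)) :
    colSnd h (SOpq.entries (r + a) (s + b) h) = 0 := by
  refine ContinuousLinearMap.ext fun u => ?_
  refine (colSnd_apply h h.1.1 u).trans ?_
  rw [SOpq.inv_mulVec_mulVec, LinearEquiv.apply_symm_apply]
  rfl

/-- The linear map whose graph is the image of `ℝ^(r,s)` under `h⁻¹ X`. -/
def colSlope (h : SOpq (r + a) (s + b)) (X : MatSpace (r + a) (s + b)) : Rpq r s →L[ℝ] Rpq a b :=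
  colSnd h X ∘L Ring.inverse (colFst h X)

theorem colSlope_self (h : SOpq (r + a) (s + b)) :
    colSlope h (SOpq.entries (r + a) (s + b) h) = 0 := by
  rw [colSlope, colSnd_self, ContinuousLinearMap.zero_comp]

theorem contDiffAt_colSlope {h : SOpq (r + a) (s + b)} {X : MatSpace (r + a) (s + b)}
    (hX : IsUnit (colFst h X)) : ContDiffAt ℝ ∞ (colSlope h) X := by
  obtain ⟨u, hu⟩ := hX
  have h0 : ContDiffAt ℝ ∞ Ring.inverse (colFst h X) := by
    rw [← hu]
    exact contDiffAt_ringInverse ℝ u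
  exact (colSnd h).contDiff.contDiffAt.clm_comp (h0.comp X (colFst h).contDiff.contDiffAt)

/-- The relation `colSlope h Y ∘L colFst h Y = colSnd h Y` near `h` is differentiated at `h`, where
the slope vanishes and `colFst` is the identity. -/
theorem fderiv_colSlope (h : SOpq (r + a) (s + b)) (δ : MatSpace (r + a) (s + b)) :
    fderiv ℝ (colSlope h) (SOpq.entries (r + a) (s + b) h) δ = colSnd h δ := by
  set X := SOpq.entries (r + a) (s + b) h with hX
  have hu : IsUnit (colFst h X) := by
    rw [colFst_self]
    exact isUnit_one
  have h1 : HasFDerivAt (colSlope h) _ X :=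
    ((contDiffAt_colSlope hu).differentiableAt (by simp)).hasFDerivAt
  have h2 : ∀ᶠ Y in 𝓝 X, colSlope h Y ∘L colFst h Y = colSnd h Y := by
    have h3 : ∀ᶠ Y in 𝓝 X, IsUnit (colFst h Y) :=
      (colFst h).continuous.continuousAt.eventually (Units.isOpen.mem_nhds hu)
    filter_upwards [h3] with Y hY
    rw [colSlope, ContinuousLinearMap.comp_assoc]
    change colSnd h Y ∘L (Ring.inverse (colFst h Y) * colFst h Y) = _
    rw [Ring.inverse_mul_cancel _ hY]
    rfl
  have h4 := (h1.clm_comp (colFst h).hasFDerivAt).unique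
    ((colSnd h).hasFDerivAt.congr_of_eventuallyEq h2)
  have h5 := congrArg (fun T => T δ) h4
  refine ContinuousLinearMap.ext fun u => ?_
  have h6 := congrArg (fun T => T u) h5
  simpa [colFst_self, colSlope_self, hX] using h6

/-- The infinitesimal isometries act transitively on linear maps `ℝ^(r,s) → ℝ^(a,b)`. -/
theorem exists_skew_colSnd (h : SOpq (r + a) (s + b)) (L : Rpq r s →L[ℝ] Rpq a b) :
    ∃ δ : MatSpace (r + a) (s + b), (isometryDeriv (SOpq.entries (r + a) (s + b) h) δ).2 = 0 ∧
      colSnd h δ = L := by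
  let σ := rpqSplit r a s b
  let P₁ : Rpq (r + a) (s + b) →ₗ[ℝ] Rpq a b := L.toLinearMap ∘ₗ LinearMap.fst ℝ _ _ ∘ₗ σ.toLinearMap
  let P₂ : Rpq (r + a) (s + b) →ₗ[ℝ] Rpq a b := LinearMap.snd ℝ _ _ ∘ₗ σ.toLinearMap
  -- A skew form with prescribed mixed part `L` between the two summands; the endomorphism `T`
  -- representing it is an infinitesimal isometry, and `h * T` is tangent to the group at `h`.
  let Ω : LinearMap.BilinForm ℝ (Rpq (r + a) (s + b)) :=
    (stdForm a b).compl₁₂ P₁ P₂ - ((stdForm a b).compl₁₂ P₁ P₂).flip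
  have hΩ : ∀ v w, Ω v w = stdForm a b (L (σ v).1) (σ w).2 - stdForm a b (L (σ w).1) (σ v).2 :=
    fun v w => rfl
  let T : Module.End ℝ (Rpq (r + a) (s + b)) :=
    ((stdForm (r + a) (s + b)).toDual (nondegenerate_stdForm _ _)).symm.toLinearMap ∘ₗ Ω
  have hT : ∀ v w, stdForm (r + a) (s + b) (T v) w = Ω v w := fun v w =>
    LinearMap.BilinForm.apply_toDual_symm_apply (hB := nondegenerate_stdForm _ _) (Ω v) w
  let M : Matrix (Fin (r + a) ⊕ Fin (s + b)) (Fin (r + a) ⊕ Fin (s + b)) ℝ := LinearMap.toMatrix' T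
  have hM : ∀ v, M *ᵥ v = T v := fun v => by
    rw [← Matrix.toLin'_apply, Matrix.toLin'_toMatrix']
  let δ : Matrix (Fin (r + a) ⊕ Fin (s + b)) (Fin (r + a) ⊕ Fin (s + b)) ℝ := h.1.1 * M
  have hδ : ∀ v, δ *ᵥ v = h.1.1 *ᵥ T v := fun v => by
    rw [← hM, Matrix.mulVec_mulVec]
  refine ⟨δ, ?_, ContinuousLinearMap.ext fun u => ?_⟩
  · have h1 : gramMatrix h.1.1 δ + gramMatrix δ h.1.1 = 0 := by
      apply (Matrix.toBilin' (R₁ := ℝ)).injective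
      rw [map_add, gramMatrix, gramMatrix, ← Matrix.toBilin'_comp, ← Matrix.toBilin'_comp, map_zero]
      refine LinearMap.ext fun v => LinearMap.ext fun w => ?_
      change stdForm _ _ (h.1.1 *ᵥ v) (δ *ᵥ w) + stdForm _ _ (δ *ᵥ v) (h.1.1 *ᵥ w) = 0
      rw [hδ, hδ, h.2, h.2, stdForm_symm, hT, hT, hΩ, hΩ]
      ring
    change (2 : ℝ) • toSym _ _ (gram _ _ (SOpq.entries _ _ h) δ) = 0
    have h2 : toSym _ _ (gram _ _ (SOpq.entries _ _ h) δ) = 0 := by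
      have h3 := transposeLin_gram (SOpq.entries (r + a) (s + b) h) (δ : MatSpace (r + a) (s + b))
      refine Subtype.ext ((coe_toSym _).trans ?_)
      rw [h3]
      exact h1
    rw [h2, smul_zero]
  · refine (colSnd_apply h δ u).trans ?_
    rw [hδ, SOpq.inv_mulVec_mulVec]
    have h3 : T (σ.symm (u, 0)) = σ.symm (0, L u) := by
      rw [← sub_eq_zero]
      refine stdForm_nondegenerate fun w => ?_
      rw [stdForm_symm, map_sub, LinearMap.sub_apply, hT, hΩ, stdForm_rpqSplit]
      simp [σ]
    change (σ (T (σ.symm (u, 0)))).2 = L u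
    rw [h3, LinearEquiv.apply_symm_apply]

variable {τ : Rpq p q ≃ₗ[ℝ] WittSpace ν (r + a) (s + b)}

/-- The members of the fiber in terms of the charts of the Grassmannian. -/
theorem fiberGr_eq_wittGr (hτ : IsWittFrame τ) (hi : i = r + s + ν)
    (hk : Module.finrank ℝ ((Fin ν → ℝ) × Rpq r s) = i)
    (h₀ h : SOpq (r + a) (s + b))
    (hu : IsUnit (colFst h₀ (SOpq.entries (r + a) (s + b) h))) :
    fiberGr hτ (Nat.le_add_right r a) (Nat.le_add_right s b) hi h =
      wittGr (coeffParam ν) (stdClm r s) (stdClm a b) (splitFrame (twistFrame τ h₀)) hk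
        ((0, colSlope h₀ (SOpq.entries (r + a) (s + b) h), 0), 0) := by
  symm
  apply Gr.eq_of_le
  intro v hv
  obtain ⟨⟨x, w⟩, rfl⟩ := (mem_wittGr_iff _ _ _ _ _ _ _).1 hv
  set v := wittParam (coeffParam ν) (stdClm r s) (stdClm a b) (splitFrame (twistFrame τ h₀))
        ((0, colSlope h₀ (SOpq.entries (r + a) (s + b) h), 0), 0) (x, w) with hvdef
  have h1 := apply_wittParam (coeffParam ν) (stdClm r s) (stdClm a b)
    (splitFrame (twistFrame τ h₀)) ((0, colSlope h₀ (SOpq.entries (r + a) (s + b) h), 0), 0) x w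
  rw [← hvdef, splitFrame_apply, twistFrame_apply] at h1
  have e1 := congrArg (fun z => z.2.1) h1
  have e2 := congrArg (fun z => z.2.2.1) h1
  have e3 := congrArg (fun z => z.2.2.2) h1
  simp only [Prod.fst_zero, Prod.snd_zero, zero_apply, add_zero] at e1 e2
  have e4 : (τ v).2.2 = 0 := by
    refine e3.trans (ContinuousLinearMap.ext fun y => ?_)
    simp
  rw [mem_fiberGr]
  refine ⟨?_, e4⟩
  -- The vector `u` is chosen so that the middle component is the image of `(u, 0)` under `h`; its
  -- coordinates relative to `h₀` are `w` and the slope applied to `w`.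
  let u := Ring.inverse (colFst h₀ (SOpq.entries (r + a) (s + b) h)) w
  have e5 : colFst h₀ (SOpq.entries (r + a) (s + b) h) u = w := by
    change (colFst h₀ (SOpq.entries (r + a) (s + b) h) *
      Ring.inverse (colFst h₀ (SOpq.entries (r + a) (s + b) h))) w = w
    rw [Ring.mul_inverse_cancel _ hu]
    rfl
  have e6 : colSnd h₀ (SOpq.entries (r + a) (s + b) h) u =
    colSlope h₀ (SOpq.entries (r + a) (s + b) h) w := rfl
  have e7 : (h₀⁻¹).1.1 *ᵥ (τ v).2.1 =
      (h₀⁻¹).1.1 *ᵥ (h.1.1 *ᵥ (rpqSplit r a s b).symm (u, 0)) := by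
    apply (rpqSplit r a s b).injective
    exact Prod.ext (e1.trans e5.symm) (e2.trans e6.symm)
  have e8 : (τ v).2.1 = h.1.1 *ᵥ (rpqSplit r a s b).symm (u, 0) := by
    have := congrArg (fun z => h₀.1.1 *ᵥ z) e7
    simpa only [SOpq.mulVec_inv_mulVec] using this
  rw [e8, SOpq.inv_mulVec_mulVec, mem_coordSubspace_iff, LinearEquiv.apply_symm_apply]

/-- The parameters which vanish on the fiber. -/
abbrev FiberCompl (ν r s a b : ℕ) : Type :=
  (((Fin ν → ℝ) →L[ℝ] Rpq r s) × ((Fin ν → ℝ) →L[ℝ] Rpq a b)) ×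
    ({p : Fin ν × Fin ν // p.1 < p.2} → ℝ) × (Sym2 (Fin ν) → ℝ)

/-- The fiber is an embedded submanifold and the map from the special orthogonal group to it is a
submersion. -/
theorem exists_fiber_submersion (hτ : IsWittFrame τ) (hi : i = r + s + ν) (N : Gr ν (Rpq p q))
    (hN : ∀ v, v ∈ N.1 ↔ (τ v).2 = 0) {F : Set (Gr i (Rpq p q))}
    (hF : ∀ W, W ∈ F ↔ W ∈ grOrbit p q i r s ∧ W.1 ⊓ (stdForm p q).orthogonal W.1 = N.1)
    (f : SOpq (r + a) (s + b) → F)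
    (hf : ∀ h, (f h).1 = fiberGr hτ (Nat.le_add_right r a) (Nat.le_add_right s b) hi h) :
    ∃ (dF : ℕ) (mF : EmbeddedManifold (GrModel i (Rpq p q)) (Subtype.val : F → Gr i (Rpq p q)) dF),
      (SOpq.manifold (r + a) (s + b)).IsSubmersion mF f := by
  have hd := wittData_stdClm r s a b
  have hk : Module.finrank ℝ ((Fin ν → ℝ) × Rpq r s) = i := (finrank_orbitParam ν r s).trans hi.symm
  have hdO := finrank_wittSlice (coeffParam ν) hd.bijective hd.symm₁ (splitFrame τ) hk
  let E := wittFiberEquiv (Fin ν → ℝ) (Rpq r s) (Rpq a b) ({p : Fin ν × Fin ν // p.1 < p.2} → ℝ)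
    (Sym2 (Fin ν) → ℝ)
  let eF : ((Rpq r s →L[ℝ] Rpq a b) × FiberCompl ν r s a b) ≃L[ℝ] GrModel i (Rpq p q) :=
    ContinuousLinearEquiv.ofFinrankEq (E.toLinearEquiv.finrank_eq.symm.trans hdO)
  have hfchart := fun h₀ : SOpq (r + a) (s + b) =>
    hd.exists_isSliceChart_fiber (coeffParam ν) hk (hτ.twistFrame h₀).wittForm_splitFrame
      (f h₀).1 (fun v => by
        rw [splitFrame_snd_snd_eq_zero_iff, hf]
        exact mem_standardSubspace _ _) N.1 (fun v => by
        rw [splitFrame_snd_eq_zero_iff, twistFrame_snd, hN]) F hF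
  have hchart : ∀ W : F, ∃ θ : OpenPartialHomeomorph (Gr i (Rpq p q))
      ((Rpq r s →L[ℝ] Rpq a b) × FiberCompl ν r s a b),
      IsSliceChart (GrModel i (Rpq p q)) (Subtype.val : F → Gr i (Rpq p q)) θ ∧ W.1 ∈ θ.source := by
    intro W
    obtain ⟨h1, h2⟩ := (hF W.1).1 W.2
    obtain ⟨h₀, e⟩ := exists_fiberGr_eq (hτ := hτ) (hr := Nat.le_add_right r a)
      (hs := Nat.le_add_right s b) (hi := hi) N hN h1 h2
    obtain ⟨θ, h3, h4, -⟩ := hfchart h₀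
    rw [hf, e] at h4
    exact ⟨θ, h3, h4⟩
  refine ⟨_, EmbeddedManifold.ofSlices IsEmbedding.subtypeVal
    (toEuclidean (E := Rpq r s →L[ℝ] Rpq a b)) eF hchart,
    EmbeddedManifold.isSubmersion_ofSlices isEmbedding_entries _ _ _ IsEmbedding.subtypeVal _ eF _ f
      fun h₀ => ?_⟩
  obtain ⟨θ, hθ, hs, hθ'⟩ := exists_isSliceChart_entries h₀
  obtain ⟨κ, hκ, hκs, hκ0, hκ'⟩ := hfchart h₀
  set X₀ := SOpq.entries (r + a) (s + b) h₀ with hX₀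
  have hsymm : θ.symm ((θ X₀).1, 0) = X₀ := by
    rw [← hθ.eq_mk_zero hs, θ.left_inv hs]
  have hmem : ((θ X₀).1, (0 : symMat (r + a) (s + b))) ∈ θ.target := by
    rw [← hθ.eq_mk_zero hs]
    exact θ.map_source hs
  have hpair : Continuous fun v : skewMat (r + a) (s + b) =>
    (v, (0 : symMat (r + a) (s + b))) := by fun_prop
  have hunit : IsUnit (colFst h₀ X₀) := by
    rw [colFst_self]
    exact isUnit_one
  have hsm : ContDiffOn ℝ ∞ θ.symm θ.target := contMDiffOn_iff_contDiffOn.1 hθ.contMDiffOn_symm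
  -- In the charts centred at `h₀` and at its image, the map sends a group element to the slope of
  -- the image of ℝ^(r,s).
  refine ⟨θ, κ, fun v => colSlope h₀ (θ.symm (v, 0)), hθ, hs, hκ, ?_, ?_, ?_⟩
  · have hc : ContinuousAt (SOpq.entries (r + a) (s + b)) h₀ :=
      isEmbedding_entries.continuous.continuousAt
    have h1 := hc.eventually (θ.open_source.mem_nhds hs)
    have h2 : ∀ᶠ h in 𝓝 h₀, IsUnit (colFst h₀ (SOpq.entries (r + a) (s + b) h)) :=
      ((colFst h₀).continuous.continuousAt.comp hc).eventually (Units.isOpen.mem_nhds hunit)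
    have h3 : ∀ᶠ h in 𝓝 h₀, (colSlope h₀ (SOpq.entries (r + a) (s + b) h),
        (0 : FiberCompl ν r s a b)) ∈ κ.target := by
      have h4 : ContinuousAt (fun h => (colSlope h₀ (SOpq.entries (r + a) (s + b) h),
          (0 : FiberCompl ν r s a b))) h₀ :=
        (ContinuousAt.comp (f := SOpq.entries (r + a) (s + b)) (g := colSlope h₀)
          (contDiffAt_colSlope hunit).continuousAt hc).prodMk continuousAt_const
      refine h4.eventually (κ.open_target.mem_nhds ?_)
      change (colSlope h₀ X₀, (0 : FiberCompl ν r s a b)) ∈ κ.target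
      rw [colSlope_self]
      have h5 := κ.map_source hκs
      rwa [hκ0] at h5
    filter_upwards [h1, h2, h3] with h hh1 hh2 hh3
    have h6 : (f h).1 = κ.symm (colSlope h₀ (SOpq.entries (r + a) (s + b) h),
        (0 : FiberCompl ν r s a b)) := by
      rw [hf, fiberGr_eq_wittGr hτ hi hk h₀ h hh2, hκ']
      rfl
    rw [h6]
    refine ⟨κ.map_target hh3, ?_⟩
    rw [κ.right_inv hh3]
    change colSlope h₀ (SOpq.entries (r + a) (s + b) h) = _
    rw [← hθ.eq_mk_zero hh1, θ.left_inv hh1]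
  · have h1 : ContinuousAt (fun v : skewMat (r + a) (s + b) => colFst h₀ (θ.symm (v, 0)))
        (θ X₀).1 :=
      (colFst h₀).continuous.continuousAt.comp
        (ContinuousAt.comp (f := fun v : skewMat (r + a) (s + b) =>
          (v, (0 : symMat (r + a) (s + b)))) (θ.symm.continuousAt hmem) hpair.continuousAt)
    have h2 : ∀ᶠ v in 𝓝 (θ X₀).1, IsUnit (colFst h₀ (θ.symm (v, 0))) := by
      refine h1.eventually (Units.isOpen.mem_nhds ?_)
      change IsUnit (colFst h₀ (θ.symm ((θ X₀).1, 0)))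
      rwa [hsymm]
    filter_upwards [h2, hpair.continuousAt.eventually (θ.open_target.mem_nhds hmem)] with v hv1 hv2
    exact ((contDiffAt_colSlope hv1).comp (v, (0 : symMat (r + a) (s + b)))
      ((hsm _ hv2).contDiffAt (θ.open_target.mem_nhds hv2))).comp v
        (contDiffAt_id.prodMk contDiffAt_const)
  · intro L
    -- A tangent vector of the group realizing `L`. Its second chart coordinate vanishes, so its
    -- first coordinate is a preimage of `L` under the derivative.
    obtain ⟨δ, hδ1, hδ2⟩ := exists_skew_colSnd h₀ L
    refine ⟨(isometryDeriv X₀ δ).1, ?_⟩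
    have h1 : HasFDerivAt θ.symm (fderiv ℝ θ.symm ((θ X₀).1, 0)) ((θ X₀).1, 0) :=
      (((hsm _ hmem).contDiffAt (θ.open_target.mem_nhds hmem)).differentiableAt
        (by simp)).hasFDerivAt
    have h2 : HasFDerivAt θ (isometryDeriv X₀) X₀ := by
      have h3 : (θ : MatSpace (r + a) (s + b) → _) = isometryMap X₀ := funext hθ'
      rw [h3]
      exact hasFDerivAt_isometryMap X₀
    have h1' := h1
    rw [← hθ.eq_mk_zero hs] at h1'
    have h4 := (h1'.comp X₀ h2).unique ((hasFDerivAt_id X₀).congr_of_eventuallyEq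
      (by filter_upwards [θ.open_source.mem_nhds hs] with X hX using θ.left_inv hX))
    have h5 : fderiv ℝ θ.symm ((θ X₀).1, 0) ((isometryDeriv X₀ δ).1, 0) = δ := by
      rw [← hθ.eq_mk_zero hs, ← hδ1]
      exact congrArg (fun T => T δ) h4
    have h6 : HasFDerivAt (colSlope h₀) (fderiv ℝ (colSlope h₀) X₀) (θ.symm ((θ X₀).1, 0)) := by
      rw [hsymm]
      exact ((contDiffAt_colSlope hunit).differentiableAt (by simp)).hasFDerivAt
    have h7 : HasFDerivAt (fun v : skewMat (r + a) (s + b) => (v, (0 : symMat (r + a) (s + b))))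
        (ContinuousLinearMap.inl ℝ _ _) (θ X₀).1 :=
      (hasFDerivAt_id _).prodMk (hasFDerivAt_const _ _)
    have h8 := HasFDerivAt.comp (θ X₀).1 (h6.comp ((θ X₀).1, 0) h1) h7
    have h9 : fderiv ℝ (fun v => colSlope h₀ (θ.symm (v, 0))) (θ X₀).1 = _ := h8.fderiv
    rw [h9]
    change fderiv ℝ (colSlope h₀) X₀
      (fderiv ℝ θ.symm ((θ X₀).1, 0) ((isometryDeriv X₀ δ).1, 0)) = L
    rw [h5, fderiv_colSlope, hδ2]

end FiberManifolds

end

noncomputable section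

/-! ### Assembly of the statements -/

section Assembly

variable {p q r s ν a b i : ℕ}

theorem mem_radical_iff_of_inStandardPosition {τ : Rpq p q ≃ₗ[ℝ] WittSpace ν a b}
    (hτ : IsWittFrame τ) {W : Submodule ℝ (Rpq p q)} (hW : InStandardPosition τ r s W)
    (v : Rpq p q) : v ∈ W ⊓ (stdForm p q).orthogonal W ↔ (τ v).2 = 0 := by
  rw [inStandardPosition_iff.1 hW]
  exact radical_standardSubspace hτ v

theorem finrank_eq_of_mem_iff {τ : Rpq p q ≃ₗ[ℝ] WittSpace ν a b} {N : Submodule ℝ (Rpq p q)}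
    (hN : ∀ v, v ∈ N ↔ (τ v).2 = 0) : Module.finrank ℝ N = ν := by
  have h : N = LinearMap.range (τ.symm.toLinearMap ∘ₗ LinearMap.inl ℝ (Fin ν → ℝ)
      (Rpq a b × ((Fin ν → ℝ) →L[ℝ] ℝ))) := by
    ext v
    rw [hN]
    constructor
    · intro h
      refine ⟨(τ v).1, ?_⟩
      apply τ.injective
      exact (τ.apply_symm_apply _).trans (Prod.ext rfl h.symm)
    · rintro ⟨x, rfl⟩
      exact congrArg Prod.snd (τ.apply_symm_apply (x, 0))
  rw [h]
  refine (LinearMap.finrank_range_of_inj ?_).trans (by simp)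
  exact τ.symm.injective.comp LinearMap.inl_injective

/-- The radicals of the subspaces in an orbit are isotropic subspaces. -/
theorem exists_radical_map (hi : i = r + s + ν) :
    ∃ π : grOrbit p q i r s → IGr ν p q,
      ∀ W, (π W).1.1 = W.1.1 ⊓ (stdForm p q).orthogonal W.1.1 := by
  refine ⟨fun W => ⟨⟨W.1.1 ⊓ (stdForm p q).orthogonal W.1.1, ?_⟩, ?_⟩, fun _ => rfl⟩
  · obtain ⟨h1, h2, h⟩ := exists_frame_of_hasSig W.2 (W.1.2.trans hi)
    obtain ⟨τ, hτ, hτW⟩ := h (p - ν) (q - ν) (by omega) (by omega)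
    exact finrank_eq_of_mem_iff (mem_radical_iff_of_inStandardPosition hτ hτW)
  · rintro x ⟨hx, -⟩ y ⟨-, hy⟩
    exact hy x hx

/-- An isometry commutes with taking orthogonal spaces, which gives equivariance of the radical map.
-/
theorem radical_smul {h : SLpq p q} (hh : h ∈ SOpq p q) (W : Gr i (Rpq p q)) {N : Gr ν (Rpq p q)}
    (hN : N.1 = W.1 ⊓ (stdForm p q).orthogonal W.1) :
    (h • W).1 ⊓ (stdForm p q).orthogonal (h • W).1 = (h • N).1 := by
  ext v
  rw [Gr.mem_smul_iff, hN]
  refine and_congr Gr.mem_smul_iff ⟨fun H w hw => ?_, fun H w hw => ?_⟩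
  · have h1 := H (h.1 *ᵥ w) (Gr.mulVec_mem_smul.2 hw)
    change stdForm p q _ _ = 0 at h1
    change stdForm p q _ _ = 0
    rw [← hh, SLpq.mulVec_inv_mulVec]
    exact h1
  · have h1 := H _ (Gr.mem_smul_iff.1 hw)
    change stdForm p q _ _ = 0 at h1
    change stdForm p q _ _ = 0
    rwa [← hh, SLpq.mulVec_inv_mulVec, SLpq.mulVec_inv_mulVec] at h1

/-- That the bijection is a diffeomorphism is expressed through its composition with the projection
from the group. This composite is a submersion whose fibers are the cosets, so it induces on the
quotient the smooth structure of the fiber. -/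
theorem exists_fiber_symmetricSpace (hi : i = r + s + ν) (ha : a + ν = p) (hb : b + ν = q)
    (hr : r ≤ a) (hs : s ≤ b) (π : grOrbit p q i r s → IGr ν p q)
    (hπ : ∀ W, (π W).1.1 = W.1.1 ⊓ (stdForm p q).orthogonal W.1.1) (N : IGr ν p q) :
    ∃ (dF : ℕ) (mF : EmbeddedManifold (GrModel i (Rpq p q))
        (Subtype.val : fiber π N → Gr i (Rpq p q)) dF)
      (Φ : (SOpq a b ⧸ SOO a b r s) ≃ fiber π N),
      (SOpq.manifold a b).IsSubmersion mF (fun h => Φ (QuotientGroup.mk h)) ∧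
      ∃ ρ : ↥(SOpq p q ⊓ MulAction.stabilizer (SLpq p q) N.1) →* SOpq a b,
        Function.Surjective ρ ∧ ∀ k x, (Φ (ρ k • x)).1 = k.1 • (Φ x).1 := by
  obtain ⟨a, rfl⟩ := Nat.exists_eq_add_of_le hr
  obtain ⟨b, rfl⟩ := Nat.exists_eq_add_of_le hs
  obtain ⟨τ, hτ, hN⟩ := (IsWittFrame.isotropic_iff N.1.2 ha hb).1 N.2
  obtain ⟨dF, mF, hmF⟩ := exists_fiber_submersion hτ hi N.1 hN (mem_fiber_radical_iff hπ N)
    (fun h => fiberEquiv hπ hτ hr hs hi N hN (QuotientGroup.mk h)) fun _ => rfl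
  exact ⟨dF, mF, fiberEquiv hπ hτ hr hs hi N hN, hmF, exists_fiber_hom hπ N hN⟩

/-- The base point of the symmetric space provides a member of each fiber. -/
theorem radical_map_surjective (hi : i = r + s + ν) (ha : a + ν = p) (hb : b + ν = q)
    (hr : r ≤ a) (hs : s ≤ b) (π : grOrbit p q i r s → IGr ν p q)
    (hπ : ∀ W, (π W).1.1 = W.1.1 ⊓ (stdForm p q).orthogonal W.1.1) : Function.Surjective π := by
  intro N
  obtain ⟨τ, hτ, hN⟩ := (IsWittFrame.isotropic_iff N.1.2 ha hb).1 N.2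
  obtain ⟨W, hW, h⟩ := (fiberEquiv hπ hτ hr hs hi N hN (QuotientGroup.mk 1)).2
  exact ⟨W, hW⟩

end Assembly

end

theorem proposition3p1 (p q i r s ν : ℕ) (hr : r ≤ p) (hs : s ≤ q) (hν : i = r + s + ν) :
    -- the sets `O_(r,s)` are orbits of `H = SO(p,q)` (except when `r = s = 0`, `p = q = ν`, where there are two if `ν > 0`)
    ((r + s ≠ 0 ∨ p ≠ ν ∨ q ≠ ν) →
      ∀ W ∈ grOrbit p q i r s, MulAction.orbit (SOpq p q) W = grOrbit p q i r s) ∧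
    -- non-emptiness
    ((grOrbit p q i r s).Nonempty ↔ ν ≤ min (p - r) (q - s)) ∧
    ((grOrbit p q i r s).Nonempty →
      ∃ (dO dI : ℕ)
        (mO : EmbeddedManifold (GrModel i (Rpq p q))
          (Subtype.val : grOrbit p q i r s → Gr i (Rpq p q)) dO)
        (mI : EmbeddedManifold (GrModel ν (Rpq p q))
          (Subtype.val : IGr ν p q → Gr ν (Rpq p q)) dI),
        -- codimension
        dO + ν * (ν + 1) / 2 = Module.finrank ℝ (GrModel i (Rpq p q)) ∧
        -- the equivariant surjective submersion
        ∃ π : grOrbit p q i r s → IGr ν p q,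
          mO.IsSubmersion mI π ∧
          Function.Surjective π ∧
          (∀ W, (π W).1.1 = W.1.1 ⊓ (stdForm p q).orthogonal W.1.1) ∧
          (∀ h ∈ SOpq p q, ∀ W : grOrbit p q i r s, ∃ hW : h • W.1 ∈ grOrbit p q i r s,
            (π ⟨h • W.1, hW⟩).1 = h • (π W).1) ∧
          -- the fibers
          ∃ (dS : ℕ) (mS : EmbeddedManifold (MatSpace (p - ν) (q - ν))
              (SOpq.entries (p - ν) (q - ν)) dS),
            ∀ N : IGr ν p q,
              ∃ (dF : ℕ) (mF : EmbeddedManifold (GrModel i (Rpq p q))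
                  (Subtype.val : fiber π N → Gr i (Rpq p q)) dF)
                (Φ : (SOpq (p - ν) (q - ν) ⧸ SOO (p - ν) (q - ν) r s) ≃ fiber π N),
                mS.IsSubmersion mF (fun h => Φ (QuotientGroup.mk h)) ∧
                ∃ ρ : ↥(SOpq p q ⊓ MulAction.stabilizer (SLpq p q) N.1) →*
                    SOpq (p - ν) (q - ν),
                  Function.Surjective ρ ∧ ∀ k x, (Φ (ρ k • x)).1 = k.1 • (Φ x).1) ∧
    -- the model of the fibers is a symmetric space
    (∃ σ : SOpq (p - ν) (q - ν) ≃* SOpq (p - ν) (q - ν),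
      Continuous σ ∧ (∀ h, σ (σ h) = h) ∧ ∀ h, σ h = h ↔ h ∈ SOO (p - ν) (q - ν) r s) ∧
    -- the isotropy group and the infinitesimal transversal
    ((grOrbit p q i r s).Nonempty → ∀ o : Gr i (Rpq p q),
      (∃ g : SLpq p q, g • o ∈ grOrbit p q i r s) ∧
      ∀ g : SLpq p q, g • o ∈ grOrbit p q i r s →
        ∃ ψ : isotropy o g →* GL (Fin ν) ℝ × SOO (p - ν) (q - ν) r s,
          Continuous ψ ∧ Function.Surjective ψ ∧ IsNaturalHom o g ψ ∧
          Nonempty (Representation.Equiv (transversalRep o g)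
            ((symRep ν).comp ((MonoidHom.fst _ _).comp ψ)))) := by
  have hne := grOrbit_nonempty_iff hν hr hs
  refine ⟨fun hpq W hW => grOrbit_eq_orbit hν hpq hW, hne, fun h => ?_,
    exists_blockInvolution _ _ _ _, fun h o => ⟨?_, fun g hg => ?_⟩⟩
  · have hle := hne.1 h
    rw [le_min_iff] at hle
    obtain ⟨π, hπ⟩ := exists_radical_map (p := p) (q := q) hν
    have ha : p - ν + ν = p := by omega
    have hb : q - ν + ν = q := by omega
    -- Here `a` and `b` count the coordinates left after removing `r`, `s` and `ν`; non-emptiness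
    -- makes these subtractions exact.
    obtain ⟨dO, dI, mO, mI, hd, hm⟩ := exists_radical_submersion (a := p - ν - r) (b := q - ν - s)
      hν (by omega) (by omega) (Set.ext fun N => mem_IGr_iff ha hb) π hπ
    refine ⟨dO, dI, mO, mI, hd, π, hm, radical_map_surjective hν ha hb (by omega) (by omega) π hπ, hπ,
      fun g hg W => ⟨SOpq.smul_mem_grOrbit hg W.2, ?_⟩, _, SOpq.manifold _ _, fun N =>
      exists_fiber_symmetricSpace hν ha hb (by omega) (by omega) π hπ N⟩
    exact Gr.ext ((hπ _).trans (radical_smul hg W.1 (hπ W)))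
  · obtain ⟨W, hW⟩ := h
    obtain ⟨g, hg⟩ := Gr.exists_smul_eq o W
    exact ⟨g, hg ▸ hW⟩
  · have hle := hne.1 h
    rw [le_min_iff] at hle
    obtain ⟨τ, hτ⟩ := exists_isAdaptedFrame (a := p - ν) (b := q - ν) hν hg (by omega) (by omega)
    exact ⟨naturalHom hτ, continuous_naturalHom hτ, naturalHom_surjective hτ,
      isNaturalHom_naturalHom hτ, nonempty_transversalRep_equiv hτ⟩
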